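/- We work in one of three settings: smooth manifolds, complex manifolds, or nonsingular varieties over an algebraically closed field of characteristic $0$; all functions, vector fields, sheaves and curves are those of the chosen setting, and $\mathbf A^1$ denotes the corresponding line. **Chart.** Let $k\ge 0$, let $S(k)$ be the $k$-th monster space over a surface $S$, and consider the standard chart of $S(k)$ specified by a set $IP\subseteq\{1,\dots,k\}$ of levels. It is $U\times\mathbf A^k$, where $U\subseteq S$ is a chart with coordinates $\mathbf r_0,\mathbf n_0$ (in the algebraic setting: an affine open set on which $d\mathbf r_0,d\mathbf n_0$ is a basis of the differentials), and it has coordinates $\mathbf r_0,\mathbf n_0,\mathbf n_1,\dots,\mathbf n_k$. Define recursively $\mathbf r_{j+1}=\mathbf n_j$, $\mathbf d_{j+1}=\mathbf r_j$ if $j+1\in IP$, and $\mathbf r_{j+1}=\mathbf r_j$, $\mathbf d_{j+1}=\mathbf n_j$ if $j+1\notin IP$. The focal sheaf $\Delta$ consists of the vector fields annihilated by $d\mathbf d_j-\mathbf n_j\,d\mathbf r_j$ for $1\le j\le k$. **Sheaves.** The small growth sheaves are $\Delta^1=\Delta$ and $\Delta^{h+1}$, the sheaf of modules generated by $\Delta^h$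 and the brackets $[\Delta,\Delta^h]$. The Lie square sheaves are $\Delta_1=\Delta$ and $\Delta_{i+1}$, generated by $\Delta_i$ and $[\Delta_i,\Delta_i]$. **Basis.** Let $v_i=\partial/\partial\mathbf n_i$ and $f_0=\partial/\partial\mathbf r_0$, and for $1\le i\le k$ let $f_i=\mathbf n_i f_{i-1}+v_{i-1}$ if $i\in IP$ and $f_i=f_{i-1}+\mathbf n_i v_{i-1}$ if $i\notin IP$. Let $g_0=f_k$, $g_1=v_k$, and for $2\le i\le k+1$ let $g_i=\pm f_{k-i+1}$ if $k-i+2\in IP$ and $g_i=\pm v_{k-i+1}$ if $k-i+2\notin IP$, with the signs for which $[g_0,g_i]=\bigl(\prod_{j\in IP,\ k-i+3\le j\le k}\mathbf n_j\bigr)g_{i+1}$ for $1\le i\le k$. **Orders.** Let $p$ be a point of the chart. The focal order $o(a)$ at $p$ of a function $a$ defined near $p$ is the minimum, over all regular parametrized curve germs $\gamma$ with $\gamma(0)=p$ that are tangent to $\Delta$, of the order of vanishing of $a\circ\gamma$ at $0$. Let $\operatorname{VO}_j=o(\mathbf n_j)$ if $j\in IP$ and $\operatorname{VO}_j=0$ if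 $j\notin IP$, and for $i\le\min\{h,k+1\}$ put $$e_{hi}=\max\Bigl\{0,\ -(h-i)+\sum_{j=k-i+4}^{k}(i+j-k-3)\operatorname{VO}_j\Bigr\}.$$ **Theorem.** For all $h\ge 3$ and $3\le i\le\min\{h,k+1\}$ there is a section $f_{hi}$ of $\Delta^h$ over the chart which can be written as $$f_{hi}=w+\sum_{j=4}^{\min\{h,k+1\}}c_{hj}\,g_j,$$ with $w$ a section of $\Delta_3$ of the form $w=\sum_{j=0}^{3}c_{hj}\,g_j$, and such that for every expression of this form the coefficient $c_{hi}$ has focal order exactly $e_{hi}$ at $p$. Moreover, $f_{hi}$ can be taken to be an iterated bracket $[g_{\varepsilon_1},[g_{\varepsilon_2},\dots,[g_{\varepsilon_m},g_3]\cdots]]$ with $m\le h-3$ and all $\varepsilon_l\in\{0,1\}$. -/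

import Mathlib

open scoped ContDiff

noncomputable section

namespace Goursat

/-!
Standard charts of the monster space `S(k)` over a surface `S`.

A chart is a copy of `U × 𝔸ᵏ`, where `U` is a chart of `S` with coordinates `r₀, n₀`, and has
the `k + 2` coordinates `r₀, n₀, n₁, …, n_k`.  They are numbered by natural numbers: `r₀` has
number `0` and `n_j` has number `j + 1`.  The chart is specified by the set
`IP ⊆ {1, …, k}` of levels at which the inverted choice is made
(the ordinary choice is made at the other levels).
-/

/-! ### Combinatorics of a chart and its standard vector fields -/

/-- The number of the retained coordinate `r_j`: `r_{j+1} = n_j` after an inverted choice and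
`r_{j+1} = r_j` after an ordinary one. -/
def retIdx (IP : Finset ℕ) : ℕ → ℕ
  | 0 => 0
  | j + 1 => if j + 1 ∈ IP then j + 1 else retIdx IP j

/-- The number of the deactivated coordinate `d_j`, `j ≥ 1`: `d_{j+1} = r_j` after an inverted
choice and `d_{j+1} = n_j` after an ordinary one (the value at `j = 0` is never used). -/
def deaIdx (IP : Finset ℕ) : ℕ → ℕ
  | 0 => 0
  | j + 1 => if j + 1 ∈ IP then retIdx IP j else j + 1

/-- The vector fields `f_i`, given the coordinate functions `x` and the coordinate vector fields
`d`: `f_0 = ∂/∂r₀`, `f_i = f_{i-1} + n_i v_{i-1}` (ordinary choice at level `i`),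
`f_i = n_i f_{i-1} + v_{i-1}` (inverted choice), where `v_i = ∂/∂n_i = d (i + 1)`. -/
def stdF {O M : Type*} [CommRing O] [AddCommGroup M] [Module O M]
    (IP : Finset ℕ) (x : ℕ → O) (d : ℕ → M) : ℕ → M
  | 0 => d 0
  | i + 1 =>
    if i + 1 ∈ IP then x (i + 2) • stdF IP x d i + d (i + 1)
    else stdF IP x d i + x (i + 2) • d (i + 1)

/-- The sign of `g_i`; it is the one for which
`[g_0, g_i] = (∏_{h ∈ IP, k-i+3 ≤ h ≤ k} n_h) g_{i+1}` for `1 ≤ i ≤ k`. -/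
def gSign (IP : Finset ℕ) (k : ℕ) : ℕ → ℤ
  | 0 => 1
  | 1 => 1
  | i + 2 => if k + 1 - i ∈ IP then gSign IP k (i + 1) else -gSign IP k (i + 1)

/-- The ordered basis `g_0, …, g_{k+1}`: `g_0 = f_k`, `g_1 = v_k`, and for `2 ≤ i ≤ k + 1`,
`g_i = ± v_{k-i+1}` if `k-i+2 ∉ IP` and `g_i = ± f_{k-i+1}` if `k-i+2 ∈ IP`. -/
def stdG {O M : Type*} [CommRing O] [AddCommGroup M] [Module O M]
    (IP : Finset ℕ) (k : ℕ) (x : ℕ → O) (d : ℕ → M) : ℕ → M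
  | 0 => stdF IP x d k
  | 1 => d (k + 1)
  | i + 2 => gSign IP k (i + 2) •
      (if k - i ∈ IP then stdF IP x d (k - i - 1) else d (k - i - 1 + 1))

/-- `[g_{ε₁}, [g_{ε₂}, … [g_{ε_m}, g_3] … ]]`, each `ε` being `0` or `1`. -/
def iterBracket {M : Type*} (br : M → M → M) (g : ℕ → M) : List (Fin 2) → M
  | [] => g 3
  | b :: l => br (g b) (iterBracket br g l)

/-- The function defining the divisor at infinity `I_j` in the chart: `n_j` if `j ∈ IP`,
and a unit otherwise, since then `I_j` does not meet the chart. -/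
def divisorEq {O : Type*} [CommRing O] (IP : Finset ℕ) (x : ℕ → O) (j : ℕ) : O :=
  if j ∈ IP then x (j + 1) else 1

/-- `e_{hi} = max (0, -(h - i) + ∑_{j=k-i+4}^k (i + j - k - 3) VO_j)`, for `i ≤ h`, `i ≤ k + 1`
and given vertical orders `VO_j`.  The subtraction of `ℕ∞` is truncated at `0`. -/
def eInv (k : ℕ) (VO : ℕ → ℕ∞) (h i : ℕ) : ℕ∞ :=
  (∑ j ∈ Finset.Icc (k + 4 - i) k, ((i + j - (k + 3) : ℕ) : ℕ∞) * VO j) - ((h - i : ℕ) : ℕ∞)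

/-! ### Smooth (`𝕜 = ℝ`) and holomorphic (`𝕜 = ℂ`) setting -/

namespace Mfd

variable (𝕜 : Type*) [RCLike 𝕜] (k : ℕ)

/-- The ambient space of a standard chart. -/
abbrev Space : Type _ := Fin (k + 2) → 𝕜

/-- The coordinate function with number `i ≤ k + 1`; also its differential. -/
def coord (i : ℕ) : Space 𝕜 k → 𝕜 := fun q => if h : i < k + 2 then q ⟨i, h⟩ else 0

/-- The coordinate vector field with number `i ≤ k + 1`. -/
def partialField (i : ℕ) : Space 𝕜 k → Space 𝕜 k :=
  fun _ => if h : i < k + 2 then Pi.single ⟨i, h⟩ 1 else 0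

/-- The chart `U × 𝕜ᵏ`. -/
def chart (U : Set (𝕜 × 𝕜)) : Set (Space 𝕜 k) :=
  {q | (coord 𝕜 k 0 q, coord 𝕜 k 1 q) ∈ U}

/-- The basis `g_0, …, g_{k+1}` of vector fields on the chart. -/
def gField (IP : Finset ℕ) : ℕ → Space 𝕜 k → Space 𝕜 k :=
  stdG (O := Space 𝕜 k → 𝕜) (M := Space 𝕜 k → Space 𝕜 k) IP k (coord 𝕜 k) (partialField 𝕜 k)

/-- The fibre at `q` of the focal distribution `Δ`: tangent vectors annihilated by
`d d_j - n_j d r_j` for `j = 1, …, k`. -/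
def FocalAt (IP : Finset ℕ) (q ξ : Space 𝕜 k) : Prop :=
  ∀ j ∈ Finset.Icc 1 k,
    coord 𝕜 k (deaIdx IP j) ξ = coord 𝕜 k (j + 1) q * coord 𝕜 k (retIdx IP j) ξ

/-- Sections over `W` of the focal sheaf `Δ`. -/
def FocalSection (IP : Finset ℕ) (W : Set (Space 𝕜 k)) (X : Space 𝕜 k → Space 𝕜 k) : Prop :=
  IsOpen W ∧ ContDiffOn 𝕜 ∞ X W ∧ ∀ q ∈ W, FocalAt 𝕜 k IP q (X q)

/-- `Generated 𝕜 k G W X`: over the open set `W`, the vector field `X` is a section of the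
sheaf of modules (over the sheaf of smooth, resp. holomorphic, functions) generated by `G`. -/
inductive Generated (G : Set (Space 𝕜 k) → (Space 𝕜 k → Space 𝕜 k) → Prop) :
    Set (Space 𝕜 k) → (Space 𝕜 k → Space 𝕜 k) → Prop
  | basic {W X} (hW : IsOpen W) (h : G W X) : Generated G W X
  | zero {W} (hW : IsOpen W) : Generated G W 0
  | add {W X Y} (hX : Generated G W X) (hY : Generated G W Y) : Generated G W (X + Y)
  | smul {W X} (a : Space 𝕜 k → 𝕜) (ha : ContDiffOn 𝕜 ∞ a W) (hX : Generated G W X) :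
      Generated G W (fun q => a q • X q)
  | restrict {W W' X} (hW' : IsOpen W') (hsub : W' ⊆ W) (hX : Generated G W X) :
      Generated G W' X
  | glue {W X} (N : Space 𝕜 k → Set (Space 𝕜 k)) (hW : IsOpen W)
      (hmem : ∀ q ∈ W, q ∈ N q ∧ N q ⊆ W) (hX : ∀ q ∈ W, Generated G (N q) X) :
      Generated G W X
  | congr {W X Y} (hXY : Set.EqOn X Y W) (hX : Generated G W X) : Generated G W Y

/-- Sections of the small growth sheaves `Δ^h`, `h ≥ 1`: `Δ^1 = Δ`, and `Δ^{h+1}` is generated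
by `Δ^h` and the brackets of sections of `Δ` with sections of `Δ^h`. -/
def SmallGrowth (IP : Finset ℕ) : ℕ → Set (Space 𝕜 k) → (Space 𝕜 k → Space 𝕜 k) → Prop
  | 0 => FocalSection 𝕜 k IP
  | 1 => FocalSection 𝕜 k IP
  | h + 2 => Generated 𝕜 k fun W X => SmallGrowth IP (h + 1) W X ∨
      ∃ Y Z, FocalSection 𝕜 k IP W Y ∧ SmallGrowth IP (h + 1) W Z ∧
        X = VectorField.lieBracket 𝕜 Y Z

/-- Sections of the sheaves `Δ_i`, `i ≥ 1`, of the Lie square sequence: `Δ_1 = Δ`, and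
`Δ_{i+1}` is generated by `Δ_i` and the brackets of sections of `Δ_i`. -/
def LieSquare (IP : Finset ℕ) : ℕ → Set (Space 𝕜 k) → (Space 𝕜 k → Space 𝕜 k) → Prop
  | 0 => FocalSection 𝕜 k IP
  | 1 => FocalSection 𝕜 k IP
  | i + 2 => Generated 𝕜 k fun W X => LieSquare IP (i + 1) W X ∨
      ∃ Y Z, LieSquare IP (i + 1) W Y ∧ LieSquare IP (i + 1) W Z ∧
        X = VectorField.lieBracket 𝕜 Y Z

/-- Regular parametrized focal curve germs through `p`. -/
structure FocalCurve (IP : Finset ℕ) (p : Space 𝕜 k) (γ : 𝕜 → Space 𝕜 k) : Prop where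
  smooth : ∀ᶠ t in nhds (0 : 𝕜), ContDiffAt 𝕜 ∞ γ t
  start : γ 0 = p
  regular : deriv γ 0 ≠ 0
  focal : ∀ᶠ t in nhds (0 : 𝕜), FocalAt 𝕜 k IP (γ t) (deriv γ t)

/-- The order of vanishing at `0` of a function of one variable. -/
def vanishingOrder (φ : 𝕜 → 𝕜) : ℕ∞ :=
  ⨅ (n : ℕ) (_ : iteratedDeriv n φ 0 ≠ 0), (n : ℕ∞)

/-- The focal order at `p` of a function `a`: the minimum over all focal curve germs through `p`
of the order of vanishing of `a` along the curve. -/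
def focalOrder (IP : Finset ℕ) (p : Space 𝕜 k) (a : Space 𝕜 k → 𝕜) : ℕ∞ :=
  ⨅ (γ : 𝕜 → Space 𝕜 k) (_ : FocalCurve 𝕜 k IP p γ), vanishingOrder 𝕜 (a ∘ γ)

/-- The vertical order `VO_j` of `p`: the focal order of the function defining `I_j`. -/
def verticalOrder (IP : Finset ℕ) (p : Space 𝕜 k) (j : ℕ) : ℕ∞ :=
  focalOrder 𝕜 k IP p (divisorEq (O := Space 𝕜 k → 𝕜) IP (coord 𝕜 k) j)

/-- Over `V`, the field `X` is written as `w + ∑_{j=4}^{min(h,k+1)} c_j g_j` with `w` a section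
of `Δ_3`, and `w` itself is written as `c_0 g_0 + c_1 g_1 + c_2 g_2 + c_3 g_3`. -/
def StructureForm (IP : Finset ℕ) (V : Set (Space 𝕜 k)) (h : ℕ) (X w : Space 𝕜 k → Space 𝕜 k)
    (c : ℕ → Space 𝕜 k → 𝕜) : Prop :=
  LieSquare 𝕜 k IP 3 V w ∧ (∀ j, ContDiffOn 𝕜 ∞ (c j) V) ∧
  (∀ q ∈ V, w q = ∑ j ∈ Finset.range 4, c j q • gField 𝕜 k IP j q) ∧
  ∀ q ∈ V, X q = w q + ∑ j ∈ Finset.Icc 4 (min h (k + 1)), c j q • gField 𝕜 k IP j q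

end Mfd

/-! ### Algebraic setting

`U` is an affine open of a nonsingular surface over `F`, with ring of functions `A`, on which
`r₀, n₀` are coordinates: their differentials form a basis `b` of the module of differentials.
The chart `U × 𝔸ᵏ` is affine, with ring of functions `A[n₁, …, n_k]`; vector fields are
derivations, and the (coherent) sheaves are given by their modules of global sections. -/

namespace Alg

/-- The extension of a derivation of `A` to `A[n₁, …, n_k]` with `n_j ↦ 0`
(differentiation of the coefficients). -/
def mapCoeffs {F A σ : Type*} [Field F] [CommRing A] [Algebra F A] (D : Derivation F A A) :
    Derivation F (MvPolynomial σ A) (MvPolynomial σ A) :=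
  have key : ∀ (p : MvPolynomial σ A) (m : σ →₀ ℕ),
      MvPolynomial.coeff m (∑ u ∈ p.support, MvPolynomial.monomial u (D (p.coeff u))) =
        D (MvPolynomial.coeff m p) := by
    classical
    intro p m
    rw [MvPolynomial.coeff_sum]
    simp only [MvPolynomial.coeff_monomial, Finset.sum_ite_eq']
    split_ifs with h
    · rfl
    · rw [MvPolynomial.notMem_support_iff.1 h, map_zero]
  Derivation.mk'
    { toFun := fun p => ∑ u ∈ p.support, MvPolynomial.monomial u (D (p.coeff u))
      map_add' := fun p q => by
        ext m
        rw [MvPolynomial.coeff_add, key, key, key, MvPolynomial.coeff_add, map_add]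
      map_smul' := fun a p => by
        ext m
        rw [RingHom.id_apply, MvPolynomial.coeff_smul, key, key, MvPolynomial.coeff_smul,
          Derivation.map_smul] }
    (fun p q => by
      classical
      ext m
      simp only [LinearMap.coe_mk, AddHom.coe_mk, smul_eq_mul]
      rw [key, MvPolynomial.coeff_add, MvPolynomial.coeff_mul, MvPolynomial.coeff_mul,
        mul_comm q, MvPolynomial.coeff_mul, map_sum, ← Finset.sum_add_distrib]
      refine Finset.sum_congr rfl fun u _ => ?_
      rw [key, key, Derivation.leibniz, smul_eq_mul, smul_eq_mul]
      ring)

variable (F : Type*) [Field F] {A : Type*} [CommRing A] [Algebra F A] (k : ℕ)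

/-- The ring of functions of the chart `U × 𝔸ᵏ`, where `A` is that of `U`. -/
abbrev Func (A : Type*) [CommRing A] (k : ℕ) : Type _ := MvPolynomial (Fin k) A

/-- The coordinate function with number `i ≤ k + 1`. -/
def coord (r₀ n₀ : A) : ℕ → Func A k
  | 0 => MvPolynomial.C r₀
  | 1 => MvPolynomial.C n₀
  | i + 2 => if h : i < k then MvPolynomial.X ⟨i, h⟩ else 0

/-- The coordinate vector field with number `i ≤ k + 1`. -/
def partialField (b : Module.Basis (Fin 2) A Ω[A⁄F]) :
    ℕ → Derivation F (Func A k) (Func A k)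
  | 0 => mapCoeffs ((b.coord 0).compDer (KaehlerDifferential.D F A))
  | 1 => mapCoeffs ((b.coord 1).compDer (KaehlerDifferential.D F A))
  | i + 2 => if h : i < k then (MvPolynomial.pderiv (R := A) ⟨i, h⟩).restrictScalars F else 0

/-- The basis `g_0, …, g_{k+1}` of vector fields on the chart. -/
def gField (IP : Finset ℕ) (r₀ n₀ : A) (b : Module.Basis (Fin 2) A Ω[A⁄F]) :
    ℕ → Derivation F (Func A k) (Func A k) :=
  stdG (O := Func A k) IP k (coord k r₀ n₀) (partialField F k b)

/-- The sections of the focal sheaf `Δ`: vector fields annihilated by `d d_j - n_j d r_j` for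
`j = 1, …, k`. -/
def focal (IP : Finset ℕ) (r₀ n₀ : A) :
    Submodule (Func A k) (Derivation F (Func A k) (Func A k)) where
  carrier := {X | ∀ j ∈ Finset.Icc 1 k, X (coord k r₀ n₀ (deaIdx IP j)) =
    coord k r₀ n₀ (j + 1) * X (coord k r₀ n₀ (retIdx IP j))}
  add_mem' := fun {X Y} hX hY j hj => by
    rw [Derivation.add_apply, Derivation.add_apply, hX j hj, hY j hj, mul_add]
  zero_mem' := fun j _ => by
    rw [Derivation.zero_apply, Derivation.zero_apply, mul_zero]
  smul_mem' := fun a X hX j hj => by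
    rw [Derivation.smul_apply, Derivation.smul_apply, hX j hj, smul_eq_mul, smul_eq_mul]
    ring

/-- The sections of the small growth sheaves `Δ^h`, `h ≥ 1`: `Δ^1 = Δ`, and `Δ^{h+1}` is
generated by `Δ^h` and the brackets of sections of `Δ` with sections of `Δ^h`. -/
def smallGrowth (IP : Finset ℕ) (r₀ n₀ : A) :
    ℕ → Submodule (Func A k) (Derivation F (Func A k) (Func A k))
  | 0 => focal F k IP r₀ n₀
  | 1 => focal F k IP r₀ n₀
  | h + 2 => smallGrowth IP r₀ n₀ (h + 1) ⊔ Submodule.span (Func A k)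
      {X | ∃ Y ∈ focal F k IP r₀ n₀, ∃ Z ∈ smallGrowth IP r₀ n₀ (h + 1), X = ⁅Y, Z⁆}

/-- The sections of the sheaves `Δ_i`, `i ≥ 1`, of the Lie square sequence: `Δ_1 = Δ`, and
`Δ_{i+1}` is generated by `Δ_i` and the brackets of sections of `Δ_i`. -/
def lieSquare (IP : Finset ℕ) (r₀ n₀ : A) :
    ℕ → Submodule (Func A k) (Derivation F (Func A k) (Func A k))
  | 0 => focal F k IP r₀ n₀
  | 1 => focal F k IP r₀ n₀
  | i + 2 => lieSquare IP r₀ n₀ (i + 1) ⊔ Submodule.span (Func A k)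
      {X | ∃ Y ∈ lieSquare IP r₀ n₀ (i + 1), ∃ Z ∈ lieSquare IP r₀ n₀ (i + 1), X = ⁅Y, Z⁆}

/-- Regular parametrized focal curve germs through the point `p`.  A germ of a nonsingular
algebraic curve with a local parameter `t` is a homomorphism to power series in `t` all of
whose values are algebraic over `F[t]`. -/
structure FocalCurve (IP : Finset ℕ) (r₀ n₀ : A) (p : Func A k →ₐ[F] F)
    (γ : Func A k →ₐ[F] PowerSeries F) : Prop where
  algebraic : ∀ a, IsAlgebraic (Polynomial F) (γ a)
  start : ∀ a, PowerSeries.constantCoeff (γ a) = p a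
  regular : ∃ a, PowerSeries.coeff 1 (γ a) ≠ 0
  focal : ∀ j ∈ Finset.Icc 1 k,
    PowerSeries.derivative F (γ (coord k r₀ n₀ (deaIdx IP j))) =
      γ (coord k r₀ n₀ (j + 1)) * PowerSeries.derivative F (γ (coord k r₀ n₀ (retIdx IP j)))

/-- The focal order at `p` of a function `a`: the minimum over all focal curve germs through `p`
of the order of vanishing of `a` along the curve. -/
def focalOrder (IP : Finset ℕ) (r₀ n₀ : A) (p : Func A k →ₐ[F] F) (a : Func A k) : ℕ∞ :=
  ⨅ (γ : Func A k →ₐ[F] PowerSeries F) (_ : FocalCurve F k IP r₀ n₀ p γ), (γ a).order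

/-- The vertical order `VO_j` of `p`: the focal order of the function defining `I_j`. -/
def verticalOrder (IP : Finset ℕ) (r₀ n₀ : A) (p : Func A k →ₐ[F] F) (j : ℕ) : ℕ∞ :=
  focalOrder F k IP r₀ n₀ p (divisorEq IP (coord k r₀ n₀) j)

/-- The field `X` is written as `w + ∑_{j=4}^{min(h,k+1)} c_j g_j` with `w` a section
of `Δ_3`, and `w` itself is written as `c_0 g_0 + c_1 g_1 + c_2 g_2 + c_3 g_3`. -/
def StructureForm (IP : Finset ℕ) (r₀ n₀ : A) (b : Module.Basis (Fin 2) A Ω[A⁄F]) (h : ℕ)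
    (X w : Derivation F (Func A k) (Func A k)) (c : ℕ → Func A k) : Prop :=
  w ∈ lieSquare F k IP r₀ n₀ 3 ∧
  w = ∑ j ∈ Finset.range 4, c j • gField F k IP r₀ n₀ b j ∧
  X = w + ∑ j ∈ Finset.Icc 4 (min h (k + 1)), c j • gField F k IP r₀ n₀ b j

end Alg

end Goursat

end

open scoped ContDiff

noncomputable section

namespace Goursat

/-! ### Calculus of vector fields -/

/-! Write a field as a combination of the `g_j` with `j ≥ 3`. Bracketing it with `g_1` only
differentiates the coefficients. Bracketing it with `g_0` also moves `g_j` to `g_{j+1}`, multiplied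
by a product of coordinates `n_l`, `l ∈ IP`. Both derivations send every `n_j` to `0` or to a
monomial with coefficient one. Hence the coefficient of `g_i` in the bracket of a word is a
universal polynomial in the `n_j` with natural coefficients, the same in all settings (`coeffPoly`,
`IsFrame.iterBracket_eq`). It is the only possible coefficient, whatever `w` is, because the forms
`d d_j - n_j d r_j` are triangular on the `g_i` (`coeff_eq_of_triangular`).

All focal orders are computed on one curve, the integral curve of `g_0 + g_1` through `p`. On it
`n_k' = 1`, and `n_j'` is a product of later coordinates. Let the weight of `n_j` be its order along
this curve. Any other focal curve satisfies the same equations for `j < k` up to a common factor, so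
integrating downwards from `n_k` shows that no `n_j` vanishes to lower order on it
(`IsGenericSeries.X_pow_dvd`). Thus `VO_j` is the weight of `n_j` for `j ∈ IP`, and a monomial of
weight `s` has order at least `s` along every focal curve.

It remains to exclude cancellation on the generic curve. If `n_j` has positive weight, its
derivative has weight one less and leading coefficient multiplied by a positive integer. So
differentiation lowers weights by at most one, and all monomials of the least possible weight have
leading coefficients that are positive rational multiples of one constant (`leadSet`,
`IsLeadingData.coeffPoly_mem`). In characteristic zero these cannot sum to zero.

The word is built as follows. After `i - 3` brackets with `g_0` the coefficient of `g_i` is a single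
monomial, of weight `E = ∑ (i + j - k - 3) VO_j` (`wt_leadProd`). While the weight is positive, some
factor `n_j` has positive weight. Bracketing with `g_1` if `j = k`, and with `g_0` otherwise,
differentiates this factor and lowers the weight by exactly one (`IsLeadingData.exists_word`). Up to
`h - i` such steps are available, which gives order `max (0, E - (h - i))`.

The generic curve has polynomial coordinates. In the algebraic setting it is a formal flow, and all
functions are algebraic along it because `dr₀, dn₀` span the differentials (`isAlgebraic_of_coord`).
-/

/-- Vector fields `M` acting on functions `O` and having a bracket, such that the usual rules hold
for the smooth functions and the smooth fields. -/
structure VFCalculus (O M : Type*) [CommRing O] [AddCommGroup M] [Module O M] where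
  /-- the derivative of a function along a field -/
  act : M → O → O
  /-- the bracket of fields -/
  br : M → M → M
  /-- the smooth functions -/
  smoothFun : Subring O
  /-- the smooth fields -/
  smoothField : AddSubgroup M
  smul_mem : ∀ {a X}, a ∈ smoothFun → X ∈ smoothField → a • X ∈ smoothField
  act_add_left : ∀ X Y a, act (X + Y) a = act X a + act Y a
  act_smul_left : ∀ b X a, act (b • X) a = b * act X a
  act_add : ∀ X {a b}, a ∈ smoothFun → b ∈ smoothFun → act X (a + b) = act X a + act X b
  act_mul : ∀ X {a b}, a ∈ smoothFun → b ∈ smoothFun →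
    act X (a * b) = a * act X b + b * act X a
  br_swap : ∀ X Y, br X Y = -br Y X
  br_add : ∀ X {Y Z}, Y ∈ smoothField → Z ∈ smoothField → br X (Y + Z) = br X Y + br X Z
  br_smul : ∀ X {a Y}, a ∈ smoothFun → Y ∈ smoothField →
    br X (a • Y) = act X a • Y + a • br X Y

/-- `∏ n_l` over the levels `l ∈ IP` with `j < l ≤ k`. -/
def tailProd {R : Type*} [CommMonoid R] (IP : Finset ℕ) (k : ℕ) (n : ℕ → R) (j : ℕ) : R :=
  ∏ l ∈ (Finset.Ioc j k).filter (· ∈ IP), n l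

/-- The derivative of `n_j` along `g_0`, for `j < k`. -/
def derivCoeff {R : Type*} [CommMonoid R] (IP : Finset ℕ) (k : ℕ) (n : ℕ → R) (j : ℕ) : R :=
  (if j + 1 ∈ IP then 1 else n (j + 1)) * tailProd IP k n (j + 1)

/-! ### Products of the inverted coordinates -/

section tailProd

variable {R : Type*} [CommMonoid R] (IP : Finset ℕ) (n : ℕ → R)

lemma tailProd_of_le {j k : ℕ} (h : k ≤ j) : tailProd IP k n j = 1 := by
  simp [tailProd, Finset.Ioc_eq_empty_of_le h]

lemma tailProd_succ_top {j k : ℕ} (h : j ≤ k) :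
    tailProd IP (k + 1) n j = (if k + 1 ∈ IP then n (k + 1) else 1) * tailProd IP k n j := by
  have : Finset.Ioc j (k + 1) = insert (k + 1) (Finset.Ioc j k) := by
    ext a; simp only [Finset.mem_Ioc, Finset.mem_insert]; omega
  unfold tailProd
  rw [this, Finset.filter_insert]
  split_ifs with h1
  · rw [Finset.prod_insert]; simp
  · rw [one_mul]

lemma tailProd_eq_mul {j k : ℕ} (h : j < k) :
    tailProd IP k n j = (if j + 1 ∈ IP then n (j + 1) else 1) * tailProd IP k n (j + 1) := by
  have : Finset.Ioc j k = insert (j + 1) (Finset.Ioc (j + 1) k) := by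
    ext a; simp only [Finset.mem_Ioc, Finset.mem_insert]; omega
  unfold tailProd
  rw [this, Finset.filter_insert]
  split_ifs with h1
  · rw [Finset.prod_insert]; simp
  · rw [one_mul]

lemma map_tailProd {S F : Type*} [CommMonoid S] [FunLike F R S] [MonoidHomClass F R S] (φ : F)
    (k j : ℕ) : φ (tailProd IP k n j) = tailProd IP k (fun l => φ (n l)) j :=
  map_prod φ _ _

lemma map_derivCoeff {S F : Type*} [CommMonoid S] [FunLike F R S] [MonoidHomClass F R S] (φ : F)
    (k j : ℕ) : φ (derivCoeff IP k n j) = derivCoeff IP k (fun l => φ (n l)) j := by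
  simp only [derivCoeff, map_mul, map_tailProd]
  split_ifs <;> simp

lemma tailProd_congr {n' : ℕ → R} {k j : ℕ} (h : ∀ l, j < l → l ≤ k → n l = n' l) :
    tailProd IP k n j = tailProd IP k n' j :=
  Finset.prod_congr rfl fun l hl => by
    simp only [Finset.mem_filter, Finset.mem_Ioc] at hl
    exact h l hl.1.1 hl.1.2

/-- Only coordinates of level above `j` enter, so the equations `n_j' = derivCoeff` can be solved
one at a time from `n_k` downwards. -/
lemma derivCoeff_congr {n' : ℕ → R} {k j : ℕ} (hj : j < k)
    (h : ∀ l, j < l → l ≤ k → n l = n' l) :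
    derivCoeff IP k n j = derivCoeff IP k n' j := by
  unfold derivCoeff
  rw [tailProd_congr IP n (fun l h1 h2 => h l (by omega) h2), h (j + 1) (by omega) (by omega)]

end tailProd

/-- `v` or `f` at level `j - 1`, whichever completes `f_j` to a basis of the span of
`f_{j-1}, v_{j-1}` (and `0` at `j = 0`). -/
def complField {O M : Type*} [CommRing O] [AddCommGroup M] [Module O M]
    (IP : Finset ℕ) (x : ℕ → O) (d : ℕ → M) : ℕ → M
  | 0 => 0
  | j + 1 => if j + 1 ∈ IP then stdF IP x d j else d (j + 1)

lemma gSign_eq (IP : Finset ℕ) (k i : ℕ) : gSign IP k i = 1 ∨ gSign IP k i = -1 := by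
  induction i using Nat.strongRecOn with
  | ind i ih =>
    match i with
    | 0 => exact Or.inl rfl
    | 1 => exact Or.inl rfl
    | i + 2 =>
      rw [gSign]
      rcases ih (i + 1) (by omega) with h | h <;> split_ifs <;> simp [h]

section frameFree

variable {O M : Type*} [CommRing O] [AddCommGroup M] [Module O M]
  (IP : Finset ℕ) (x : ℕ → O) (d : ℕ → M)

lemma stdF_succ (i : ℕ) : stdF IP x d (i + 1) =
    if i + 1 ∈ IP then x (i + 2) • stdF IP x d i + d (i + 1)
    else stdF IP x d i + x (i + 2) • d (i + 1) := rfl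

lemma stdG_add_two {k i : ℕ} (h : i < k) :
    stdG IP k x d (i + 2) = gSign IP k (i + 2) • complField IP x d (k - i) := by
  obtain ⟨m, hm⟩ : ∃ m, k - i = m + 1 := ⟨k - i - 1, by omega⟩
  rw [stdG, hm, complField]
  simp

end frameFree

namespace VFCalculus

variable {O M : Type*} [CommRing O] [AddCommGroup M] [Module O M] (V : VFCalculus O M)

/-- Coordinates `x_0, …, x_K` with their coordinate vector fields `d_0, …, d_K`; the further
coordinates are `0`. -/
structure IsFrame (K : ℕ) (x : ℕ → O) (d : ℕ → M) : Prop where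
  x_mem : ∀ i, x i ∈ V.smoothFun
  d_mem : ∀ i, d i ∈ V.smoothField
  x_eq_zero : ∀ i, K < i → x i = 0
  act_d : ∀ i j, i ≤ K → j ≤ K → V.act (d i) (x j) = if i = j then 1 else 0
  br_d : ∀ i j, i ≤ K → j ≤ K → V.br (d i) (d j) = 0

lemma act_one (X : M) : V.act X 1 = 0 := by
  have := V.act_mul X V.smoothFun.one_mem V.smoothFun.one_mem
  simpa using this

lemma act_zero (X : M) : V.act X 0 = 0 := by
  have := V.act_add X V.smoothFun.zero_mem V.smoothFun.zero_mem
  simpa using this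

lemma act_natCast (X : M) (n : ℕ) : V.act X n = 0 := by
  induction n with
  | zero => rw [Nat.cast_zero, act_zero]
  | succ n ih =>
    rw [Nat.cast_succ, V.act_add X (natCast_mem _ n) V.smoothFun.one_mem, ih, act_one, add_zero]

lemma br_zero (X : M) : V.br X 0 = 0 := by
  have := V.br_add X V.smoothField.zero_mem V.smoothField.zero_mem
  simpa using this

lemma br_neg (X : M) {Y : M} (hY : Y ∈ V.smoothField) : V.br X (-Y) = -V.br X Y := by
  have := V.br_add X hY (V.smoothField.neg_mem hY)
  rw [add_neg_cancel, br_zero] at this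
  exact (neg_eq_of_add_eq_zero_right this.symm).symm

lemma br_sign (X : M) {Y : M} (hY : Y ∈ V.smoothField) {s : ℤ} (hs : s = 1 ∨ s = -1) :
    V.br X (s • Y) = s • V.br X Y := by
  rcases hs with rfl | rfl
  · simp
  · simp [V.br_neg X hY]

lemma br_sum (X : M) {ι : Type*} (s : Finset ι) (Y : ι → M) (hY : ∀ i ∈ s, Y i ∈ V.smoothField) :
    V.br X (∑ i ∈ s, Y i) = ∑ i ∈ s, V.br X (Y i) := by
  classical
  induction s using Finset.induction_on with
  | empty => simp [br_zero]
  | insert a s ha ih =>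
    rw [Finset.sum_insert ha, Finset.sum_insert ha, V.br_add X (hY a (by simp))
      (sum_mem fun i hi => hY i (by simp [hi])), ih fun i hi => hY i (by simp [hi])]

/-- The differential of a function, as a linear form on vector fields. -/
def diff (a : O) : M →ₗ[O] O where
  toFun X := V.act X a
  map_add' X Y := V.act_add_left X Y a
  map_smul' b X := V.act_smul_left b X a

@[simp] lemma diff_apply (a : O) (X : M) : V.diff a X = V.act X a := rfl

variable {V} {K : ℕ} {x : ℕ → O} {d : ℕ → M} (hf : V.IsFrame K x d) (IP : Finset ℕ)
include hf

/-! ### Brackets of the fields `f_i` and `v_i` -/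

namespace IsFrame

lemma stdF_mem (m : ℕ) : stdF IP x d m ∈ V.smoothField := by
  induction m with
  | zero => exact hf.d_mem 0
  | succ m ih =>
    rw [stdF_succ]
    split_ifs
    · exact add_mem (V.smul_mem (hf.x_mem _) ih) (hf.d_mem _)
    · exact add_mem ih (V.smul_mem (hf.x_mem _) (hf.d_mem _))

lemma complField_mem (m : ℕ) : complField IP x d m ∈ V.smoothField := by
  cases m with
  | zero => exact V.smoothField.zero_mem
  | succ m =>
    rw [complField]
    split_ifs
    · exact hf.stdF_mem IP m
    · exact hf.d_mem _

lemma stdG_mem (k i : ℕ) : stdG IP k x d i ∈ V.smoothField := by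
  match i with
  | 0 => exact hf.stdF_mem IP k
  | 1 => exact hf.d_mem _
  | i + 2 =>
    refine zsmul_mem ?_ _
    split_ifs
    · exact hf.stdF_mem IP _
    · exact hf.d_mem _

lemma act_stdF_of_lt {m i : ℕ} (hmi : m < i) (hi : i ≤ K) :
    V.act (stdF IP x d m) (x i) = 0 := by
  induction m with
  | zero => rw [stdF, hf.act_d 0 i (by omega) hi, if_neg (by omega)]
  | succ m ih =>
    have h1 := ih (by omega)
    have h2 : V.act (d (m + 1)) (x i) = 0 := by
      rw [hf.act_d _ _ (by omega) hi, if_neg (by omega)]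
    rw [stdF_succ]
    split_ifs <;> simp [V.act_add_left, V.act_smul_left, h1, h2]

/-- The coefficients of `f_j` involve only `n_1, …, n_j`, which `v_l` does not see. -/
lemma br_d_stdF {l j : ℕ} (hlj : j < l) (hl : l + 1 ≤ K) :
    V.br (d (l + 1)) (stdF IP x d j) = 0 := by
  induction j with
  | zero => exact hf.br_d _ _ hl (by omega)
  | succ j ih =>
    have h1 := ih (by omega)
    have h2 : V.act (d (l + 1)) (x (j + 2)) = 0 := by
      rw [hf.act_d _ _ hl (by omega), if_neg (by omega)]
    have h3 := hf.br_d (l + 1) (j + 1) hl (by omega)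
    rw [stdF_succ]
    split_ifs
    · rw [V.br_add _ (V.smul_mem (hf.x_mem _) (hf.stdF_mem IP _)) (hf.d_mem _),
        V.br_smul _ (hf.x_mem _) (hf.stdF_mem IP _), h1, h2, h3]
      simp
    · rw [V.br_add _ (hf.stdF_mem IP _) (V.smul_mem (hf.x_mem _) (hf.d_mem _)),
        V.br_smul _ (hf.x_mem _) (hf.d_mem _), h1, h2, h3]
      simp

/-- For `j ≥ 1`, `f_j` is affine in `n_j`, and its slope is `f_{j-1}` or `v_{j-1}` according to the
choice at level `j`. -/
lemma br_d_stdF_self {j : ℕ} (hj : j + 1 ≤ K) :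
    V.br (d (j + 1)) (stdF IP x d j) = complField IP x d j := by
  cases j with
  | zero => exact hf.br_d _ _ hj (by omega)
  | succ j =>
    have h1 := hf.br_d_stdF IP (show j < j + 1 by omega) hj
    have h2 : V.act (d (j + 2)) (x (j + 2)) = 1 := by
      rw [hf.act_d _ _ hj (by omega), if_pos rfl]
    have h3 := hf.br_d (j + 2) (j + 1) hj (by omega)
    rw [stdF_succ, complField]
    split_ifs
    · rw [V.br_add _ (V.smul_mem (hf.x_mem _) (hf.stdF_mem IP _)) (hf.d_mem _),
        V.br_smul _ (hf.x_mem _) (hf.stdF_mem IP _), h1, h2, h3]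
      simp
    · rw [V.br_add _ (hf.stdF_mem IP _) (V.smul_mem (hf.x_mem _) (hf.d_mem _)),
        V.br_smul _ (hf.x_mem _) (hf.d_mem _), h1, h2, h3]
      simp

/-- Modulo terms that commute with `v_j`, passing from `f_m` to `f_{m+1}` multiplies by `n_{m+1}` at
an inverted level and changes nothing at an ordinary one. -/
lemma br_stdF_d {m j : ℕ} (hj : j ≤ m) (hm : m + 1 ≤ K) :
    V.br (stdF IP x d m) (d (j + 1)) =
      -(tailProd IP m (fun l => x (l + 1)) j • complField IP x d j) := by
  induction m, hj using Nat.le_induction with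
  | base =>
    rw [V.br_swap, hf.br_d_stdF_self IP hm, tailProd_of_le _ _ le_rfl, one_smul]
  | succ m hjm ih =>
    have ih := ih (by omega)
    rw [V.br_swap, neg_inj] at ih ⊢
    have h2 : V.act (d (j + 1)) (x (m + 2)) = 0 := by
      rw [hf.act_d _ _ (by omega) (by omega), if_neg (by omega)]
    have h3 := hf.br_d (j + 1) (m + 1) (by omega) (by omega)
    rw [stdF_succ, tailProd_succ_top _ _ hjm]
    split_ifs
    · rw [V.br_add _ (V.smul_mem (hf.x_mem _) (hf.stdF_mem IP _)) (hf.d_mem _),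
        V.br_smul _ (hf.x_mem _) (hf.stdF_mem IP _), ih, h2, h3]
      simp [mul_smul]
    · rw [V.br_add _ (hf.stdF_mem IP _) (V.smul_mem (hf.x_mem _) (hf.d_mem _)),
        V.br_smul _ (hf.x_mem _) (hf.d_mem _), ih, h2, h3]
      simp

/-- Antisymmetry alone yields only `2 [X, X] = 0`, and 2-torsion is not excluded here, so the
vanishing is obtained from the coordinate fields by induction. -/
lemma br_self_of_stdF (j : ℕ) (hj : j + 1 ≤ K) :
    V.br (stdF IP x d j) (stdF IP x d j) = 0 := by
  induction j with
  | zero => exact hf.br_d 0 0 (by omega) (by omega)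
  | succ j ih =>
    have hF := hf.stdF_mem IP j
    have ih := ih (by omega)
    have h1 : V.br (d (j + 1)) (d (j + 1)) = 0 := hf.br_d _ _ (by omega) (by omega)
    have h2 := hf.act_stdF_of_lt IP (show j < j + 2 by omega) hj
    have h3 : V.act (d (j + 1)) (x (j + 2)) = 0 := by
      rw [hf.act_d _ _ (by omega) hj, if_neg (by omega)]
    have h4 := V.br_swap (stdF IP x d j) (d (j + 1))
    have hx := hf.x_mem (j + 2)
    have hd := hf.d_mem (j + 1)
    set X := stdF IP x d (j + 1) with hX
    have e1 : V.br X (stdF IP x d j) = -V.br (stdF IP x d j) X := V.br_swap _ _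
    have e2 : V.br X (d (j + 1)) = -V.br (d (j + 1)) X := V.br_swap _ _
    have a1 : V.act X (x (j + 2)) = 0 := hf.act_stdF_of_lt IP (by omega) hj
    by_cases hIP : j + 1 ∈ IP
    · have hX' : X = x (j + 2) • stdF IP x d j + d (j + 1) := by rw [hX, stdF_succ, if_pos hIP]
      have key : ∀ Y, V.br Y X = V.act Y (x (j + 2)) • stdF IP x d j +
          x (j + 2) • V.br Y (stdF IP x d j) + V.br Y (d (j + 1)) := fun Y => by
        rw [hX', V.br_add _ (V.smul_mem hx hF) hd, V.br_smul _ hx hF]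
      rw [key, e1, e2, key, key, a1, h2, h3, ih, h1, h4]
      simp
    · have hX' : X = stdF IP x d j + x (j + 2) • d (j + 1) := by rw [hX, stdF_succ, if_neg hIP]
      have key : ∀ Y, V.br Y X = V.br Y (stdF IP x d j) + (V.act Y (x (j + 2)) • d (j + 1) +
          x (j + 2) • V.br Y (d (j + 1))) := fun Y => by
        rw [hX', V.br_add _ hF (V.smul_mem hx hd), V.br_smul _ hx hd]
      rw [key, e1, e2, key, key, a1, h2, h3, ih, h1, h4]
      simp

/-- At `m = j + 1` one has `f_m = n_m f_j + v_j`, and only `[v_j, f_j]` survives. Each further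
inverted level multiplies by its coordinate. -/
lemma br_stdF_stdF {m j : ℕ} (hIP : j + 1 ∈ IP) (hj : j + 1 ≤ m) (hm : m + 1 ≤ K) :
    V.br (stdF IP x d m) (stdF IP x d j) =
      tailProd IP m (fun l => x (l + 1)) (j + 1) • complField IP x d j := by
  rw [V.br_swap]
  have hF := hf.stdF_mem IP
  induction m, hj using Nat.le_induction with
  | base =>
    have h2 := hf.act_stdF_of_lt IP (show j < j + 2 by omega) hm
    have h1 := hf.br_self_of_stdF IP j (by omega)
    rw [tailProd_of_le _ _ le_rfl, one_smul, stdF_succ, if_pos hIP,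
      V.br_add _ (V.smul_mem (hf.x_mem _) (hF _)) (hf.d_mem _),
        V.br_smul _ (hf.x_mem _) (hF _), h2, h1, V.br_swap, hf.br_d_stdF_self IP (by omega)]
    simp
  | succ m hjm ih =>
    have ih := ih (by omega)
    rw [neg_eq_iff_eq_neg] at ih ⊢
    have h2 := hf.act_stdF_of_lt IP (show j < m + 2 by omega) hm
    have h3 : V.br (stdF IP x d j) (d (m + 1)) = 0 := by
      rw [V.br_swap, hf.br_d_stdF IP (by omega) (by omega), neg_zero]
    rw [stdF_succ, tailProd_succ_top _ _ hjm]
    split_ifs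
    · rw [V.br_add _ (V.smul_mem (hf.x_mem _) (hF _)) (hf.d_mem _),
        V.br_smul _ (hf.x_mem _) (hF _), ih, h2, h3]
      simp [mul_smul]
    · rw [V.br_add _ (hF _) (V.smul_mem (hf.x_mem _) (hf.d_mem _)),
        V.br_smul _ (hf.x_mem _) (hf.d_mem _), ih, h2, h3]
      simp

lemma br_stdF_complField {k j : ℕ} (hj : j + 1 ≤ k) (hk : k + 1 ≤ K) :
    V.br (stdF IP x d k) (complField IP x d (j + 1)) =
      (if j + 1 ∈ IP then 1 else -1 : ℤ) •
        tailProd IP k (fun l => x (l + 1)) (j + 1) • complField IP x d j := by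
  rw [complField]
  split_ifs with h
  · rw [hf.br_stdF_stdF IP h hj hk, one_smul]
  · rw [hf.br_stdF_d IP (by omega) hk, tailProd_eq_mul _ _ (show j < k by omega), if_neg h]
    simp

/-- The field `v_j` enters at level `j + 1` with coefficient `1` or `n_{j+1}`, and each later
inverted level multiplies it by its coordinate. -/
lemma act_stdF_n {m j : ℕ} (hj : j < m) (hm : m + 1 ≤ K) :
    V.act (stdF IP x d m) (x (j + 1)) = derivCoeff IP m (fun l => x (l + 1)) j := by
  unfold derivCoeff
  induction m, Nat.succ_le_of_lt hj using Nat.le_induction with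
  | base =>
    have h1 := hf.act_stdF_of_lt IP (show j < j + 1 by omega) (by omega)
    have h2 := hf.act_d (j + 1) (j + 1) (by omega) (by omega)
    rw [tailProd_of_le _ _ le_rfl, stdF_succ]
    split_ifs <;> simp [V.act_add_left, V.act_smul_left, h1, h2]
  | succ m hjm ih =>
    have ih := ih (by omega) (by omega)
    have h2 := hf.act_d (m + 1) (j + 1) (by omega) (by omega)
    rw [if_neg (by omega)] at h2
    rw [stdF_succ, tailProd_succ_top _ _ hjm, mul_left_comm, ← ih]
    split_ifs <;> simp [V.act_add_left, V.act_smul_left, h2]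

/-! ### Brackets of the basis `g_i` -/

variable {k : ℕ} (hk : k + 1 ≤ K)
include hk

lemma br_g_zero_g_one (hIP : IP ⊆ Finset.Icc 1 k) (hk0 : 0 < k) :
    V.br (stdG IP k x d 0) (stdG IP k x d 1) = stdG IP k x d 2 := by
  -- The sign of `g_2` is decided by level `k + 1`, which lies outside `IP`.
  have : k + 1 ∉ IP := fun h => by have := hIP h; simp at this
  rw [stdG_add_two IP x d hk0]
  simp only [stdG, gSign]
  rw [hf.br_stdF_d IP le_rfl hk, tailProd_of_le _ _ le_rfl]
  simp [this]

lemma br_g_zero_g {i : ℕ} (hi : 2 ≤ i) (hik : i ≤ k) :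
    V.br (stdG IP k x d 0) (stdG IP k x d i) =
      tailProd IP k (fun l => x (l + 1)) (k + 2 - i) • stdG IP k x d (i + 1) := by
  obtain ⟨i, rfl⟩ : ∃ i', i = i' + 2 := ⟨i - 2, by omega⟩
  obtain ⟨j, hj⟩ : ∃ j, k - i = j + 1 := ⟨k - i - 1, by omega⟩
  have hs := gSign_eq IP k (i + 2)
  rw [stdG_add_two IP x d (by omega), show i + 2 + 1 = (i + 1) + 2 from rfl,
    stdG_add_two IP x d (by omega), hj, V.br_sign _ (hf.complField_mem IP _) hs]
  simp only [stdG]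
  have hs' : gSign IP k (i + 1 + 2) =
      if j + 1 ∈ IP then gSign IP k (i + 2) else -gSign IP k (i + 2) := by
    rw [gSign, show k + 1 - (i + 1) = j + 1 by omega]
  rw [hf.br_stdF_complField IP (by omega) hk, hs', show k - (i + 1) = j by omega, show k + 2 - (i + 2) = j + 1 by omega]
  split_ifs <;> rcases hs with h | h <;> simp [h]

lemma br_g_zero_g_last (hk0 : 0 < k) :
    V.br (stdG IP k x d 0) (stdG IP k x d (k + 1)) = 0 := by
  obtain ⟨k, rfl⟩ : ∃ i', k = i' + 1 := ⟨k - 1, by omega⟩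
  rw [stdG_add_two IP x d (by omega), V.br_sign _ (hf.complField_mem IP _) (gSign_eq _ _ _)]
  simp only [stdG]
  -- The bracket is a multiple of `complField` at level `0`, which is `0`: the chain of the `g_i`
  -- ends here.
  rw [show k + 1 - k = 0 + 1 by omega, hf.br_stdF_complField IP (by omega) hk, complField]
  simp

lemma br_g_one_g {i : ℕ} (hi : 2 ≤ i) (hik : i ≤ k + 1) :
    V.br (stdG IP k x d 1) (stdG IP k x d i) = 0 := by
  obtain ⟨i, rfl⟩ : ∃ i', i = i' + 2 := ⟨i - 2, by omega⟩
  obtain ⟨j, hj⟩ : ∃ j, k - i = j + 1 := ⟨k - i - 1, by omega⟩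
  rw [stdG_add_two IP x d (by omega), V.br_sign _ (hf.complField_mem IP _) (gSign_eq _ _ _), hj,
    complField]
  simp only [stdG]
  split_ifs
  · rw [hf.br_d_stdF IP (by omega) hk, smul_zero]
  · rw [hf.br_d _ _ hk (by omega), smul_zero]

end IsFrame

end VFCalculus

open MvPolynomial (X)

/-! ### Coefficients of iterated brackets -/

/-- `g_0` acting on polynomials in `n_1, …, n_k`. -/
def derivZero (IP : Finset ℕ) (k : ℕ) :
    Derivation ℕ (MvPolynomial ℕ ℕ) (MvPolynomial ℕ ℕ) :=
  MvPolynomial.mkDerivation ℕ fun j => if j < k then derivCoeff IP k X j else 0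

/-- `g_1` acting on polynomials in `n_1, …, n_k`. -/
def derivOne (k : ℕ) : Derivation ℕ (MvPolynomial ℕ ℕ) (MvPolynomial ℕ ℕ) :=
  MvPolynomial.mkDerivation ℕ fun j => if j = k then 1 else 0

@[simp] lemma derivZero_X (IP : Finset ℕ) (k j : ℕ) :
    derivZero IP k (X j) = if j < k then derivCoeff IP k X j else 0 :=
  MvPolynomial.mkDerivation_X _ _ _

@[simp] lemma derivOne_X (k j : ℕ) : derivOne k (X j) = if j = k then 1 else 0 :=
  MvPolynomial.mkDerivation_X _ _ _

/-- The coefficient of `g_j` in the iterated bracket given by a word. -/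
def coeffPoly (IP : Finset ℕ) (k : ℕ) : List (Fin 2) → ℕ → MvPolynomial ℕ ℕ
  | [], j => if j = 3 then 1 else 0
  | b :: l, j =>
    if b = 0 then derivZero IP k (coeffPoly IP k l j) +
      tailProd IP k X (k + 3 - j) * coeffPoly IP k l (j - 1)
    else derivOne k (coeffPoly IP k l j)

lemma coeffPoly_of_lt (IP : Finset ℕ) (k : ℕ) (l : List (Fin 2)) {j : ℕ} (hj : j < 3) :
    coeffPoly IP k l j = 0 := by
  induction l generalizing j with
  | nil => rw [coeffPoly, if_neg (by omega)]
  | cons b l ih =>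
    rw [coeffPoly, ih hj, ih (show j - 1 < 3 by omega)]
    simp

lemma coeffPoly_of_gt (IP : Finset ℕ) (k : ℕ) (l : List (Fin 2)) {j : ℕ} (hj : l.length + 3 < j) :
    coeffPoly IP k l j = 0 := by
  induction l generalizing j with
  | nil => rw [coeffPoly, if_neg (by simp at hj; omega)]
  | cons b l ih =>
    rw [List.length_cons] at hj
    rw [coeffPoly, ih (by omega), ih (show l.length + 3 < j - 1 by omega)]
    simp

/-- Evaluation of a polynomial at `n_1, …, n_k`. -/
def evalN {O : Type*} [CommRing O] (n : ℕ → O) : MvPolynomial ℕ ℕ →+* O :=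
  MvPolynomial.eval₂Hom (Nat.castRingHom O) n

@[simp] lemma evalN_X {O : Type*} [CommRing O] (n : ℕ → O) (j : ℕ) : evalN n (X j) = n j :=
  MvPolynomial.eval₂_X _ _ _

lemma map_evalN {O O' : Type*} [CommRing O] [CommRing O'] (n : ℕ → O) (φ : O →+* O')
    (a : MvPolynomial ℕ ℕ) : φ (evalN n a) = evalN (fun j => φ (n j)) a := by
  have : φ.comp (evalN n) = evalN (fun j => φ (n j)) := by
    apply MvPolynomial.ringHom_ext
    · intro r; simp
    · intro j; simp
  exact DFunLike.congr_fun this a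

namespace VFCalculus

variable {O M : Type*} [CommRing O] [AddCommGroup M] [Module O M] {V : VFCalculus O M}
  {k : ℕ} {x : ℕ → O} {d : ℕ → M} (hf : V.IsFrame (k + 1) x d) (IP : Finset ℕ)
include hf

namespace IsFrame

lemma evalN_mem (a : MvPolynomial ℕ ℕ) : evalN (fun j => x (j + 1)) a ∈ V.smoothFun := by
  induction a using MvPolynomial.induction_on with
  | C n => simp [natCast_mem]
  | add p q hp hq => rw [map_add]; exact add_mem hp hq
  | mul_X p i hp => rw [map_mul, evalN_X]; exact mul_mem hp (hf.x_mem _)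

lemma act_evalN (Y : M) (D : Derivation ℕ (MvPolynomial ℕ ℕ) (MvPolynomial ℕ ℕ))
    (h : ∀ j, V.act Y (x (j + 1)) = evalN (fun j => x (j + 1)) (D (X j)))
    (a : MvPolynomial ℕ ℕ) :
    V.act Y (evalN (fun j => x (j + 1)) a) = evalN (fun j => x (j + 1)) (D a) := by
  induction a using MvPolynomial.induction_on with
  | C n => simp [act_natCast]
  | add p q hp hq =>
    rw [map_add, V.act_add Y (hf.evalN_mem _) (hf.evalN_mem _), hp, hq, map_add, map_add]
  | mul_X p i hp =>
    rw [map_mul, V.act_mul Y (hf.evalN_mem _) (hf.evalN_mem _), hp, evalN_X, h, D.leibniz]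
    simp only [map_add, smul_eq_mul, map_mul, evalN_X]

lemma act_g_zero (a : MvPolynomial ℕ ℕ) :
    V.act (stdG IP k x d 0) (evalN (fun j => x (j + 1)) a) =
      evalN (fun j => x (j + 1)) (derivZero IP k a) := by
  refine hf.act_evalN _ _ (fun j => ?_) a
  rw [derivZero_X]
  simp only [stdG]
  split_ifs with h
  · rw [hf.act_stdF_n IP h le_rfl, map_derivCoeff]
    simp
  · rw [map_zero]
    rcases (not_lt.1 h).eq_or_lt with rfl | h'
    · exact hf.act_stdF_of_lt IP (by omega) le_rfl
    · rw [hf.x_eq_zero _ (by omega), act_zero]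

lemma act_g_one (a : MvPolynomial ℕ ℕ) :
    V.act (stdG IP k x d 1) (evalN (fun j => x (j + 1)) a) =
      evalN (fun j => x (j + 1)) (derivOne k a) := by
  refine hf.act_evalN _ _ (fun j => ?_) a
  rw [derivOne_X]
  simp only [stdG]
  by_cases h : j ≤ k
  · rw [hf.act_d _ _ le_rfl (by omega)]
    by_cases h' : j = k
    · simp [h']
    · simp [h', Ne.symm h']
  · rw [hf.x_eq_zero _ (by omega), act_zero, if_neg (by omega), map_zero]

/-- The span of `g_3, …, g_{k+1}` is preserved: `g_0` shifts the index up by one, nothing enters at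
`g_3`, and `[g_0, g_{k+1}] = 0` closes the top. -/
lemma iterBracket_eq (hk : 2 ≤ k) (l : List (Fin 2)) :
    iterBracket V.br (stdG IP k x d) l =
      ∑ i ∈ Finset.range (k - 1),
        evalN (fun j => x (j + 1)) (coeffPoly IP k l (i + 3)) • stdG IP k x d (i + 3) := by
  obtain ⟨k', hk'⟩ : ∃ k', k - 1 = k' + 1 := ⟨k - 2, by omega⟩
  rw [hk']
  induction l with
  | nil =>
    rw [Finset.sum_range_succ', Finset.sum_eq_zero]
    · simp [iterBracket, coeffPoly]
    · intro i _
      simp [coeffPoly]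
  | cons b l ih =>
    have hmem : ∀ i ∈ Finset.range (k' + 1),
        evalN (fun j => x (j + 1)) (coeffPoly IP k l (i + 3)) • stdG IP k x d (i + 3) ∈
          V.smoothField := fun i _ => V.smul_mem (hf.evalN_mem _) (hf.stdG_mem IP k _)
    rw [iterBracket, ih, V.br_sum _ _ _ hmem]
    have hb : b = 0 ∨ b = 1 := by omega
    rcases hb with rfl | rfl
    · have h1 : ∀ i ∈ Finset.range (k' + 1), V.br (stdG IP k x d ((0 : Fin 2) : ℕ))
          (evalN (fun j => x (j + 1)) (coeffPoly IP k l (i + 3)) • stdG IP k x d (i + 3)) =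
          evalN (fun j => x (j + 1)) (derivZero IP k (coeffPoly IP k l (i + 3))) •
            stdG IP k x d (i + 3) +
          evalN (fun j => x (j + 1)) (coeffPoly IP k l (i + 3)) •
            V.br (stdG IP k x d 0) (stdG IP k x d (i + 3)) := fun i _ => by
        rw [V.br_smul _ (hf.evalN_mem _) (hf.stdG_mem IP k _)]
        simp only [Fin.val_zero]
        rw [hf.act_g_zero IP]
      rw [Finset.sum_congr rfl h1, Finset.sum_add_distrib]
      simp only [coeffPoly, if_true, map_add, add_smul, Finset.sum_add_distrib]
      congr 1
      rw [Finset.sum_range_succ, Finset.sum_range_succ', show k' + 3 = k + 1 by omega,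
        hf.br_g_zero_g_last IP le_rfl (by omega), coeffPoly_of_lt IP k l (show 0 + 3 - 1 < 3 by omega)]
      simp only [smul_zero, add_zero, mul_zero, map_zero, zero_smul]
      refine Finset.sum_congr rfl fun i hi => ?_
      rw [Finset.mem_range] at hi
      rw [hf.br_g_zero_g IP le_rfl (by omega) (by omega), map_mul, map_tailProd, smul_smul]
      simp only [evalN_X]
      rw [mul_comm, show k + 2 - (i + 3) = k + 3 - (i + 1 + 3) by omega]
      rfl
    · refine Finset.sum_congr rfl fun i hi => ?_
      rw [Finset.mem_range] at hi
      rw [V.br_smul _ (hf.evalN_mem _) (hf.stdG_mem IP k _)]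
      simp only [Fin.val_one]
      rw [hf.act_g_one IP, hf.br_g_one_g IP le_rfl (by omega) (by omega)]
      simp [coeffPoly]

end IsFrame

end VFCalculus

/-! ### The focal one-forms and linear independence -/

lemma retIdx_le (IP : Finset ℕ) (j : ℕ) : retIdx IP j ≤ j := by
  induction j with
  | zero => exact le_rfl
  | succ j ih => rw [retIdx]; split_ifs <;> omega

lemma deaIdx_le (IP : Finset ℕ) (j : ℕ) : deaIdx IP j ≤ j := by
  cases j with
  | zero => exact le_rfl
  | succ j => have := retIdx_le IP j; rw [deaIdx]; split_ifs <;> omega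

namespace VFCalculus

variable {O M : Type*} [CommRing O] [AddCommGroup M] [Module O M] (V : VFCalculus O M)

/-- The one-form `d d_j - n_j d r_j`. -/
def focalForm (IP : Finset ℕ) (x : ℕ → O) (j : ℕ) : M →ₗ[O] O :=
  V.diff (x (deaIdx IP j)) - x (j + 1) • V.diff (x (retIdx IP j))

variable {V}

namespace IsFrame

variable {K k : ℕ} {x : ℕ → O} {d : ℕ → M} (hf : V.IsFrame K x d) (IP : Finset ℕ)
include hf

lemma act_stdF_retIdx {j : ℕ} (hj : j ≤ K) : V.act (stdF IP x d j) (x (retIdx IP j)) = 1 := by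
  induction j with
  | zero => rw [stdF, retIdx, hf.act_d _ _ hj hj, if_pos rfl]
  | succ j ih =>
    have ih := ih (by omega)
    have hr := retIdx_le IP j
    rw [stdF_succ, retIdx]
    split_ifs
    · rw [V.act_add_left, V.act_smul_left, hf.act_stdF_of_lt IP (by omega) hj,
        hf.act_d _ _ hj hj]
      simp
    · rw [V.act_add_left, V.act_smul_left, ih, hf.act_d _ _ hj (by omega), if_neg (by omega)]
      simp

lemma act_stdF_deaIdx {j : ℕ} (hj : j + 1 ≤ K) :
    V.act (stdF IP x d (j + 1)) (x (deaIdx IP (j + 1))) = x (j + 2) := by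
  have ih := hf.act_stdF_retIdx IP (show j ≤ K by omega)
  have hr := retIdx_le IP j
  rw [stdF_succ, deaIdx]
  split_ifs
  · rw [V.act_add_left, V.act_smul_left, ih, hf.act_d _ _ hj (by omega), if_neg (by omega)]
    simp
  · rw [V.act_add_left, V.act_smul_left, hf.act_stdF_of_lt IP (by omega) hj, hf.act_d _ _ hj hj]
    simp

lemma focalForm_d {j m : ℕ} (hjm : j ≤ m) (hm : m + 1 ≤ K) :
    V.focalForm IP x j (d (m + 1)) = 0 := by
  have h1 := retIdx_le IP j
  have h2 := deaIdx_le IP j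
  simp only [focalForm, LinearMap.sub_apply, LinearMap.smul_apply, diff_apply]
  rw [hf.act_d _ _ hm (by omega), hf.act_d _ _ hm (by omega), if_neg (by omega),
    if_neg (by omega)]
  simp

lemma focalForm_stdF {j m : ℕ} (hj : 1 ≤ j) (hjm : j ≤ m) (hm : m ≤ K) :
    V.focalForm IP x j (stdF IP x d m) = 0 := by
  induction m, hjm using Nat.le_induction with
  | base =>
    obtain ⟨j, rfl⟩ : ∃ j', j = j' + 1 := ⟨j - 1, by omega⟩
    simp only [focalForm, LinearMap.sub_apply, LinearMap.smul_apply, diff_apply]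
    rw [hf.act_stdF_retIdx IP hm, hf.act_stdF_deaIdx IP hm]
    simp
  | succ m hjm ih =>
    have ih := ih (by omega)
    have h2 := hf.focalForm_d IP hjm hm
    rw [stdF_succ]
    split_ifs <;> simp [ih, h2]

lemma focalForm_complField {j : ℕ} (hj : j + 1 ≤ K) :
    V.focalForm IP x (j + 1) (complField IP x d (j + 1)) = 1 := by
  have h1 := retIdx_le IP j
  simp only [focalForm, LinearMap.sub_apply, LinearMap.smul_apply, diff_apply]
  rw [complField, retIdx, deaIdx]
  split_ifs
  · rw [hf.act_stdF_retIdx IP (by omega), hf.act_stdF_of_lt IP (by omega) hj]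
    simp
  · rw [hf.act_d _ _ hj hj, hf.act_d _ _ hj (by omega), if_pos rfl, if_neg (by omega)]
    simp

lemma focalForm_complField_of_lt {j m : ℕ} (hj : 1 ≤ j) (hjm : j < m) (hm : m ≤ K) :
    V.focalForm IP x j (complField IP x d m) = 0 := by
  obtain ⟨m, rfl⟩ : ∃ m', m = m' + 1 := ⟨m - 1, by omega⟩
  rw [complField]
  split_ifs
  · exact hf.focalForm_stdF IP hj (by omega) (by omega)
  · exact hf.focalForm_d IP (by omega) hm

/-- For `i ≥ 2` the field `g_i` is, up to sign, `complField` at level `k + 2 - i > j`, hence one of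
the fields `f_m`, `v_m` with `m ≥ j`, all killed by the `j`-th form. -/
lemma focalForm_g_of_lt {j i : ℕ} (hj : 1 ≤ j) (hjk : j ≤ k) (hi : i < k + 2 - j)
    (hk : k + 1 ≤ K) : V.focalForm IP x j (stdG IP k x d i) = 0 := by
  match i with
  | 0 => exact hf.focalForm_stdF IP hj hjk (by omega)
  | 1 => exact hf.focalForm_d IP hjk hk
  | i + 2 =>
    rw [stdG_add_two IP x d (by omega), map_zsmul,
      hf.focalForm_complField_of_lt IP hj (by omega) (by omega), smul_zero]

lemma isUnit_focalForm_g {j : ℕ} (hj : 1 ≤ j) (hjk : j ≤ k) (hk : k + 1 ≤ K) :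
    IsUnit (V.focalForm IP x j (stdG IP k x d (k + 2 - j))) := by
  obtain ⟨j, rfl⟩ : ∃ j', j = j' + 1 := ⟨j - 1, by omega⟩
  rw [show k + 2 - (j + 1) = (k - j - 1) + 2 by omega, stdG_add_two IP x d (by omega), map_zsmul,
    show k - (k - j - 1) = j + 1 by omega, hf.focalForm_complField IP (by omega)]
  rcases gSign_eq IP k (k - j - 1 + 2) with h | h <;> simp [h]

end IsFrame

end VFCalculus

/-- Linear independence from a triangular family of linear forms. -/
lemma eq_zero_of_triangular {O M : Type*} [CommRing O] [AddCommGroup M] [Module O M] {k : ℕ}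
    (g : ℕ → M) (θ : ℕ → M →ₗ[O] O)
    (h0 : ∀ j i, 1 ≤ j → j ≤ k → i < k + 2 - j → θ j (g i) = 0)
    (h1 : ∀ j, 1 ≤ j → j ≤ k → IsUnit (θ j (g (k + 2 - j)))) (a : ℕ → O) {N : ℕ}
    (hN : N ≤ k + 1) (h : ∑ i ∈ Finset.range (N + 1), a i • g i = 0) {i : ℕ} (hi : 2 ≤ i)
    (hiN : i ≤ N) : a i = 0 := by
  induction N with
  | zero => omega
  | succ N ih =>
    rcases Nat.lt_or_ge N 1 with hN1 | hN1
    · omega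
    have key : a (N + 1) = 0 := by
      -- This form kills `g_0, …, g_N` and takes a unit value on `g_{N+1}`, so it isolates the last
      -- coefficient.
      have := congrArg (θ (k + 1 - N)) h
      rw [map_sum, map_zero, Finset.sum_range_succ, Finset.sum_eq_zero] at this
      · have hu := h1 (k + 1 - N) (by omega) (by omega)
        rw [show k + 2 - (k + 1 - N) = N + 1 by omega] at hu
        rw [zero_add, map_smul, smul_eq_mul] at this
        exact hu.mul_left_eq_zero.1 this
      · intro i hi
        rw [Finset.mem_range] at hi
        rw [map_smul, h0 _ _ (by omega) (by omega) (by omega), smul_zero]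
    rcases hiN.eq_or_lt with rfl | hlt
    · exact key
    · rw [Finset.sum_range_succ, key, zero_smul, add_zero] at h
      exact ih (by omega) h (by omega)

/-- Comparison of two expressions `∑ c_j g_j`, one of them split at `j = 4`. -/
lemma coeff_eq_of_triangular {O M : Type*} [CommRing O] [AddCommGroup M] [Module O M] {k : ℕ}
    (g : ℕ → M) (θ : ℕ → M →ₗ[O] O)
    (h0 : ∀ j i, 1 ≤ j → j ≤ k → i < k + 2 - j → θ j (g i) = 0)
    (h1 : ∀ j, 1 ≤ j → j ≤ k → IsUnit (θ j (g (k + 2 - j)))) (a b : ℕ → O) {N : ℕ}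
    (hN : N ≤ k + 1) (hN3 : 3 ≤ N)
    (h : ∑ i ∈ Finset.range 4, a i • g i + ∑ i ∈ Finset.Icc 4 N, a i • g i =
      ∑ i ∈ Finset.range (N + 1), b i • g i) {i : ℕ} (hi : 2 ≤ i)
    (hiN : i ≤ N) : a i = b i := by
  have e : Finset.Icc 4 N = Finset.Ico 4 (N + 1) := by
    ext j; simp only [Finset.mem_Icc, Finset.mem_Ico]; omega
  rw [e, Finset.sum_range_add_sum_Ico _ (by omega)] at h
  have := eq_zero_of_triangular g θ h0 h1 (fun j => a j - b j) hN (by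
    simp only [sub_smul, Finset.sum_sub_distrib]
    rw [h, sub_self]) hi hiN
  exact sub_eq_zero.1 this

/-- A word of length `L` reaches at most `g_{L+3}`, and the basis ends at `g_{k+1}`. Hence the cut
at `min h (k + 1)` loses nothing. -/
lemma sum_range_sub_one_add_three {M : Type*} [AddCommMonoid M] {k h L : ℕ} (hk : 2 ≤ k)
    (hL : L + 3 ≤ h) (t : ℕ → M) (h1 : ∀ j < 3, t j = 0) (h2 : ∀ j, L + 3 < j → t j = 0) :
    ∑ i ∈ Finset.range (k - 1), t (i + 3) = ∑ j ∈ Finset.range (min h (k + 1) + 1), t j := by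
  have e1 : ∑ i ∈ Finset.range (k - 1), t (i + 3) = ∑ j ∈ Finset.range (k + 2), t j := by
    rw [show k + 2 = 3 + (k - 1) by omega, Finset.sum_range_add,
      Finset.sum_eq_zero fun j hj => h1 j (Finset.mem_range.1 hj), zero_add]
    simp only [add_comm]
  refine e1.trans (Finset.sum_subset (Finset.range_subset_range.2 (by omega)) ?_).symm
  intro j hj hj'
  rw [Finset.mem_range] at hj hj'
  exact h2 j (by omega)

lemma sum_range_four {M : Type*} [AddCommMonoid M] (t : ℕ → M) (h1 : ∀ j < 3, t j = 0) :
    ∑ j ∈ Finset.range 4, t j = t 3 := by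
  rw [Finset.sum_range_succ, Finset.sum_eq_zero fun j hj => h1 j (Finset.mem_range.1 hj), zero_add]

lemma sum_range_eq_add_sum_Icc {M : Type*} [AddCommMonoid M] {N : ℕ} (hN : 3 ≤ N) (t : ℕ → M)
    (h1 : ∀ j < 3, t j = 0) :
    ∑ j ∈ Finset.range (N + 1), t j = t 3 + ∑ j ∈ Finset.Icc 4 N, t j := by
  have e : Finset.Icc 4 N = Finset.Ico 4 (N + 1) := by
    ext j; simp only [Finset.mem_Icc, Finset.mem_Ico]; omega
  rw [e, ← Finset.sum_range_add_sum_Ico _ (show 4 ≤ N + 1 by omega), sum_range_four t h1]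

open MvPolynomial (X)

/-! ### Weights of monomials and leading coefficients -/

section Leading

variable {K : Type*} [Field K]

/-- The weight of a pair consisting of a weight and a leading coefficient. -/
def wt (g : Multiplicative ℕ × K) : ℕ := Multiplicative.toAdd g.1

@[simp] lemma wt_one : wt (1 : Multiplicative ℕ × K) = 0 := rfl

@[simp] lemma wt_mul (g g' : Multiplicative ℕ × K) : wt (g * g') = wt g + wt g' := rfl

lemma wt_prod {ι : Type*} (s : Finset ι) (f : ι → Multiplicative ℕ × K) :
    wt (∏ i ∈ s, f i) = ∑ i ∈ s, wt (f i) := by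
  simp [wt, Prod.fst_prod, toAdd_prod]

/-- Weights and leading coefficients of `n_0, …, n_k` which are compatible with the derivatives
along `g_0` and `g_1`. -/
structure IsLeadingData (IP : Finset ℕ) (k : ℕ) (χ : ℕ → Multiplicative ℕ × K) : Prop where
  ne_zero : ∀ j ≤ k, (χ j).2 ≠ 0
  top : wt (χ k) = 0 ∨ (wt (χ k) = 1 ∧ (χ k).2 = 1)
  lt : ∀ j < k, wt (χ j) = 0 ∨ (wt (χ j) = wt (derivCoeff IP k χ j) + 1 ∧
    (derivCoeff IP k χ j).2 = wt (χ j) * (χ j).2)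

/-- The monomials in `n_0, …, n_k` with their weights and leading coefficients. -/
def monomials (k : ℕ) (χ : ℕ → Multiplicative ℕ × K) :
    Submonoid ((Multiplicative ℕ × K) × MvPolynomial ℕ ℕ) :=
  Submonoid.closure {y | ∃ j ≤ k, y = (χ j, X j)}

/-- Sums of monomials of weight at least `s`, those of weight `s` having as leading coefficients
positive rational multiples of `κ`. -/
def leadSet (k : ℕ) (χ : ℕ → Multiplicative ℕ × K) (s : ℤ) (κ : K) :
    AddSubmonoid (MvPolynomial ℕ ℕ) :=
  AddSubmonoid.closure {a | ∃ g, (g, a) ∈ monomials k χ ∧ s ≤ wt g ∧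
    ((wt g : ℤ) = s → ∃ q : ℚ, 0 < q ∧ g.2 = q * κ)}

/-- The weight and leading coefficient of the first coefficient of `g_i` to be nonzero. -/
def leadProd (IP : Finset ℕ) (k : ℕ) (χ : ℕ → Multiplicative ℕ × K) (i : ℕ) :
    Multiplicative ℕ × K :=
  ∏ j ∈ Finset.Ico 3 i, tailProd IP k χ (k + 2 - j)

variable {IP : Finset ℕ} {k : ℕ} {χ : ℕ → Multiplicative ℕ × K}

lemma X_mem_monomials {j : ℕ} (hj : j ≤ k) : (χ j, X j) ∈ monomials k χ :=
  Submonoid.subset_closure ⟨j, hj, rfl⟩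

lemma tailProd_mem_monomials (IP : Finset ℕ) (j : ℕ) :
    (tailProd IP k χ j, tailProd IP k X j) ∈ monomials k χ := by
  have : (tailProd IP k χ j, tailProd IP k X j) =
      ∏ l ∈ (Finset.Ioc j k).filter (· ∈ IP), ((χ l, X l) : _ × MvPolynomial ℕ ℕ) := by
    ext1
    · rw [Prod.fst_prod]; rfl
    · rw [Prod.snd_prod]; rfl
  rw [this]
  refine Submonoid.prod_mem _ fun l hl => X_mem_monomials ?_
  simp only [Finset.mem_filter, Finset.mem_Ioc] at hl
  exact hl.1.2

lemma derivCoeff_mem_monomials (IP : Finset ℕ) {j : ℕ} (hj : j < k) :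
    (derivCoeff IP k χ j, derivCoeff IP k X j) ∈ monomials k χ := by
  unfold derivCoeff
  have := tailProd_mem_monomials (k := k) (χ := χ) IP (j + 1)
  split_ifs
  · simpa using this
  · exact mul_mem (X_mem_monomials (Nat.succ_le_of_lt hj)) this

/-- When `s < s'` every monomial has weight above `s`, so leading coefficients are unconstrained. -/
lemma leadSet_le [CharZero K] {s s' : ℤ} {κ κ' : K} (hs : s ≤ s')
    (h : s' = s → ∃ q : ℚ, 0 < q ∧ κ' = q * κ) : leadSet k χ s' κ' ≤ leadSet k χ s κ := by
  refine AddSubmonoid.closure_mono ?_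
  rintro a ⟨g, hg, h1, h2⟩
  refine ⟨g, hg, hs.trans h1, fun h3 => ?_⟩
  obtain ⟨q, hq, e⟩ := h2 (by omega)
  obtain ⟨q', hq', e'⟩ := h (by omega)
  exact ⟨q * q', mul_pos hq hq', by rw [e, e', Rat.cast_mul]; ring⟩

lemma mem_leadSet_congr {s s' : ℤ} {κ κ' : K} {a : MvPolynomial ℕ ℕ}
    (ha : a ∈ leadSet k χ s κ) (hs : s = s') (hκ : κ = κ') : a ∈ leadSet k χ s' κ' :=
  hs ▸ hκ ▸ ha

lemma mem_leadSet_of_mem_monomials {g : Multiplicative ℕ × K} {a : MvPolynomial ℕ ℕ}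
    (h : (g, a) ∈ monomials k χ) : a ∈ leadSet k χ (wt g) g.2 :=
  AddSubmonoid.subset_closure ⟨g, h, le_rfl, fun _ => ⟨1, one_pos, by simp⟩⟩

/-- A product has the least weight only if both factors do, and positive multiples multiply. -/
lemma mul_mem_leadSet [CharZero K] {s s' : ℤ} {κ κ' : K} {a b : MvPolynomial ℕ ℕ}
    (ha : a ∈ leadSet k χ s κ) (hb : b ∈ leadSet k χ s' κ') :
    a * b ∈ leadSet k χ (s + s') (κ * κ') := by
  unfold leadSet at ha
  induction ha using AddSubmonoid.closure_induction with
  | zero => rw [zero_mul]; exact zero_mem _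
  | add x y _ _ hx hy => rw [add_mul]; exact add_mem hx hy
  | mem x hx =>
    unfold leadSet at hb
    induction hb using AddSubmonoid.closure_induction with
    | zero => rw [mul_zero]; exact zero_mem _
    | add x y _ _ hx hy => rw [mul_add]; exact add_mem hx hy
    | mem y hy =>
      obtain ⟨g, hg, h1, h2⟩ := hx
      obtain ⟨g', hg', h1', h2'⟩ := hy
      refine AddSubmonoid.subset_closure ⟨g * g', mul_mem hg hg', ?_, fun h => ?_⟩
      · rw [wt_mul]; push_cast; omega
      · rw [wt_mul] at h; push_cast at h
        obtain ⟨q, hq, e⟩ := h2 (by omega)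
        obtain ⟨q', hq', e'⟩ := h2' (by omega)
        exact ⟨q * q', mul_pos hq hq', by rw [Prod.snd_mul, e, e', Rat.cast_mul]; ring⟩

/-- By the Leibniz rule it suffices to test variables: replacing one factor of a monomial by its
derivative lowers the weight by at most one, and if by exactly one, keeps the leading coefficient up
to a positive rational. -/
lemma derivation_mem_leadSet [CharZero K]
    {D : Derivation ℕ (MvPolynomial ℕ ℕ) (MvPolynomial ℕ ℕ)}
    (hD : ∀ j ≤ k, D (X j) ∈ leadSet k χ ((wt (χ j) : ℤ) - 1) (χ j).2) {s : ℤ} {κ : K}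
    {a : MvPolynomial ℕ ℕ} (ha : a ∈ leadSet k χ s κ) : D a ∈ leadSet k χ (s - 1) κ := by
  have key : ∀ y ∈ monomials k χ, D y.2 ∈ leadSet k χ ((wt y.1 : ℤ) - 1) y.1.2 := by
    intro y hy
    have hy' := hy
    unfold monomials at hy
    induction hy using Submonoid.closure_induction with
    | one => simp
    | mem y h =>
      obtain ⟨j, hj, rfl⟩ := h
      exact hD j hj
    | mul y z hy hz ihy ihz =>
      rw [Prod.snd_mul, D.leibniz, smul_eq_mul, smul_eq_mul]
      refine add_mem ?_ ?_
      · have := mul_mem_leadSet (mem_leadSet_of_mem_monomials (g := y.1) (a := y.2) hy) (ihz hz)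
        refine mem_leadSet_congr this ?_ rfl
        rw [Prod.fst_mul, wt_mul]; push_cast; ring
      · have := mul_mem_leadSet (mem_leadSet_of_mem_monomials (g := z.1) (a := z.2) hz) (ihy hy)
        refine mem_leadSet_congr this ?_ (mul_comm _ _)
        rw [Prod.fst_mul, wt_mul]; push_cast; ring
  unfold leadSet at ha
  induction ha using AddSubmonoid.closure_induction with
  | zero => rw [map_zero]; exact zero_mem _
  | add x y _ _ hx hy => rw [map_add]; exact add_mem hx hy
  | mem x hx =>
    obtain ⟨g, hg, h1, h2⟩ := hx
    have := key (g, x) hg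
    exact leadSet_le (sub_le_sub_right h1 1) (fun h => h2 (by omega)) this

lemma leadProd_succ {i : ℕ} (hi : 3 ≤ i) :
    leadProd IP k χ (i + 1) = leadProd IP k χ i * tailProd IP k χ (k + 2 - i) := by
  unfold leadProd
  rw [Finset.prod_Ico_succ_top hi]

/-- After `m` letters `g_{m+3}` is reached for the first time, so nothing has been differentiated
and the coefficient is a bare product of shift factors. -/
lemma coeffPoly_replicate (IP : Finset ℕ) (k m : ℕ) :
    coeffPoly IP k (List.replicate m 0) (m + 3) =
      ∏ j ∈ Finset.Ico 3 (m + 3), tailProd IP k X (k + 2 - j) := by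
  induction m with
  | zero => simp [coeffPoly]
  | succ m ih =>
    rw [List.replicate_succ, coeffPoly, if_pos rfl,
      coeffPoly_of_gt _ _ _ (show (List.replicate m (0 : Fin 2)).length + 3 < m + 1 + 3 by
        rw [List.length_replicate]; omega),
      show m + 1 + 3 - 1 = m + 3 by omega, ih, map_zero, zero_add,
      show m + 1 + 3 = m + 3 + 1 by omega, Finset.prod_Ico_succ_top (show 3 ≤ m + 3 by omega),
      mul_comm, show k + 3 - (m + 3 + 1) = k + 2 - (m + 3) by omega]

lemma leadProd_mem_monomials (IP : Finset ℕ) (m : ℕ) :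
    (leadProd IP k χ (m + 3), coeffPoly IP k (List.replicate m 0) (m + 3)) ∈ monomials k χ := by
  rw [coeffPoly_replicate]
  have : (leadProd IP k χ (m + 3), ∏ j ∈ Finset.Ico 3 (m + 3), tailProd IP k X (k + 2 - j)) =
      ∏ j ∈ Finset.Ico 3 (m + 3), ((tailProd IP k χ (k + 2 - j), tailProd IP k X (k + 2 - j)) :
        _ × MvPolynomial ℕ ℕ) := by
    ext1
    · rw [Prod.fst_prod]; rfl
    · rw [Prod.snd_prod]
  rw [this]
  exact Submonoid.prod_mem _ fun l _ => tailProd_mem_monomials IP _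

lemma exists_factor {y : (Multiplicative ℕ × K) × MvPolynomial ℕ ℕ} (hy : y ∈ monomials k χ)
    (h : 0 < wt y.1) : ∃ j ≤ k, 0 < wt (χ j) ∧ ∃ z ∈ monomials k χ, y = (χ j, X j) * z := by
  have hy' := hy
  unfold monomials at hy
  induction hy using Submonoid.closure_induction with
  | one => simp at h
  | mem y hm =>
    obtain ⟨j, hj, rfl⟩ := hm
    exact ⟨j, hj, h, 1, one_mem _, (mul_one _).symm⟩
  | mul y z hy hz ihy ihz =>
    rw [Prod.fst_mul, wt_mul] at h
    rcases Nat.eq_zero_or_pos (wt y.1) with h0 | h0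
    · obtain ⟨j, hj, h1, w, hw, e⟩ := ihz (by omega) hz
      exact ⟨j, hj, h1, y * w, mul_mem hy hw, by rw [e, mul_left_comm]⟩
    · obtain ⟨j, hj, h1, w, hw, e⟩ := ihy h0 hy
      exact ⟨j, hj, h1, w * z, mul_mem hw hz, by rw [e, mul_assoc]⟩

/-- The shift from `g_{j-1}` to `g_j` multiplies by exactly the factor that distinguishes `leadProd`
at `j` from `leadProd` at `j - 1`. So the shift term obeys the same bound as the differentiated
term. -/
lemma tail_mul_mem_leadSet [CharZero K] {l : List (Fin 2)} {j : ℕ} (hj : 3 ≤ j)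
    (h : ∀ j, 3 ≤ j → coeffPoly IP k l j ∈
      leadSet k χ ((wt (leadProd IP k χ j) : ℤ) - l.length + j - 3) (leadProd IP k χ j).2) :
    tailProd IP k X (k + 3 - j) * coeffPoly IP k l (j - 1) ∈
      leadSet k χ ((wt (leadProd IP k χ j) : ℤ) - l.length + j - 4) (leadProd IP k χ j).2 := by
  rcases hj.eq_or_lt with rfl | hj
  · rw [coeffPoly_of_lt _ _ _ (by omega), mul_zero]
    exact zero_mem _
  · obtain ⟨j, rfl⟩ : ∃ j', j = j' + 1 := ⟨j - 1, by omega⟩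
    have := mul_mem_leadSet (mem_leadSet_of_mem_monomials
      (tailProd_mem_monomials (k := k) (χ := χ) IP (k + 2 - j))) (h j (by omega))
    rw [leadProd_succ (by omega), show k + 3 - (j + 1) = k + 2 - j by omega, Nat.add_sub_cancel]
    refine mem_leadSet_congr this ?_ (mul_comm _ _)
    rw [wt_mul]; push_cast; ring

variable (hχ : IsLeadingData IP k χ)
include hχ

/-- For a coordinate of weight `0` the bound is `-1`, which no monomial attains. This is why bounds
are integers. -/
lemma IsLeadingData.derivOne_X_mem {j : ℕ} (hj : j ≤ k) :
    derivOne k (X j) ∈ leadSet k χ ((wt (χ j) : ℤ) - 1) (χ j).2 := by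
  rw [derivOne_X]
  split_ifs with h
  · subst h
    refine AddSubmonoid.subset_closure ⟨1, one_mem _, ?_, fun h => ⟨1, one_pos, ?_⟩⟩
    · rcases hχ.top with h | ⟨h, _⟩ <;> simp [h]
    · rcases hχ.top with h' | ⟨h', h2⟩
      · simp [h'] at h
      · simp [h2]
  · exact zero_mem _

/-- The positive multiple is the weight itself, as in `(c t^s)' = s c t^(s-1)`. -/
lemma IsLeadingData.derivZero_X_mem (j : ℕ) :
    derivZero IP k (X j) ∈ leadSet k χ ((wt (χ j) : ℤ) - 1) (χ j).2 := by
  rw [derivZero_X]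
  split_ifs with h
  · refine AddSubmonoid.subset_closure ⟨_, derivCoeff_mem_monomials IP h, ?_, fun h' => ?_⟩
    · rcases hχ.lt j h with h' | ⟨h', _⟩ <;> rw [h'] <;> push_cast <;> omega
    · rcases hχ.lt j h with h1 | ⟨h1, h2⟩
      · omega
      · exact ⟨wt (χ j), by exact_mod_cast (by omega), by rw [h2]; norm_num⟩
  · exact zero_mem _

/-- To reach `g_j`, `j - 3` letters are spent on shifts, which build `leadProd`. The other letters
differentiate and cost at most one unit of weight each. -/
lemma IsLeadingData.coeffPoly_mem [CharZero K] (l : List (Fin 2)) {j : ℕ} (hj : 3 ≤ j) :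
    coeffPoly IP k l j ∈
      leadSet k χ ((wt (leadProd IP k χ j) : ℤ) - l.length + j - 3) (leadProd IP k χ j).2 := by
  induction l generalizing j with
  | nil =>
    rw [coeffPoly]
    split_ifs with h
    · subst h
      refine AddSubmonoid.subset_closure ⟨1, one_mem _, ?_, fun h => ⟨1, one_pos, ?_⟩⟩
      · simp [leadProd]
      · simp [leadProd]
    · exact zero_mem _
  | cons b l ih =>
    have e : ((wt (leadProd IP k χ j) : ℤ) - (b :: l).length + j - 3) =
      ((wt (leadProd IP k χ j) : ℤ) - l.length + j - 3) - 1 := by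
      rw [List.length_cons]; push_cast; ring
    rw [coeffPoly, e]
    split_ifs
    · refine add_mem (derivation_mem_leadSet (fun j _ => hχ.derivZero_X_mem j) (ih hj)) ?_
      have := tail_mul_mem_leadSet hj (fun j hj => ih hj)
      exact mem_leadSet_congr this (by ring) rfl
    · exact derivation_mem_leadSet (fun j hj => hχ.derivOne_X_mem hj) (ih hj)

/-- A word whose coefficient of `g_i` has weight exactly `t` less than the first one to be
nonzero. -/
lemma IsLeadingData.exists_word [CharZero K] {i : ℕ} (hi : 3 ≤ i) (t : ℕ) (ht : t ≤ wt (leadProd IP k χ i)) :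
    ∃ l : List (Fin 2), l.length = i - 3 + t ∧ ∃ g a b, (g, a) ∈ monomials k χ ∧
      coeffPoly IP k l i = a + b ∧
      b ∈ leadSet k χ ((wt (leadProd IP k χ i) : ℤ) - t) (leadProd IP k χ i).2 ∧
      wt g + t = wt (leadProd IP k χ i) ∧ ∃ q : ℚ, 0 < q ∧ g.2 = q * (leadProd IP k χ i).2 := by
  induction t with
  | zero =>
    obtain ⟨m, rfl⟩ : ∃ m, i = m + 3 := ⟨i - 3, by omega⟩
    refine ⟨List.replicate m 0, by simp, _, _, 0, leadProd_mem_monomials IP m, (add_zero _).symm,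
      zero_mem _, rfl, 1, one_pos, by simp⟩
  | succ t ih =>
    obtain ⟨l, hl, g, a, b, hga, hab, hb, hw, q, hq, hgq⟩ := ih (by omega)
    -- The distinguished monomial `a` still has positive weight, so it has a factor `n_j` of
    -- positive weight, which the next letter will differentiate.
    obtain ⟨j, hjk, hj0, ⟨g', a'⟩, hz, e⟩ := exists_factor hga (by
      change 0 < wt g
      omega)
    rw [Prod.mk_mul_mk, Prod.mk.injEq] at e
    obtain ⟨rfl, rfl⟩ := e
    rw [wt_mul] at hw
    rw [Prod.snd_mul] at hgq
    have e1 : ((wt (leadProd IP k χ i) : ℤ) - (t + 1 : ℕ)) =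
      ((wt (leadProd IP k χ i) : ℤ) - t) - 1 := by push_cast; ring
    -- The terms in which the chosen factor is not differentiated, together with the old remainder,
    -- have admissible weights and leading coefficients; they can only reinforce the new monomial.
    have hrest : ∀ D : Derivation ℕ (MvPolynomial ℕ ℕ) (MvPolynomial ℕ ℕ),
        (∀ j ≤ k, D (X j) ∈ leadSet k χ ((wt (χ j) : ℤ) - 1) (χ j).2) →
        X j * D a' + D b ∈
          leadSet k χ ((wt (leadProd IP k χ i) : ℤ) - (t + 1 : ℕ)) (leadProd IP k χ i).2 := by
      intro D hD
      rw [e1]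
      refine add_mem ?_ (derivation_mem_leadSet hD hb)
      refine leadSet_le ?_ ?_ (mul_mem_leadSet (mem_leadSet_of_mem_monomials (X_mem_monomials hjk))
        (derivation_mem_leadSet hD (mem_leadSet_of_mem_monomials hz)))
      · omega
      · exact fun _ => ⟨q, hq, hgq⟩
    -- The coordinate `n_k` is moved by `g_1` only, and the lower ones by `g_0` only.
    rcases hjk.eq_or_lt with rfl | hjk'
    · obtain ⟨h1, h2⟩ := hχ.top.resolve_left (by omega)
      refine ⟨1 :: l, by simp [hl]; omega, g', a', _, hz, ?_,
        hrest (derivOne j) (fun j hj => hχ.derivOne_X_mem hj), by omega, q, hq, ?_⟩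
      · rw [coeffPoly, if_neg (by decide), hab, map_add, Derivation.leibniz, derivOne_X,
          if_pos rfl]
        simp only [smul_eq_mul]
        ring
      · rw [← hgq, h2, one_mul]
    · obtain ⟨h1, h2⟩ := (hχ.lt j hjk').resolve_left (by omega)
      refine ⟨0 :: l, by simp [hl]; omega, derivCoeff IP k χ j * g', derivCoeff IP k X j * a', _,
        mul_mem (derivCoeff_mem_monomials IP hjk') hz, ?_,
        add_mem (hrest (derivZero IP k) (fun j _ => hχ.derivZero_X_mem j)) (?_ :
          tailProd IP k X (k + 3 - i) * coeffPoly IP k l (i - 1) ∈ _),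
        by rw [wt_mul]; omega, wt (χ j) * q, ?_, ?_⟩
      · rw [coeffPoly, if_pos rfl, hab, map_add, Derivation.leibniz, derivZero_X, if_pos hjk']
        simp only [smul_eq_mul]
        ring
      · have := tail_mul_mem_leadSet (l := l) hi (fun j hj => hχ.coeffPoly_mem l hj)
        refine mem_leadSet_congr this ?_ rfl
        rw [hl]; push_cast [Nat.cast_sub hi]; ring
      · exact mul_pos (by exact_mod_cast hj0) hq
      · rw [Prod.snd_mul, h2, mul_assoc, hgq]
        push_cast
        ring

end Leading

open MvPolynomial (X)
open PowerSeries (derivative constantCoeff)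

/-! ### Focal curves as power series -/

section Series

variable {K : Type*} [Field K] {IP : Finset ℕ} {k : ℕ}

/-- The coordinates `n_j` along an integral curve of `g_0 + g_1`. -/
structure IsGenericSeries (IP : Finset ℕ) (k : ℕ) (x : ℕ → PowerSeries K) : Prop where
  top : derivative K (x k) = 1
  lt : ∀ j < k, derivative K (x j) = derivCoeff IP k x j

/-- The coordinates `n_j` along a focal curve. -/
def IsFocalSeries (IP : Finset ℕ) (k : ℕ) (z : ℕ → PowerSeries K) : Prop :=
  ∃ α, ∀ j < k, derivative K (z j) = α * derivCoeff IP k z j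

lemma order_X_pow_mul {s : ℕ} {u : PowerSeries K} (hu : constantCoeff u ≠ 0) :
    (PowerSeries.X ^ s * u).order = (s : ℕ∞) := by
  have : u.order = 0 := by
    have := PowerSeries.order_le (φ := u) 0 (by simpa using hu)
    simpa using this
  rw [PowerSeries.order_mul, PowerSeries.order_X_pow, this, add_zero]

/-- `x` has order `wt g` and leading coefficient `g.2` (if the latter is nonzero). -/
def HasLead (x : PowerSeries K) (g : Multiplicative ℕ × K) : Prop :=
  ∃ u, x = PowerSeries.X ^ wt g * u ∧ constantCoeff u = g.2

lemma HasLead.mul {x y : PowerSeries K} {g g' : Multiplicative ℕ × K} (h : HasLead x g)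
    (h' : HasLead y g') : HasLead (x * y) (g * g') := by
  obtain ⟨u, rfl, hu⟩ := h
  obtain ⟨u', rfl, hu'⟩ := h'
  exact ⟨u * u', by rw [wt_mul, pow_add]; ring, by rw [map_mul, hu, hu']; rfl⟩

lemma hasLead_one : HasLead (1 : PowerSeries K) 1 := ⟨1, by simp, by simp⟩

lemma HasLead.tailProd {x : ℕ → PowerSeries K} {χ : ℕ → Multiplicative ℕ × K} {j : ℕ}
    (h : ∀ l, j < l → l ≤ k → HasLead (x l) (χ l)) :
    HasLead (tailProd IP k x j) (tailProd IP k χ j) := by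
  unfold Goursat.tailProd
  have : ∀ l ∈ (Finset.Ioc j k).filter (· ∈ IP), HasLead (x l) (χ l) := fun l hl => by
    simp only [Finset.mem_filter, Finset.mem_Ioc] at hl
    exact h l hl.1.1 hl.1.2
  revert this
  generalize (Finset.Ioc j k).filter (· ∈ IP) = s
  intro hs
  induction s using Finset.induction_on with
  | empty => simpa using hasLead_one
  | insert a s ha ih =>
    rw [Finset.prod_insert ha, Finset.prod_insert ha]
    exact (hs a (by simp)).mul (ih fun l hl => hs l (by simp [hl]))

lemma HasLead.derivCoeff {x : ℕ → PowerSeries K} {χ : ℕ → Multiplicative ℕ × K} {j : ℕ}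
    (hj : j < k) (h : ∀ l, j < l → l ≤ k → HasLead (x l) (χ l)) :
    HasLead (derivCoeff IP k x j) (derivCoeff IP k χ j) := by
  unfold Goursat.derivCoeff
  refine HasLead.mul ?_ (HasLead.tailProd fun l h1 h2 => h l (by omega) h2)
  split_ifs
  · exact hasLead_one
  · exact h _ (by omega) (by omega)

/-- Order and leading coefficient of a power series. -/
def leadOf (x : PowerSeries K) : Multiplicative ℕ × K :=
  (Multiplicative.ofAdd x.order.toNat, PowerSeries.coeff x.order.toNat x)

lemma hasLead_leadOf (x : PowerSeries K) : HasLead x (leadOf x) :=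
  ⟨x.divXPowOrder, PowerSeries.X_pow_order_mul_divXPowOrder.symm,
    PowerSeries.constantCoeff_divXPowOrder⟩

lemma HasLead.order_eq {x : PowerSeries K} {g : Multiplicative ℕ × K} (h : HasLead x g)
    (hg : g.2 ≠ 0) : x.order = (wt g : ℕ∞) := by
  obtain ⟨u, rfl, hu⟩ := h
  exact order_X_pow_mul (by rwa [hu])

lemma HasLead.coeff_eq {x : PowerSeries K} {g : Multiplicative ℕ × K} (h : HasLead x g) :
    PowerSeries.coeff (wt g) x = g.2 := by
  obtain ⟨u, rfl, hu⟩ := h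
  rw [PowerSeries.coeff_X_pow_mul', if_pos le_rfl]
  simpa using hu

lemma HasLead.derivative {x : PowerSeries K} {s : ℕ} {c : K}
    (h : HasLead x (Multiplicative.ofAdd (s + 1), c)) :
    HasLead (derivative K x) (Multiplicative.ofAdd s, (s + 1) * c) := by
  obtain ⟨u, rfl, hu⟩ := h
  change constantCoeff u = c at hu
  refine ⟨((s : PowerSeries K) + 1) * u + PowerSeries.X * PowerSeries.derivative K u, ?_, ?_⟩
  · change PowerSeries.derivative K (PowerSeries.X ^ (s + 1) * u) = PowerSeries.X ^ s * _
    rw [Derivation.leibniz, PowerSeries.derivative_pow, PowerSeries.derivative_X]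
    simp only [smul_eq_mul, Nat.add_sub_cancel]
    push_cast
    ring
  · simp [hu]

/-- Downward induction: the derivative of `x j` is `1` or a product of series of higher index, hence
nonzero. -/
lemma IsGenericSeries.ne_zero {x : ℕ → PowerSeries K} (hx : IsGenericSeries IP k x)
    {j : ℕ} (hj : j ≤ k) : x j ≠ 0 := by
  induction h : k - j using Nat.strongRecOn generalizing j with
  | ind m ih =>
    intro h0
    rcases hj.eq_or_lt with rfl | hlt
    · have := hx.top
      rw [h0, map_zero] at this
      exact zero_ne_one this
    · have := hx.lt j hlt
      rw [h0, map_zero] at this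
      revert this
      rw [imp_false, eq_comm]
      unfold derivCoeff tailProd
      refine mul_ne_zero ?_ (Finset.prod_ne_zero_iff.2 fun l hl => ?_)
      · split_ifs
        · exact one_ne_zero
        · exact ih (k - (j + 1)) (by omega) (by omega) rfl
      · simp only [Finset.mem_filter, Finset.mem_Ioc] at hl
        exact ih (k - l) (by omega) hl.1.2 rfl

/-! ### Orders along the generic curve are minimal -/

namespace IsGenericSeries

variable [CharZero K] {x : ℕ → PowerSeries K} (hx : IsGenericSeries IP k x)
include hx

/-- A series of positive order `s` and leading coefficient `c` has derivative of order `s - 1` and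
leading coefficient `s c`; this is compared with the differential equation. -/
lemma isLeadingData : IsLeadingData IP k fun j => leadOf (x j) where
  ne_zero j hj := PowerSeries.coeff_order (hx.ne_zero hj)
  top := by
    rcases Nat.eq_zero_or_pos (wt (leadOf (x k))) with h | h
    · exact Or.inl h
    · right
      obtain ⟨s, hs⟩ : ∃ s, wt (leadOf (x k)) = s + 1 := ⟨_, (Nat.succ_pred_eq_of_pos h).symm⟩
      have h1 := hasLead_leadOf (x k)
      have h0 : (leadOf (x k)).2 ≠ 0 := PowerSeries.coeff_order (hx.ne_zero le_rfl)
      have e : leadOf (x k) = (Multiplicative.ofAdd (s + 1), (leadOf (x k)).2) :=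
        Prod.ext hs rfl
      rw [e] at h1
      have h2 := h1.derivative
      rw [hx.top] at h2
      have h3 := h2.order_eq (mul_ne_zero (by exact_mod_cast s.succ_ne_zero) h0)
      rw [PowerSeries.order_one] at h3
      have h4 : s = 0 := by
        change (0 : ℕ∞) = (s : ℕ) at h3
        exact_mod_cast h3.symm
      subst h4
      have h5 := h2.coeff_eq
      refine ⟨hs, ?_⟩
      change PowerSeries.coeff 0 1 = _ at h5
      simpa using h5.symm
  lt j hj := by
    rcases Nat.eq_zero_or_pos (wt (leadOf (x j))) with h | h
    · exact Or.inl h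
    · right
      obtain ⟨s, hs⟩ : ∃ s, wt (leadOf (x j)) = s + 1 := ⟨_, (Nat.succ_pred_eq_of_pos h).symm⟩
      have h1 := hasLead_leadOf (x j)
      have h0 : (leadOf (x j)).2 ≠ 0 := PowerSeries.coeff_order (hx.ne_zero hj.le)
      have e : leadOf (x j) = (Multiplicative.ofAdd (s + 1), (leadOf (x j)).2) :=
        Prod.ext hs rfl
      rw [e] at h1
      have h2 := h1.derivative
      rw [hx.lt j hj] at h2
      have h3 := h2.order_eq (mul_ne_zero (by exact_mod_cast s.succ_ne_zero) h0)
      have h4 : HasLead (derivCoeff IP k x j) (derivCoeff IP k (fun j => leadOf (x j)) j) :=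
        HasLead.derivCoeff hj fun l _ _ => hasLead_leadOf (x l)
      have h5 : (derivCoeff IP k (fun j => leadOf (x j)) j).2 ≠ 0 := by
        have : (derivCoeff IP k (fun j => leadOf (x j)) j).2 =
            derivCoeff IP k (fun j => (leadOf (x j)).2) j :=
          map_derivCoeff IP (fun j => leadOf (x j)) (MonoidHom.snd (Multiplicative ℕ) K) k j
        rw [this]
        unfold derivCoeff tailProd
        refine mul_ne_zero ?_ (Finset.prod_ne_zero_iff.2 fun l hl => ?_)
        · split_ifs
          · exact one_ne_zero
          · exact PowerSeries.coeff_order (hx.ne_zero (by omega))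
        · simp only [Finset.mem_filter, Finset.mem_Ioc] at hl
          exact PowerSeries.coeff_order (hx.ne_zero hl.1.2)
      have h6 := h4.order_eq h5
      rw [h3] at h6
      have h7 : s = wt (derivCoeff IP k (fun j => leadOf (x j)) j) := by
        change ((s : ℕ) : ℕ∞) = _ at h6
        exact_mod_cast h6
      refine ⟨by rw [hs, ← h7], ?_⟩
      rw [← h4.coeff_eq, ← h7, hs]
      have h8 := h2.coeff_eq
      change PowerSeries.coeff s _ = (s + 1) * (leadOf (x j)).2 at h8
      rw [h8]
      push_cast
      rfl

omit [CharZero K] in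
lemma order_eq {j : ℕ} (hj : j ≤ k) : (x j).order = (wt (leadOf (x j)) : ℕ∞) :=
  (PowerSeries.coe_toNat_order (hx.ne_zero hj)).symm

/-- The coordinates along a focal curve vanish at least to the same order as along a generic
one. -/
lemma X_pow_dvd {z : ℕ → PowerSeries K} (hz : IsFocalSeries IP k z)
    (h0 : ∀ j ≤ k, constantCoeff (z j) = constantCoeff (x j)) {j : ℕ} (hj : j ≤ k) :
    PowerSeries.X ^ wt (leadOf (x j)) ∣ z j := by
  induction h : k - j using Nat.strongRecOn generalizing j with
  | ind m ih =>
    rcases Nat.eq_zero_or_pos (wt (leadOf (x j))) with hw | hw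
    · rw [hw, pow_zero]
      exact one_dvd _
    have hz0 : constantCoeff (z j) = 0 := by
      rw [h0 j hj]
      have := PowerSeries.X_pow_order_dvd (φ := x j)
      exact PowerSeries.X_dvd_iff.1 ((dvd_pow_self _ (show (x j).order.toNat ≠ 0 from hw.ne')).trans this)
    rcases hj.eq_or_lt with rfl | hlt
    · obtain ⟨h1, -⟩ := hx.isLeadingData.top.resolve_left hw.ne'
      rw [h1, pow_one]
      exact PowerSeries.X_dvd_iff.2 hz0
    · obtain ⟨h1, -⟩ := (hx.isLeadingData.lt j hlt).resolve_left hw.ne'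
      obtain ⟨α, hα⟩ := hz
      have ihl : ∀ l, j < l → l ≤ k → PowerSeries.X ^ wt (leadOf (x l)) ∣ z l :=
        fun l hl hlk => ih (k - l) (by omega) hlk rfl
      have htail : PowerSeries.X ^ wt (tailProd IP k (fun j => leadOf (x j)) (j + 1)) ∣
          tailProd IP k z (j + 1) := by
        unfold tailProd
        rw [wt_prod, ← Finset.prod_pow_eq_pow_sum]
        refine Finset.prod_dvd_prod_of_dvd _ _ fun l hl => ?_
        simp only [Finset.mem_filter, Finset.mem_Ioc] at hl
        exact ihl l (by omega) hl.1.2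
      -- The derivative of `z j` is a multiple of a product of later coordinates, each divisible by
      -- the required power by induction.
      have hd : PowerSeries.X ^ wt (derivCoeff IP k (fun j => leadOf (x j)) j) ∣
          PowerSeries.derivative K (z j) := by
        rw [hα j hlt]
        refine Dvd.dvd.mul_left ?_ _
        unfold derivCoeff
        rw [wt_mul, pow_add]
        refine mul_dvd_mul ?_ htail
        split_ifs
        · simp
        · exact ihl _ (by omega) (by omega)
      change wt (leadOf (x j)) = _ at h1
      rw [h1]
      -- Integration: the constant term of `z j` vanishes and positive integers are invertible, so
      -- one more power of `X` is gained.
      rw [PowerSeries.X_pow_dvd_iff] at hd ⊢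
      intro n hn
      cases n with
      | zero => simpa using hz0
      | succ n =>
        have := hd n (by omega)
        rw [PowerSeries.coeff_derivative] at this
        exact (mul_eq_zero.1 this).resolve_right (by exact_mod_cast n.succ_ne_zero)

lemma order_le {z : ℕ → PowerSeries K} (hz : IsFocalSeries IP k z)
    (h0 : ∀ j ≤ k, constantCoeff (z j) = constantCoeff (x j)) {j : ℕ} (hj : j ≤ k) :
    (x j).order ≤ (z j).order := by
  rw [hx.order_eq hj]
  exact PowerSeries.nat_le_order _ _ (PowerSeries.X_pow_dvd_iff.1 (hx.X_pow_dvd hz h0 hj))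

omit [CharZero K] hx in
lemma hasLead_evalN {g : Multiplicative ℕ × K} {a : MvPolynomial ℕ ℕ}
    (h : (g, a) ∈ monomials k fun j => leadOf (x j)) : HasLead (evalN x a) g := by
  revert h
  generalize hy' : (g, a) = y
  intro hy
  rw [show g = y.1 from congrArg Prod.fst hy', show a = y.2 from congrArg Prod.snd hy']
  clear hy'
  unfold monomials at hy
  induction hy using Submonoid.closure_induction with
  | one => simpa using hasLead_one
  | mem y hm =>
    obtain ⟨j, hj, rfl⟩ := hm
    simpa using hasLead_leadOf (x j)
  | mul y z _ _ ihy ihz =>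
    rw [Prod.fst_mul, Prod.snd_mul, map_mul]
    exact ihy.mul ihz

omit hx in
-- Nonnegative rational multiples of `κ` are closed under addition. Added to a monomial whose
-- multiple is strictly positive, they therefore cannot cancel it.
lemma exists_evalN_leadSet {s : ℕ} {κ : K} {a : MvPolynomial ℕ ℕ}
    (h : a ∈ leadSet k (fun j => leadOf (x j)) s κ) :
    ∃ u, ∃ q : ℚ, 0 ≤ q ∧ evalN x a = PowerSeries.X ^ s * u ∧ constantCoeff u = q * κ := by
  unfold leadSet at h
  induction h using AddSubmonoid.closure_induction with
  | zero => exact ⟨0, 0, le_rfl, by simp, by simp⟩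
  | add a b _ _ iha ihb =>
    obtain ⟨u, q, hq, e1, e2⟩ := iha
    obtain ⟨u', q', hq', e1', e2'⟩ := ihb
    exact ⟨u + u', q + q', add_nonneg hq hq', by rw [map_add, e1, e1', mul_add], by
      rw [map_add, e2, e2', Rat.cast_add, add_mul]⟩
  | mem a ha =>
    obtain ⟨g, hg, h1, h2⟩ := ha
    obtain ⟨u, e1, e2⟩ := hasLead_evalN hg
    have h1 : s ≤ wt g := by exact_mod_cast h1
    rcases h1.eq_or_lt with h3 | h3
    · obtain ⟨q, hq, e⟩ := h2 (by rw [h3])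
      exact ⟨u, q, hq.le, by rw [e1, h3], by rw [e2, e]⟩
    · refine ⟨PowerSeries.X ^ (wt g - s) * u, 0, le_rfl, ?_, ?_⟩
      · rw [e1, ← mul_assoc, ← pow_add, Nat.add_sub_cancel' h3.le]
      · have : wt g - s ≠ 0 := by omega
        simp [this]

omit hx [CharZero K] in
-- Along an arbitrary focal curve only the weights matter: cancellation could only raise the order.
lemma X_pow_dvd_evalN {z : ℕ → PowerSeries K}
    (hz : ∀ j ≤ k, PowerSeries.X ^ wt (leadOf (x j)) ∣ z j) {s : ℕ} {κ : K}
    {a : MvPolynomial ℕ ℕ} (h : a ∈ leadSet k (fun j => leadOf (x j)) s κ) :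
    PowerSeries.X ^ s ∣ evalN z a := by
  have key : ∀ y ∈ monomials k fun j => leadOf (x j),
      PowerSeries.X ^ wt y.1 ∣ evalN z y.2 := by
    intro y hy
    unfold monomials at hy
    induction hy using Submonoid.closure_induction with
    | one => simp
    | mem y hm =>
      obtain ⟨j, hj, rfl⟩ := hm
      simpa using hz j hj
    | mul y z _ _ ihy ihz =>
      rw [Prod.fst_mul, Prod.snd_mul, map_mul, wt_mul, pow_add]
      exact mul_dvd_mul ihy ihz
  unfold leadSet at h
  induction h using AddSubmonoid.closure_induction with
  | zero => simp
  | add a b _ _ iha ihb => rw [map_add]; exact dvd_add iha ihb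
  | mem a ha =>
    obtain ⟨g, hg, h1, -⟩ := ha
    have h1 : s ≤ wt g := by exact_mod_cast h1
    exact (pow_dvd_pow _ h1).trans (key (g, a) hg)

end IsGenericSeries

/-- For `j ∈ IP`, the coordinate `n_j` occurs in the factor of index `l` exactly when `k + 2 - l <
j`. This leaves `i + j - k - 3` values of `l` in `[3, i)`. -/
lemma wt_leadProd (χ : ℕ → Multiplicative ℕ × K) {i : ℕ} (hi : 3 ≤ i) (hik : i ≤ k + 1) :
    wt (leadProd IP k χ i) =
      ∑ j ∈ Finset.Icc (k + 4 - i) k, (i + j - (k + 3)) * if j ∈ IP then wt (χ j) else 0 := by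
  -- The added terms have truncated multiplicity `0`, so the range of summation no longer depends on
  -- `i`.
  have e : ∀ i ≤ k + 1, ∑ j ∈ Finset.Icc (k + 4 - i) k,
      (i + j - (k + 3)) * (if j ∈ IP then wt (χ j) else 0) =
      ∑ j ∈ Finset.range (k + 1), (i + j - (k + 3)) * if j ∈ IP then wt (χ j) else 0 := by
    intro i hi
    refine Finset.sum_subset (fun j hj => ?_) fun j hj hj' => ?_
    · simp only [Finset.mem_Icc, Finset.mem_range] at hj ⊢
      omega
    · simp only [Finset.mem_Icc, Finset.mem_range] at hj hj'
      rw [show i + j - (k + 3) = 0 by omega, zero_mul]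
  rw [e i hik]
  induction i, hi using Nat.le_induction with
  | base =>
    rw [Finset.sum_eq_zero]
    · simp [leadProd]
    · intro j hj
      rw [Finset.mem_range] at hj
      rw [show 3 + j - (k + 3) = 0 by omega, zero_mul]
  | succ i hi ih =>
    rw [leadProd_succ hi, wt_mul, ih (by omega)]
    have : wt (tailProd IP k χ (k + 2 - i)) = ∑ j ∈ Finset.range (k + 1),
        if k + 2 - i < j then (if j ∈ IP then wt (χ j) else 0) else 0 := by
      unfold tailProd
      rw [wt_prod]
      conv_rhs => rw [← Finset.sum_filter]
      rw [Finset.sum_filter]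
      refine Finset.sum_congr ?_ fun _ _ => rfl
      ext j
      simp only [Finset.mem_Ioc, Finset.mem_filter, Finset.mem_range]
      omega
    rw [this, ← Finset.sum_add_distrib]
    refine Finset.sum_congr rfl fun j hj => ?_
    rw [Finset.mem_range] at hj
    by_cases h1 : k + 2 - i < j
    · rw [if_pos h1, show i + 1 + j - (k + 3) = i + j - (k + 3) + 1 by omega, add_mul, one_mul]
    · rw [if_neg h1, show i + 1 + j - (k + 3) = 0 by omega, show i + j - (k + 3) = 0 by omega]
      simp

/-- The order along a generic curve of the coefficient of `g_i` in a suitable iterated bracket,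
which is the least one along all focal curves. -/
theorem IsGenericSeries.exists_word [CharZero K] {x : ℕ → PowerSeries K} (hx : IsGenericSeries IP k x)
    {h i : ℕ} (hi : 3 ≤ i) (hih : i ≤ h) (hik : i ≤ k + 1) {VO : ℕ → ℕ∞}
    (hVO : ∀ j, 1 ≤ j → j ≤ k → VO j = if j ∈ IP then (x j).order else 0) :
    ∃ l : List (Fin 2), l.length ≤ h - 3 ∧
      (evalN x (coeffPoly IP k l i)).order = eInv k VO h i ∧
      ∀ z, IsFocalSeries IP k z → (∀ j ≤ k, constantCoeff (z j) = constantCoeff (x j)) →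
        eInv k VO h i ≤ (evalN z (coeffPoly IP k l i)).order := by
  set χ : ℕ → Multiplicative ℕ × K := fun j => leadOf (x j) with hχdef
  have hχ : IsLeadingData IP k χ := hx.isLeadingData
  set E := wt (leadProd IP k χ i) with hE
  -- The weight is lowered as often as `h` permits, but not below `0`; the word has length `i - 3 +
  -- min (h - i) E ≤ h - 3`.
  obtain ⟨l, hl, g, a, b, hga, hab, hb, hw, q, hq, hgq⟩ :=
    hχ.exists_word hi (min (h - i) E) (min_le_right _ _)
  have hEV : eInv k VO h i = ((wt g : ℕ) : ℕ∞) := by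
    have e1 : ∑ j ∈ Finset.Icc (k + 4 - i) k, ((i + j - (k + 3) : ℕ) : ℕ∞) * VO j =
        ((E : ℕ) : ℕ∞) := by
      rw [hE, wt_leadProd χ hi hik, Nat.cast_sum]
      refine Finset.sum_congr rfl fun j hj => ?_
      rw [Finset.mem_Icc] at hj
      rw [hVO j (by omega) hj.2, Nat.cast_mul]
      split_ifs
      · rw [hx.order_eq hj.2]
      · simp
    rw [eInv, e1, ← ENat.natCast_sub, show E - (h - i) = wt g by omega]
  have hb' : b ∈ leadSet k χ (wt g : ℕ) (leadProd IP k χ i).2 :=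
    mem_leadSet_congr hb (by omega) rfl
  have hκ : (leadProd IP k χ i).2 ≠ 0 := by
    unfold leadProd tailProd
    rw [Prod.snd_prod]
    refine Finset.prod_ne_zero_iff.2 fun j _ => ?_
    rw [Prod.snd_prod]
    refine Finset.prod_ne_zero_iff.2 fun l hl => ?_
    simp only [Finset.mem_filter, Finset.mem_Ioc] at hl
    exact hχ.ne_zero l hl.1.2
  refine ⟨l, by omega, ?_, fun z hz h0 => ?_⟩
  · obtain ⟨u, e1, e2⟩ := IsGenericSeries.hasLead_evalN hga
    obtain ⟨u', q', hq', e1', e2'⟩ := IsGenericSeries.exists_evalN_leadSet hb'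
    rw [hab, map_add, e1, e1', ← mul_add, hEV]
    refine order_X_pow_mul ?_
    -- The leading coefficient is `(q + q') κ` with `q > 0`, `q' ≥ 0` and `κ ≠ 0`.
    rw [map_add, e2, e2', hgq, ← add_mul, ← Rat.cast_add]
    exact mul_ne_zero (by exact_mod_cast (add_pos_of_pos_of_nonneg hq hq').ne') hκ
  · rw [hEV, hab]
    refine PowerSeries.nat_le_order _ _ (PowerSeries.X_pow_dvd_iff.1 ?_)
    rw [map_add]
    have hz' := fun j (hj : j ≤ k) => hx.X_pow_dvd hz h0 hj
    refine dvd_add (IsGenericSeries.X_pow_dvd_evalN hz' (κ := g.2)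
      (mem_leadSet_of_mem_monomials hga)) (IsGenericSeries.X_pow_dvd_evalN hz' hb')

end Series

open PowerSeries (derivative constantCoeff)

/-! ### The focal condition along a curve -/

/-- The common factor `α` is the derivative of the last retained coordinate `r_k`. Going down,
`r_j'` is `r_k'` times the inverted coordinates above level `j`, and the focal equations then give
each `n_j'`. -/
lemma isFocalSeries_of_focal {K : Type*} [Field K] {IP : Finset ℕ} {k : ℕ} {y : ℕ → PowerSeries K}
    (h : ∀ j ∈ Finset.Icc 1 k, derivative K (y (deaIdx IP j)) =
      y (j + 1) * derivative K (y (retIdx IP j))) :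
    IsFocalSeries IP k fun j => y (j + 1) := by
  have key : ∀ j ≤ k, derivative K (y (retIdx IP j)) =
      derivative K (y (retIdx IP k)) * tailProd IP k (fun j => y (j + 1)) j := by
    intro j hj
    induction hm : k - j generalizing j with
    | zero =>
      obtain rfl : j = k := by omega
      rw [tailProd_of_le _ _ le_rfl, mul_one]
    | succ m ih =>
      have ih := ih (j + 1) (by omega) (by omega)
      have h := h (j + 1) (by simp; omega)
      rw [tailProd_eq_mul _ _ (by omega)]
      rw [retIdx] at ih
      rw [retIdx, deaIdx] at h
      split_ifs at h ih ⊢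
      · rw [h, ih]; ring
      · rw [ih, one_mul]
  refine ⟨derivative K (y (retIdx IP k)), fun j hj => ?_⟩
  have h := h (j + 1) (by simp; omega)
  have h' := key (j + 1) (by omega)
  unfold derivCoeff
  rw [retIdx] at h'
  rw [retIdx, deaIdx] at h
  split_ifs at h h' ⊢
  · rw [h', one_mul]
  · rw [h, h']; ring

/-- Converse with `α = 1`, stated for any values `δ` of the derivatives so that it needs no curve.
-/
lemma focal_of_deriv {R : Type*} [CommRing R] {IP : Finset ℕ} {k : ℕ} {y δ : ℕ → R}
    (h0 : δ 0 = tailProd IP k (fun j => y (j + 1)) 0)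
    (h : ∀ j < k, δ (j + 1) = derivCoeff IP k (fun j => y (j + 1)) j) {j : ℕ}
    (hj : j ∈ Finset.Icc 1 k) : δ (deaIdx IP j) = y (j + 1) * δ (retIdx IP j) := by
  have key : ∀ j ≤ k, δ (retIdx IP j) = tailProd IP k (fun j => y (j + 1)) j := by
    intro j hj
    induction j with
    | zero => exact h0
    | succ j ih =>
      have ih := ih (by omega)
      rw [tailProd_eq_mul _ _ (by omega)] at ih
      have h := h j (by omega)
      unfold derivCoeff at h
      rw [retIdx]
      split_ifs at h ih ⊢
      · rw [h, one_mul]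
      · rw [ih, one_mul]
  obtain ⟨j, rfl⟩ : ∃ j', j = j' + 1 := ⟨j - 1, by simp at hj; omega⟩
  rw [Finset.mem_Icc] at hj
  have h := h j (by omega)
  have h1 := key j (by omega)
  have h2 := key (j + 1) (by omega)
  rw [tailProd_eq_mul _ _ (by omega)] at h1
  unfold derivCoeff at h
  rw [deaIdx]
  rw [retIdx] at h2 ⊢
  split_ifs at h h1 h2 ⊢
  · rw [h1, h2]
  · rw [h, h2]

/-! ### Polynomial integral curves of `g_0 + g_1` -/

section Polynomial

open Polynomial

lemma exists_derivative_eq {K : Type*} [Field K] [CharZero K] (p : K[X]) (c : K) :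
    ∃ q : K[X], Polynomial.derivative q = p ∧ q.eval 0 = c := by
  have : ∃ q : K[X], Polynomial.derivative q = p := by
    induction p using Polynomial.induction_on' with
    | add p q hp hq =>
      obtain ⟨a, rfl⟩ := hp
      obtain ⟨b, rfl⟩ := hq
      exact ⟨a + b, map_add _ _ _⟩
    | monomial n a =>
      refine ⟨monomial (n + 1) (a / (n + 1)), ?_⟩
      rw [derivative_monomial, Nat.add_sub_cancel, Nat.cast_succ,
        div_mul_cancel₀ _ (by exact_mod_cast n.succ_ne_zero)]
  obtain ⟨q, hq⟩ := this
  exact ⟨q + C (c - q.eval 0), by simp [hq], by simp⟩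

/-- Downward construction: after `m` steps the coordinates of index at least `k - m` are found, and
the next is a primitive of a polynomial in them. -/
lemma exists_polynomials_derivative_eq {K : Type*} [Field K] [CharZero K] (IP : Finset ℕ) (k : ℕ)
    (p : ℕ → K) : ∀ m ≤ k, ∃ y : ℕ → K[X],
      (∀ i, k - m ≤ i → i ≤ k → (y i).eval 0 = p (i + 1)) ∧ Polynomial.derivative (y k) = 1 ∧
      ∀ j < k, k - m ≤ j → Polynomial.derivative (y j) = derivCoeff IP k y j := by
  intro m hm
  induction m with
  | zero =>
    obtain ⟨q, hq, hq'⟩ := exists_derivative_eq (1 : K[X]) (p (k + 1))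
    refine ⟨fun _ => q, fun i h1 h2 => ?_, hq, fun j h1 h2 => by omega⟩
    obtain rfl : i = k := by omega
    exact hq'
  | succ m ih =>
    obtain ⟨y, h1, h2, h3⟩ := ih (by omega)
    obtain ⟨q, hq, hq'⟩ := exists_derivative_eq (derivCoeff IP k y (k - (m + 1)))
      (p (k - (m + 1) + 1))
    have e : ∀ l, k - (m + 1) < l → Function.update y (k - (m + 1)) q l = y l := fun l hl =>
      Function.update_of_ne (by omega) _ _
    have e' : Function.update y (k - (m + 1)) q (k - (m + 1)) = q := Function.update_self _ _ _
    have e2 : ∀ j < k, k - (m + 1) ≤ j →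
        derivCoeff IP k (Function.update y (k - (m + 1)) q) j = derivCoeff IP k y j :=
      fun j hj hj' => derivCoeff_congr _ _ hj fun l h1 _ => e l (by omega)
    refine ⟨Function.update y (k - (m + 1)) q, fun i hi hik => ?_, ?_, fun j hj hj' => ?_⟩
    · rcases hi.eq_or_lt with rfl | hi
      · rw [e', hq']
      · rw [e i hi, h1 i (by omega) hik]
    · rw [e k (by omega), h2]
    · rw [e2 j hj hj']
      rcases hj'.eq_or_lt with rfl | hj'
      · rw [e', hq]
      · rw [e j hj', h3 j hj (by omega)]

/-- The integral curve of `g_0 + g_1` through a given point has polynomial coordinates. -/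
lemma exists_generic_polynomials {K : Type*} [Field K] [CharZero K] (IP : Finset ℕ) (k : ℕ)
    (p : ℕ → K) : ∃ y : ℕ → K[X], (∀ i ≤ k + 1, (y i).eval 0 = p i) ∧
      Polynomial.derivative (y (k + 1)) = 1 ∧
      Polynomial.derivative (y 0) = tailProd IP k (fun j => y (j + 1)) 0 ∧
      ∀ j < k, Polynomial.derivative (y (j + 1)) = derivCoeff IP k (fun j => y (j + 1)) j := by
  obtain ⟨y, h1, h2, h3⟩ := exists_polynomials_derivative_eq IP k p k le_rfl
  obtain ⟨q, hq, hq'⟩ := exists_derivative_eq (tailProd IP k y 0) (p 0)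
  obtain ⟨Y, hY0, hY⟩ : ∃ Y : ℕ → K[X], Y 0 = q ∧ ∀ j, Y (j + 1) = y j :=
    ⟨fun i => Nat.casesOn i q y, rfl, fun _ => rfl⟩
  have hY' : (fun j => Y (j + 1)) = y := funext hY
  rw [← hY'] at hq
  refine ⟨Y, fun i hi => ?_, by rw [hY, h2], by rw [hY0, hq], fun j hj => ?_⟩
  · cases i with
    | zero => rw [hY0, hq']
    | succ i => rw [hY, h1 i (by omega) (by omega)]
  · rw [hY, hY', h3 j hj (by omega)]

end Polynomial

/-! ### Taylor series -/

section Taylor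

variable {𝕜 : Type*} [RCLike 𝕜]

/-- The Taylor series at `0`. -/
def taylor (φ : 𝕜 → 𝕜) : PowerSeries 𝕜 :=
  PowerSeries.mk fun n => iteratedDeriv n φ 0 / (n.factorial : 𝕜)

lemma coeff_taylor (φ : 𝕜 → 𝕜) (n : ℕ) :
    PowerSeries.coeff n (taylor φ) = iteratedDeriv n φ 0 / (n.factorial : 𝕜) :=
  PowerSeries.coeff_mk _ _

lemma coeff_taylor_ne_zero (φ : 𝕜 → 𝕜) (n : ℕ) :
    PowerSeries.coeff n (taylor φ) ≠ 0 ↔ iteratedDeriv n φ 0 ≠ 0 := by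
  rw [coeff_taylor, ne_eq, div_eq_zero_iff, not_or]
  exact and_iff_left (by exact_mod_cast n.factorial_ne_zero)

/-- A flat function has Taylor series `0`, and both sides are then `⊤`. -/
lemma order_taylor (φ : 𝕜 → 𝕜) : (taylor φ).order = Mfd.vanishingOrder 𝕜 φ := by
  unfold Mfd.vanishingOrder
  refine le_antisymm (le_iInf₂ fun n hn => ?_) ?_
  · exact PowerSeries.order_le n ((coeff_taylor_ne_zero φ n).2 hn)
  · refine PowerSeries.le_order _ _ fun n hn => ?_
    by_contra h
    exact absurd (iInf₂_le n ((coeff_taylor_ne_zero φ n).1 h)) (not_le.2 hn)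

lemma constantCoeff_taylor (φ : 𝕜 → 𝕜) : constantCoeff (taylor φ) = φ 0 := by
  rw [← PowerSeries.coeff_zero_eq_constantCoeff_apply, coeff_taylor]
  simp

lemma derivative_taylor (φ : 𝕜 → 𝕜) : derivative 𝕜 (taylor φ) = taylor (deriv φ) := by
  ext n
  rw [PowerSeries.coeff_derivative, coeff_taylor, coeff_taylor, iteratedDeriv_succ',
    Nat.factorial_succ]
  have h1 : (n.factorial : 𝕜) ≠ 0 := by exact_mod_cast n.factorial_ne_zero
  have h2 : ((n : 𝕜) + 1) ≠ 0 := by exact_mod_cast n.succ_ne_zero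
  push_cast
  field_simp

lemma taylor_congr {φ ψ : 𝕜 → 𝕜} (h : φ =ᶠ[nhds 0] ψ) : taylor φ = taylor ψ := by
  ext n
  rw [coeff_taylor, coeff_taylor, h.iteratedDeriv_eq]

lemma taylor_const (c : 𝕜) : taylor (fun _ : 𝕜 => c) = PowerSeries.C c := by
  ext n
  rw [coeff_taylor, iteratedDeriv_const, PowerSeries.coeff_C]
  split_ifs with h <;> simp [h]

lemma taylor_add {φ ψ : 𝕜 → 𝕜} (hφ : ContDiffAt 𝕜 ∞ φ 0) (hψ : ContDiffAt 𝕜 ∞ ψ 0) :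
    taylor (fun t => φ t + ψ t) = taylor φ + taylor ψ := by
  ext n
  rw [map_add, coeff_taylor, coeff_taylor, coeff_taylor, ← add_div]
  congr 1
  exact iteratedDeriv_add (hφ.of_le (by exact_mod_cast le_top))
    (hψ.of_le (by exact_mod_cast le_top))

lemma taylor_mul {φ ψ : 𝕜 → 𝕜} (hφ : ContDiffAt 𝕜 ∞ φ 0) (hψ : ContDiffAt 𝕜 ∞ ψ 0) :
    taylor (fun t => φ t * ψ t) = taylor φ * taylor ψ := by
  ext n
  rw [PowerSeries.coeff_mul, Finset.Nat.sum_antidiagonal_eq_sum_range_succ_mk, coeff_taylor]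
  have := iteratedDeriv_mul (n := n) (hφ.of_le (by exact_mod_cast le_top))
    (hψ.of_le (by exact_mod_cast le_top))
  change iteratedDeriv n (φ * ψ) 0 / _ = _
  rw [this, Finset.sum_div]
  refine Finset.sum_congr rfl fun i hi => ?_
  rw [Finset.mem_range] at hi
  have h0 : (n.factorial : 𝕜) ≠ 0 := by exact_mod_cast n.factorial_ne_zero
  have h1 : (i.factorial : 𝕜) ≠ 0 := by exact_mod_cast i.factorial_ne_zero
  have h2 : ((n - i).factorial : 𝕜) ≠ 0 := by exact_mod_cast (n - i).factorial_ne_zero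
  have h3 : (n.choose i : 𝕜) * i.factorial * (n - i).factorial = n.factorial := by
    exact_mod_cast Nat.choose_mul_factorial_mul_factorial (by omega : i ≤ n)
  simp only [coeff_taylor]
  rw [← h3]
  have h4 : (n.choose i : 𝕜) ≠ 0 := by
    exact_mod_cast (Nat.choose_pos (by omega : i ≤ n)).ne'
  field_simp

lemma taylor_polynomial (p : Polynomial 𝕜) :
    taylor (fun t => p.eval t) = (p : PowerSeries 𝕜) := by
  have hs : ∀ p : Polynomial 𝕜, ContDiffAt 𝕜 ∞ (fun t => p.eval t) 0 := fun p =>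
    by
    simpa using (Polynomial.contDiff_aeval (𝕜 := 𝕜) p ∞).contDiffAt
  have hX : taylor (fun t : 𝕜 => t) = PowerSeries.X := by
    ext n
    rw [coeff_taylor, iteratedDeriv_fun_id_zero, PowerSeries.coeff_X]
    split_ifs with h <;> simp [h]
  induction p using Polynomial.induction_on with
  | C a => simp [taylor_const]
  | add p q hp hq =>
    simp only [Polynomial.eval_add]
    rw [taylor_add (hs p) (hs q), hp, hq, Polynomial.coe_add]
  | monomial n a ih =>
    rw [pow_succ, ← mul_assoc]
    simp only [Polynomial.eval_mul (q := Polynomial.X), Polynomial.eval_X]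
    rw [taylor_mul (hs _) (ψ := fun t => t) contDiffAt_id, ih, hX, ← Polynomial.coe_X,
      ← Polynomial.coe_mul]

end Taylor

open PowerSeries (derivative constantCoeff)

namespace Mfd

variable (𝕜 : Type*) [RCLike 𝕜] (k : ℕ)

/-! ### The calculus of smooth vector fields -/

/-- The coordinate functions as continuous linear maps. -/
def coordL (i : ℕ) : Space 𝕜 k →L[𝕜] 𝕜 :=
  if h : i < k + 2 then ContinuousLinearMap.proj ⟨i, h⟩ else 0

lemma coordL_eq (i : ℕ) : ⇑(coordL 𝕜 k i) = coord 𝕜 k i := by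
  unfold coordL coord
  split_ifs <;> rfl

lemma contDiff_coord (i : ℕ) : ContDiff 𝕜 ∞ (coord 𝕜 k i) := by
  rw [← coordL_eq]
  exact (coordL 𝕜 k i).contDiff

/-- The smooth functions. -/
def smoothFunctions : Subring (Space 𝕜 k → 𝕜) where
  carrier := {a | ContDiff 𝕜 ∞ a}
  mul_mem' {a b} ha hb := show ContDiff 𝕜 ∞ (a * b) from ContDiff.mul ha hb
  one_mem' := show ContDiff 𝕜 ∞ (1 : Space 𝕜 k → 𝕜) from contDiff_const
  add_mem' {a b} ha hb := show ContDiff 𝕜 ∞ (a + b) from ContDiff.add ha hb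
  zero_mem' := show ContDiff 𝕜 ∞ (0 : Space 𝕜 k → 𝕜) from contDiff_const
  neg_mem' {a} ha := show ContDiff 𝕜 ∞ (-a) from ContDiff.neg ha

/-- The smooth vector fields. -/
def smoothFields : AddSubgroup (Space 𝕜 k → Space 𝕜 k) where
  carrier := {X | ContDiff 𝕜 ∞ X}
  add_mem' {a b} ha hb := show ContDiff 𝕜 ∞ (a + b) from ContDiff.add ha hb
  zero_mem' := show ContDiff 𝕜 ∞ (0 : Space 𝕜 k → Space 𝕜 k) from contDiff_const
  neg_mem' {a} ha := show ContDiff 𝕜 ∞ (-a) from ContDiff.neg ha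

lemma differentiableAt_of_smooth {F : Type*} [NormedAddCommGroup F] [NormedSpace 𝕜 F]
    {a : Space 𝕜 k → F} (ha : ContDiff 𝕜 ∞ a) (q : Space 𝕜 k) : DifferentiableAt 𝕜 a q :=
  (ha.differentiable (by simp)) q

/-- Smooth vector fields on the ambient space of a chart. -/
def calculus : VFCalculus (Space 𝕜 k → 𝕜) (Space 𝕜 k → Space 𝕜 k) where
  act X a := fun q => fderiv 𝕜 a q (X q)
  br := VectorField.lieBracket 𝕜
  smoothFun := smoothFunctions 𝕜 k
  smoothField := smoothFields 𝕜 k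
  smul_mem := fun {a X} (ha : ContDiff 𝕜 ∞ a) (hX : ContDiff 𝕜 ∞ X) =>
    show ContDiff 𝕜 ∞ (a • X) from ha.smul hX
  act_add_left X Y a := funext fun q => map_add (fderiv 𝕜 a q) _ _
  act_smul_left b X a := funext fun q => map_smul (fderiv 𝕜 a q) _ _
  act_add := fun X {a b} ha hb => funext fun q => by
    have ha' : DifferentiableAt 𝕜 a q := differentiableAt_of_smooth 𝕜 k ha q
    have hb' : DifferentiableAt 𝕜 b q := differentiableAt_of_smooth 𝕜 k hb q
    rw [fderiv_add ha' hb']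
    rfl
  act_mul := fun X {a b} ha hb => funext fun q => by
    have ha' : DifferentiableAt 𝕜 a q := differentiableAt_of_smooth 𝕜 k ha q
    have hb' : DifferentiableAt 𝕜 b q := differentiableAt_of_smooth 𝕜 k hb q
    rw [fderiv_mul ha' hb']
    rfl
  br_swap X Y := funext fun q => VectorField.lieBracket_swap
  br_add := fun X {Y Z} hY hZ => funext fun q => by
    have hY' : DifferentiableAt 𝕜 Y q := differentiableAt_of_smooth 𝕜 k hY q
    have hZ' : DifferentiableAt 𝕜 Z q := differentiableAt_of_smooth 𝕜 k hZ q
    exact VectorField.lieBracket_add_right hY' hZ'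
  br_smul := fun X {a Y} ha hY => funext fun q => by
    have ha' : DifferentiableAt 𝕜 a q := differentiableAt_of_smooth 𝕜 k ha q
    have hY' : DifferentiableAt 𝕜 Y q := differentiableAt_of_smooth 𝕜 k hY q
    exact VectorField.lieBracket_smul_right ha' hY'

lemma act_coord (X : Space 𝕜 k → Space 𝕜 k) (i : ℕ) :
    (calculus 𝕜 k).act X (coord 𝕜 k i) = fun q => coord 𝕜 k i (X q) := by
  funext q
  change fderiv 𝕜 (coord 𝕜 k i) q (X q) = _
  rw [← coordL_eq, ContinuousLinearMap.fderiv]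

lemma isFrame : (calculus 𝕜 k).IsFrame (k + 1) (coord 𝕜 k) (partialField 𝕜 k) where
  x_mem i := contDiff_coord 𝕜 k i
  d_mem i := show ContDiff 𝕜 ∞ (partialField 𝕜 k i) from contDiff_const
  x_eq_zero i hi := funext fun q => dif_neg (by omega)
  act_d i j hi hj := by
    rw [act_coord]
    funext q
    unfold coord partialField
    rw [dif_pos (by omega), dif_pos (by omega), Pi.single_apply]
    by_cases h : i = j
    · simp [h]
    · simp [h, Ne.symm h]
  br_d i j hi hj := by
    funext q
    change VectorField.lieBracket 𝕜 _ _ q = 0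
    have h : ∀ i, fderiv 𝕜 (partialField 𝕜 k i) q = 0 := fun i => by
      unfold partialField
      exact fderiv_const_apply _
    simp [VectorField.lieBracket, h]

variable {k}

/-- The one-form `d d_j - n_j d r_j` at a point. -/
def focalFormAt (IP : Finset ℕ) (q : Space 𝕜 k) (j : ℕ) : Space 𝕜 k →ₗ[𝕜] 𝕜 :=
  (coordL 𝕜 k (deaIdx IP j)).toLinearMap -
    coord 𝕜 k (j + 1) q • (coordL 𝕜 k (retIdx IP j)).toLinearMap

lemma focalFormAt_apply (IP : Finset ℕ) (q ξ : Space 𝕜 k) (j : ℕ) :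
    focalFormAt 𝕜 IP q j ξ =
      coord 𝕜 k (deaIdx IP j) ξ - coord 𝕜 k (j + 1) q * coord 𝕜 k (retIdx IP j) ξ := by
  simp [focalFormAt, coordL_eq]

lemma focalForm_apply (IP : Finset ℕ) (X : Space 𝕜 k → Space 𝕜 k) (j : ℕ) (q : Space 𝕜 k) :
    (calculus 𝕜 k).focalForm IP (coord 𝕜 k) j X q = focalFormAt 𝕜 IP q j (X q) := by
  rw [focalFormAt_apply]
  simp only [VFCalculus.focalForm, LinearMap.sub_apply, LinearMap.smul_apply,
    VFCalculus.diff_apply, act_coord]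
  rfl

lemma focalSection_of_focalForm {IP : Finset ℕ} {X : Space 𝕜 k → Space 𝕜 k}
    (hX : ContDiff 𝕜 ∞ X)
    (h : ∀ j, 1 ≤ j → j ≤ k → (calculus 𝕜 k).focalForm IP (coord 𝕜 k) j X = 0)
    {W : Set (Space 𝕜 k)} (hW : IsOpen W) : FocalSection 𝕜 k IP W X := by
  refine ⟨hW, hX.contDiffOn, fun q _ j hj => ?_⟩
  rw [Finset.mem_Icc] at hj
  have := congrFun (h j hj.1 hj.2) q
  rw [focalForm_apply, focalFormAt_apply] at this
  exact sub_eq_zero.1 this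

lemma focalSection_g {IP : Finset ℕ} (b : Fin 2) {W : Set (Space 𝕜 k)} (hW : IsOpen W) :
    FocalSection 𝕜 k IP W (gField 𝕜 k IP b) := by
  refine focalSection_of_focalForm 𝕜 ((isFrame 𝕜 k).stdG_mem IP k b) (fun j h1 h2 => ?_) hW
  exact (isFrame 𝕜 k).focalForm_g_of_lt IP h1 h2 (by omega) le_rfl

/-! ### Sections of the sheaves -/

lemma smallGrowth_succ {IP : Finset ℕ} {h : ℕ} {W : Set (Space 𝕜 k)} (hW : IsOpen W)
    {X : Space 𝕜 k → Space 𝕜 k} (hX : SmallGrowth 𝕜 k IP (h + 1) W X) :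
    SmallGrowth 𝕜 k IP (h + 2) W X :=
  Generated.basic hW (Or.inl hX)

lemma smallGrowth_mono {IP : Finset ℕ} {h h' : ℕ} (hh : h ≤ h') {W : Set (Space 𝕜 k)}
    (hW : IsOpen W) {X : Space 𝕜 k → Space 𝕜 k} (hX : SmallGrowth 𝕜 k IP (h + 1) W X) :
    SmallGrowth 𝕜 k IP (h' + 1) W X := by
  induction h', hh using Nat.le_induction with
  | base => exact hX
  | succ h' _ ih => exact smallGrowth_succ 𝕜 hW ih

lemma smallGrowth_bracket {IP : Finset ℕ} {h : ℕ} {W : Set (Space 𝕜 k)} (hW : IsOpen W)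
    {X Y : Space 𝕜 k → Space 𝕜 k} (hX : FocalSection 𝕜 k IP W X)
    (hY : SmallGrowth 𝕜 k IP (h + 1) W Y) :
    SmallGrowth 𝕜 k IP (h + 2) W (VectorField.lieBracket 𝕜 X Y) :=
  Generated.basic hW (Or.inr ⟨X, Y, hX, hY, rfl⟩)

lemma lieBracket_g_zero_g_one {IP : Finset ℕ} (hIP : IP ⊆ Finset.Icc 1 k) (hk : 2 ≤ k) :
    VectorField.lieBracket 𝕜 (gField 𝕜 k IP 0) (gField 𝕜 k IP 1) = gField 𝕜 k IP 2 :=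
  (isFrame 𝕜 k).br_g_zero_g_one IP le_rfl hIP (by omega)

lemma lieBracket_g_zero_g_two {IP : Finset ℕ} (hk : 2 ≤ k) :
    VectorField.lieBracket 𝕜 (gField 𝕜 k IP 0) (gField 𝕜 k IP 2) = gField 𝕜 k IP 3 := by
  have := (isFrame 𝕜 k).br_g_zero_g IP le_rfl le_rfl hk
  rw [tailProd_of_le _ _ (by omega), one_smul] at this
  exact this

/-- The base case is `g_3 = [g_0, [g_0, g_1]]`, a section of the third sheaf; each letter then costs
one step. -/
lemma smallGrowth_iterBracket {IP : Finset ℕ} (hIP : IP ⊆ Finset.Icc 1 k) (hk : 2 ≤ k)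
    {W : Set (Space 𝕜 k)} (hW : IsOpen W) (l : List (Fin 2)) :
    SmallGrowth 𝕜 k IP (l.length + 3) W
      (iterBracket (VectorField.lieBracket 𝕜) (gField 𝕜 k IP) l) := by
  induction l with
  | nil =>
    rw [iterBracket, ← lieBracket_g_zero_g_two 𝕜 hk]
    refine smallGrowth_bracket 𝕜 hW (focalSection_g 𝕜 0 hW) ?_
    rw [← lieBracket_g_zero_g_one 𝕜 hIP hk]
    exact smallGrowth_bracket 𝕜 hW (focalSection_g 𝕜 0 hW) (focalSection_g 𝕜 1 hW)
  | cons b l ih => exact smallGrowth_bracket 𝕜 hW (focalSection_g 𝕜 b hW) ih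

lemma lieSquare_three_g_three {IP : Finset ℕ} (hIP : IP ⊆ Finset.Icc 1 k) (hk : 2 ≤ k)
    {W : Set (Space 𝕜 k)} (hW : IsOpen W) : LieSquare 𝕜 k IP 3 W (gField 𝕜 k IP 3) := by
  have h2 : LieSquare 𝕜 k IP 2 W (gField 𝕜 k IP 2) :=
    Generated.basic hW (Or.inr ⟨_, _, focalSection_g 𝕜 0 hW, focalSection_g 𝕜 1 hW,
      (lieBracket_g_zero_g_one 𝕜 hIP hk).symm⟩)
  have h1 : LieSquare 𝕜 k IP 2 W (gField 𝕜 k IP 0) :=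
    Generated.basic hW (Or.inl (focalSection_g 𝕜 0 hW))
  exact Generated.basic hW (Or.inr ⟨_, _, h1, h2, (lieBracket_g_zero_g_two 𝕜 hk).symm⟩)

lemma isOpen_chart {U : Set (𝕜 × 𝕜)} (hU : IsOpen U) : IsOpen (chart 𝕜 k U) :=
  hU.preimage ((contDiff_coord 𝕜 k 0).continuous.prodMk (contDiff_coord 𝕜 k 1).continuous)

/-- The coefficient of `g_j` in an iterated bracket, as a function. -/
def wordCoeff (k : ℕ) (IP : Finset ℕ) (l : List (Fin 2)) (j : ℕ) : Space 𝕜 k → 𝕜 :=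
  evalN (fun j => coord 𝕜 k (j + 1)) (coeffPoly IP k l j)

lemma wordCoeff_of_lt (IP : Finset ℕ) (l : List (Fin 2)) {j : ℕ} (hj : j < 3) :
    wordCoeff 𝕜 k IP l j = 0 := by
  rw [wordCoeff, coeffPoly_of_lt _ _ _ hj, map_zero]

lemma iterBracket_apply {IP : Finset ℕ} (hk : 2 ≤ k) (l : List (Fin 2)) {h : ℕ}
    (hl : l.length + 3 ≤ h) (q : Space 𝕜 k) :
    iterBracket (VectorField.lieBracket 𝕜) (gField 𝕜 k IP) l q =
      ∑ j ∈ Finset.range (min h (k + 1) + 1), wordCoeff 𝕜 k IP l j q • gField 𝕜 k IP j q := by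
  have := (isFrame 𝕜 k).iterBracket_eq IP hk l
  change iterBracket (VectorField.lieBracket 𝕜) (gField 𝕜 k IP) l = _ at this
  rw [this, Finset.sum_apply]
  refine sum_range_sub_one_add_three hk hl
    (fun j => wordCoeff 𝕜 k IP l j q • gField 𝕜 k IP j q) (fun j hj => ?_) fun j hj => ?_
  · simp only [wordCoeff_of_lt 𝕜 IP l hj, Pi.zero_apply, zero_smul]
  · rw [wordCoeff, coeffPoly_of_gt _ _ _ hj, map_zero, Pi.zero_apply, zero_smul]

lemma contDiff_wordCoeff (IP : Finset ℕ) (l : List (Fin 2)) (j : ℕ) :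
    ContDiff 𝕜 ∞ (wordCoeff 𝕜 k IP l j) :=
  (isFrame 𝕜 k).evalN_mem _

lemma exists_structureForm {IP : Finset ℕ} (hIP : IP ⊆ Finset.Icc 1 k) (hk : 2 ≤ k)
    {W : Set (Space 𝕜 k)} (hW : IsOpen W) (l : List (Fin 2)) {h : ℕ} (hl : l.length + 3 ≤ h) :
    ∃ w c, StructureForm 𝕜 k IP W h
      (iterBracket (VectorField.lieBracket 𝕜) (gField 𝕜 k IP) l) w c := by
  refine ⟨fun q => wordCoeff 𝕜 k IP l 3 q • gField 𝕜 k IP 3 q, wordCoeff 𝕜 k IP l,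
    Generated.smul _ (contDiff_wordCoeff 𝕜 IP l 3).contDiffOn
      (lieSquare_three_g_three 𝕜 hIP hk hW),
    fun j => (contDiff_wordCoeff 𝕜 IP l j).contDiffOn, ?_, ?_⟩
  · intro q _
    refine (sum_range_four (fun j => wordCoeff 𝕜 k IP l j q • gField 𝕜 k IP j q) ?_).symm
    intro j hj
    simp only [wordCoeff_of_lt 𝕜 IP l hj, Pi.zero_apply, zero_smul]
  · intro q _
    rw [iterBracket_apply 𝕜 hk l hl]
    refine sum_range_eq_add_sum_Icc (by omega)
      (fun j => wordCoeff 𝕜 k IP l j q • gField 𝕜 k IP j q) fun j hj => ?_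
    simp only [wordCoeff_of_lt 𝕜 IP l hj, Pi.zero_apply, zero_smul]

/-- Triangularity is applied at each point separately, so no regularity of the coefficients is
needed. -/
lemma StructureForm.coeff_eq {IP : Finset ℕ} (hk : 2 ≤ k) {W : Set (Space 𝕜 k)}
    {l : List (Fin 2)} {h : ℕ} (hl : l.length + 3 ≤ h) {w c}
    (hc : StructureForm 𝕜 k IP W h
      (iterBracket (VectorField.lieBracket 𝕜) (gField 𝕜 k IP) l) w c) {i : ℕ} (hi : 3 ≤ i)
    (hih : i ≤ min h (k + 1)) {q : Space 𝕜 k} (hq : q ∈ W) :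
    c i q = wordCoeff 𝕜 k IP l i q := by
  obtain ⟨-, -, hw, hX⟩ := hc
  refine coeff_eq_of_triangular (k := k) (fun i => gField 𝕜 k IP i q) (focalFormAt 𝕜 IP q)
    (fun j i h1 h2 h3 => ?_) (fun j h1 h2 => ?_) (fun i => c i q)
    (fun i => wordCoeff 𝕜 k IP l i q) (N := min h (k + 1)) (by omega) (by omega) ?_ (by omega) hih
  · rw [← focalForm_apply]
    exact congrFun ((isFrame 𝕜 k).focalForm_g_of_lt IP h1 h2 h3 le_rfl) q
  · rw [← focalForm_apply]
    exact ((isFrame 𝕜 k).isUnit_focalForm_g IP h1 h2 le_rfl).map (Pi.evalRingHom _ q)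
  · rw [← iterBracket_apply 𝕜 hk l hl, hX q hq, hw q hq]

/-! ### Focal orders -/

variable {𝕜}

lemma taylor_evalN {γ : 𝕜 → Space 𝕜 k} (hγ : ContDiffAt 𝕜 ∞ γ 0) (a : MvPolynomial ℕ ℕ) :
    taylor (evalN (fun j => coord 𝕜 k (j + 1)) a ∘ γ) =
      evalN (fun j => taylor (coord 𝕜 k (j + 1) ∘ γ)) a := by
  have hs : ∀ a, ContDiffAt 𝕜 ∞ (evalN (fun j => coord 𝕜 k (j + 1)) a ∘ γ) 0 := fun a =>
    (show ContDiff 𝕜 ∞ _ from (isFrame 𝕜 k).evalN_mem a).contDiffAt.comp 0 hγ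
  induction a using MvPolynomial.induction_on with
  | C n =>
    have : evalN (fun j => coord 𝕜 k (j + 1)) (MvPolynomial.C n) ∘ γ = fun _ => (n : 𝕜) := by
      funext t
      simp [evalN]
    rw [this, taylor_const]
    simp [evalN]
  | add p q hp hq =>
    rw [map_add, map_add, ← hp, ← hq]
    exact taylor_add (hs p) (hs q)
  | mul_X p i hp =>
    rw [map_mul, map_mul, ← hp, evalN_X, evalN_X]
    exact taylor_mul (hs p) ((contDiff_coord 𝕜 k (i + 1)).contDiffAt.comp 0 hγ)

lemma coord_deriv {γ : 𝕜 → Space 𝕜 k} {t : 𝕜} (hγ : DifferentiableAt 𝕜 γ t) (i : ℕ) :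
    coord 𝕜 k i (deriv γ t) = deriv (coord 𝕜 k i ∘ γ) t := by
  rw [← coordL_eq]
  exact (((coordL 𝕜 k i).hasFDerivAt.comp_hasDerivAt t hγ.hasDerivAt).deriv).symm

lemma FocalCurve.isFocalSeries {IP : Finset ℕ} {p : Space 𝕜 k} {γ : 𝕜 → Space 𝕜 k}
    (hγ : FocalCurve 𝕜 k IP p γ) :
    IsFocalSeries IP k fun j => taylor (coord 𝕜 k (j + 1) ∘ γ) := by
  have h0 := hγ.smooth.self_of_nhds
  have hs : ∀ i, ContDiffAt 𝕜 ∞ (coord 𝕜 k i ∘ γ) 0 := fun i =>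
    (contDiff_coord 𝕜 k i).contDiffAt.comp 0 h0
  refine isFocalSeries_of_focal (y := fun i => taylor (coord 𝕜 k i ∘ γ)) fun j hj => ?_
  rw [derivative_taylor, derivative_taylor, ← taylor_mul (hs _) ((hs _).derivWithin (by simp))]
  refine taylor_congr ?_
  filter_upwards [hγ.smooth, hγ.focal] with t h1 h2
  have hd : DifferentiableAt 𝕜 γ t := h1.differentiableAt (by simp)
  rw [← coord_deriv hd, ← coord_deriv hd]
  exact h2 j hj

/-- The polynomial curve is regular because its coordinate `n_k` has derivative `1`. -/
lemma exists_generic_curve (IP : Finset ℕ) (p : Space 𝕜 k) : ∃ γ, FocalCurve 𝕜 k IP p γ ∧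
    IsGenericSeries IP k fun j => taylor (coord 𝕜 k (j + 1) ∘ γ) := by
  obtain ⟨y, h1, h2, h3, h4⟩ := exists_generic_polynomials IP k fun i => coord 𝕜 k i p
  set γ : 𝕜 → Space 𝕜 k := fun t i => (y i).eval t with hγ
  have hc : ∀ i ≤ k + 1, coord 𝕜 k i ∘ γ = fun t => (y i).eval t := fun i hi => by
    funext t
    simp [coord, hγ, show i < k + 2 by omega]
  have hs : ContDiff 𝕜 ∞ γ := contDiff_pi.2 fun i => by
    simpa using Polynomial.contDiff_aeval (𝕜 := 𝕜) (y i) ∞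
  have hd : ∀ i ≤ k + 1, ∀ t, coord 𝕜 k i (deriv γ t) = (Polynomial.derivative (y i)).eval t :=
    fun i hi t => by
      rw [coord_deriv (hs.differentiable (by simp) t), hc i hi, Polynomial.deriv]
  refine ⟨γ, ⟨Filter.Eventually.of_forall fun t => hs.contDiffAt, ?_, ?_, ?_⟩, ?_, ?_⟩
  · funext i
    have := h1 i (by omega)
    simpa [hγ, coord] using this
  · intro h
    have := hd (k + 1) le_rfl 0
    rw [h, h2] at this
    simp [coord] at this
  · refine Filter.Eventually.of_forall fun t j hj => ?_
    have := focal_of_deriv (δ := fun i => Polynomial.derivative (y i)) h3 h4 hj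
    rw [Finset.mem_Icc] at hj
    have e1 := deaIdx_le IP j
    have e2 := retIdx_le IP j
    rw [hd _ (by omega), hd _ (by omega), this, Polynomial.eval_mul]
    congr 1
    exact (congrFun (hc (j + 1) (by omega)) t).symm
  · rw [hc (k + 1) le_rfl, taylor_polynomial, PowerSeries.derivative_coe, h2, Polynomial.coe_one]
  · intro j hj
    rw [hc (j + 1) (by omega), taylor_polynomial, PowerSeries.derivative_coe, h4 j hj]
    refine (map_derivCoeff IP (fun j => y (j + 1)) (Polynomial.coeToPowerSeries.ringHom (R := 𝕜))
      k j).trans (derivCoeff_congr _ _ hj fun l _ hl => ?_)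
    rw [hc (l + 1) (by omega), taylor_polynomial]
    rfl

lemma focalOrder_eq {IP : Finset ℕ} {p : Space 𝕜 k} {a : Space 𝕜 k → 𝕜} {γ : 𝕜 → Space 𝕜 k}
    (hγ : FocalCurve 𝕜 k IP p γ)
    (h : ∀ γ', FocalCurve 𝕜 k IP p γ' → (taylor (a ∘ γ)).order ≤ (taylor (a ∘ γ')).order) :
    focalOrder 𝕜 k IP p a = (taylor (a ∘ γ)).order := by
  refine le_antisymm ?_ (le_iInf₂ fun γ' hγ' => ?_)
  · rw [order_taylor]
    exact iInf₂_le γ hγ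
  · rw [← order_taylor]
    exact h γ' hγ'

lemma verticalOrder_eq {IP : Finset ℕ} {p : Space 𝕜 k} {γ : 𝕜 → Space 𝕜 k}
    (hγ : FocalCurve 𝕜 k IP p γ)
    (hx : IsGenericSeries IP k fun j => taylor (coord 𝕜 k (j + 1) ∘ γ)) {j : ℕ} (hj : j ≤ k) :
    verticalOrder 𝕜 k IP p j =
      if j ∈ IP then (taylor (coord 𝕜 k (j + 1) ∘ γ)).order else 0 := by
  unfold verticalOrder divisorEq
  split_ifs with h
  · refine focalOrder_eq hγ fun γ' hγ' => hx.order_le hγ'.isFocalSeries (fun j _ => ?_) hj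
    rw [constantCoeff_taylor, constantCoeff_taylor]
    simp [hγ.start, hγ'.start]
  · have e : ∀ γ' : 𝕜 → Space 𝕜 k,
        (taylor ((1 : Space 𝕜 k → 𝕜) ∘ γ')).order = 0 := fun γ' => by
      have : (1 : Space 𝕜 k → 𝕜) ∘ γ' = fun _ => 1 := rfl
      rw [this, taylor_const, map_one, PowerSeries.order_one]
    rw [focalOrder_eq hγ fun γ' _ => by rw [e, e], e]

variable (𝕜) in
theorem exists_bracket (IP : Finset ℕ) (hIP : IP ⊆ Finset.Icc 1 k)
    (U : Set (𝕜 × 𝕜)) (hU : IsOpen U) (p : Space 𝕜 k) (hp : p ∈ chart 𝕜 k U)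
    (h i : ℕ) (hi : 3 ≤ i) (hih : i ≤ min h (k + 1)) :
    ∃ f : Space 𝕜 k → Space 𝕜 k,
      (∃ ε : List (Fin 2), ε.length ≤ h - 3 ∧
        f = iterBracket (VectorField.lieBracket 𝕜) (gField 𝕜 k IP) ε) ∧
      SmallGrowth 𝕜 k IP h (chart 𝕜 k U) f ∧
      (∃ w c, StructureForm 𝕜 k IP (chart 𝕜 k U) h f w c) ∧
      ∀ w c, StructureForm 𝕜 k IP (chart 𝕜 k U) h f w c →
        focalOrder 𝕜 k IP p (c i) = eInv k (verticalOrder 𝕜 k IP p) h i := by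
  have hk : 2 ≤ k := by omega
  have hW := isOpen_chart 𝕜 (k := k) hU
  obtain ⟨γ, hγ, hx⟩ := exists_generic_curve IP p
  obtain ⟨l, hl, h1, h2⟩ := hx.exists_word hi (hih.trans (min_le_left _ _))
    (hih.trans (min_le_right _ _)) (VO := verticalOrder 𝕜 k IP p)
    fun j _ hj => verticalOrder_eq hγ hx hj
  have hl' : l.length + 3 ≤ h := by omega
  refine ⟨_, ⟨l, hl, rfl⟩, ?_, exists_structureForm 𝕜 hIP hk hW l hl', fun w c hc => ?_⟩
  · obtain ⟨h, rfl⟩ : ∃ h', h = h' + 1 := ⟨h - 1, by omega⟩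
    exact smallGrowth_mono 𝕜 (h := l.length + 2) (by omega) hW
      (smallGrowth_iterBracket 𝕜 hIP hk hW l)
  · have e : ∀ γ', FocalCurve 𝕜 k IP p γ' → taylor (c i ∘ γ') =
        evalN (fun j => taylor (coord 𝕜 k (j + 1) ∘ γ')) (coeffPoly IP k l i) := fun γ' hγ' => by
      have h0 := hγ'.smooth.self_of_nhds
      rw [← taylor_evalN h0]
      refine taylor_congr ?_
      -- The coefficient is known only on the chart, which contains the curve near `0`; this
      -- determines its Taylor series.
      have hmem : chart 𝕜 k U ∈ nhds (γ' 0) := by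
        rw [hγ'.start]
        exact hW.mem_nhds hp
      filter_upwards [h0.continuousAt.preimage_mem_nhds hmem] with t ht
      exact hc.coeff_eq 𝕜 hk hl' hi hih ht
    rw [← h1, ← e γ hγ]
    refine focalOrder_eq hγ fun γ' hγ' => ?_
    rw [e γ hγ, e γ' hγ', h1]
    refine h2 _ hγ'.isFocalSeries fun j _ => ?_
    rw [constantCoeff_taylor, constantCoeff_taylor]
    simp [hγ.start, hγ'.start]

end Mfd

open PowerSeries (derivative constantCoeff)

namespace VFCalculus.IsFrame

/-- Each inverted level multiplies the coefficient of `∂/∂r₀` by its coordinate. This makes `r₀`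
polynomial along the flow. -/
lemma act_stdF_zero {O M : Type*} [CommRing O] [AddCommGroup M] [Module O M]
    {V : VFCalculus O M} {K m : ℕ} {x : ℕ → O} {d : ℕ → M} (hf : V.IsFrame K x d)
    (IP : Finset ℕ) (hm : m ≤ K) :
    V.act (stdF IP x d m) (x 0) = tailProd IP m (fun l => x (l + 1)) 0 := by
  induction m with
  | zero => rw [stdF, hf.act_d 0 0 (by omega) (by omega), if_pos rfl, tailProd_of_le _ _ le_rfl]
  | succ m ih =>
    have ih := ih (by omega)
    have h2 := hf.act_d (m + 1) 0 hm (by omega)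
    rw [if_neg (by omega)] at h2
    rw [stdF_succ, tailProd_succ_top _ _ (by omega)]
    split_ifs <;> simp [V.act_add_left, V.act_smul_left, ih, h2]

end VFCalculus.IsFrame

namespace Alg

variable {F : Type*} [Field F] {A : Type*} [CommRing A] [Algebra F A] {k : ℕ}

/-! ### The calculus of derivations -/

lemma coeff_mapCoeffs {σ : Type*} (D : Derivation F A A) (p : MvPolynomial σ A) (m : σ →₀ ℕ) :
    MvPolynomial.coeff m (mapCoeffs D p) = D (MvPolynomial.coeff m p) := by
  classical
  change MvPolynomial.coeff m (∑ u ∈ p.support, MvPolynomial.monomial u (D (p.coeff u))) = _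
  rw [MvPolynomial.coeff_sum]
  simp only [MvPolynomial.coeff_monomial, Finset.sum_ite_eq']
  split_ifs with h
  · rfl
  · rw [MvPolynomial.notMem_support_iff.1 h, map_zero]

lemma mapCoeffs_C {σ : Type*} (D : Derivation F A A) (a : A) :
    mapCoeffs D (MvPolynomial.C a : MvPolynomial σ A) = MvPolynomial.C (D a) := by
  classical
  ext m
  rw [coeff_mapCoeffs, MvPolynomial.coeff_C, MvPolynomial.coeff_C]
  split_ifs <;> simp

lemma mapCoeffs_X {σ : Type*} (D : Derivation F A A) (i : σ) :
    mapCoeffs D (MvPolynomial.X i : MvPolynomial σ A) = 0 := by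
  classical
  ext m
  rw [coeff_mapCoeffs, MvPolynomial.coeff_X, MvPolynomial.coeff_zero]
  split_ifs <;> simp

variable (F k) in
/-- The derivations of the ring of functions of a chart. -/
def calculus (A : Type*) [CommRing A] [Algebra F A] :
    VFCalculus (Func A k) (Derivation F (Func A k) (Func A k)) where
  act X a := X a
  br X Y := ⁅X, Y⁆
  smoothFun := ⊤
  smoothField := ⊤
  smul_mem _ _ := AddSubgroup.mem_top _
  act_add_left X Y a := rfl
  act_smul_left b X a := rfl
  act_add X _ _ _ _ := map_add X _ _
  act_mul X _ _ _ _ := by rw [X.leibniz, smul_eq_mul, smul_eq_mul]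
  br_swap X Y := (lie_skew X Y).symm
  br_add X _ _ _ _ := lie_add X _ _
  br_smul X a Y _ _ := by
    ext1 c
    simp only [Derivation.commutator_apply, Derivation.add_apply, Derivation.smul_apply,
      smul_eq_mul, Derivation.leibniz]
    ring

section

variable {r₀ n₀ : A} {b : Module.Basis (Fin 2) A (Ω[A⁄F])}
  (hb0 : b 0 = KaehlerDifferential.D F A r₀) (hb1 : b 1 = KaehlerDifferential.D F A n₀)
include hb0 hb1

/-- A derivation is determined by its values on coordinates. -/
lemma derivation_eq_zero {N : Type*} [AddCommGroup N] [Module F N] [Module A N]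
    [IsScalarTower F A N] (D : Derivation F A N) (h0 : D r₀ = 0) (h1 : D n₀ = 0) : D = 0 := by
  have : D.liftKaehlerDifferential = 0 := by
    refine b.ext fun i => ?_
    fin_cases i
    · simp [hb0, h0]
    · simp [hb1, h1]
  rw [← D.liftKaehlerDifferential_comp, this]
  ext a
  rfl

lemma derivation_eq_zero_of_coord {D : Derivation F (Func A k) (Func A k)}
    (h : ∀ i ≤ k + 1, D (coord k r₀ n₀ i) = 0) : D = 0 := by
  have hA : D.compAlgebraMap A = 0 := derivation_eq_zero hb0 hb1 _ (h 0 (by omega)) (h 1 (by omega))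
  ext1 q
  induction q using MvPolynomial.induction_on with
  | C a => exact DFunLike.congr_fun hA a
  | add p q hp hq => rw [map_add, hp, hq, map_add]
  | mul_X p i hp =>
    have hi : D (MvPolynomial.X i) = 0 := by
      have := h (i + 2) (by omega)
      rwa [coord, dif_pos i.2] at this
    rw [D.leibniz, hp, hi]
    simp

lemma partialField_coord {i j : ℕ} (hi : i ≤ k + 1) (hj : j ≤ k + 1) :
    partialField F k b i (coord k r₀ n₀ j) = if i = j then 1 else 0 := by
  have e : ∀ i j, b.coord i (b j) = if i = j then 1 else 0 := fun i j => by
    rw [Module.Basis.coord_apply, Module.Basis.repr_self, Finsupp.single_apply]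
    simp [eq_comm]
  match i, j with
  | 0, 0 => simp [partialField, coord, mapCoeffs_C, ← hb0]
  | 0, 1 => simp [partialField, coord, mapCoeffs_C, ← hb1]
  | 1, 0 => simp [partialField, coord, mapCoeffs_C, ← hb0]
  | 1, 1 => simp [partialField, coord, mapCoeffs_C, ← hb1]
  | 0, j + 2 => rw [coord, dif_pos (by omega), partialField, mapCoeffs_X, if_neg (by omega)]
  | 1, j + 2 => rw [coord, dif_pos (by omega), partialField, mapCoeffs_X, if_neg (by omega)]
  | i + 2, 0 =>
    rw [partialField, dif_pos (by omega), coord, if_neg (by omega)]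
    exact MvPolynomial.pderiv_C
  | i + 2, 1 =>
    rw [partialField, dif_pos (by omega), coord, if_neg (by omega)]
    exact MvPolynomial.pderiv_C
  | i + 2, j + 2 =>
    classical
    rw [partialField, dif_pos (by omega), coord, dif_pos (by omega)]
    refine (MvPolynomial.pderiv_X _ _).trans ?_
    rw [Pi.single_apply]
    simp [eq_comm]

lemma isFrame : (calculus F k A).IsFrame (k + 1) (coord k r₀ n₀) (partialField F k b) where
  x_mem i := Subring.mem_top _
  d_mem i := AddSubgroup.mem_top _
  x_eq_zero i hi := by
    obtain ⟨i, rfl⟩ : ∃ i', i = i' + 2 := ⟨i - 2, by omega⟩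
    exact dif_neg (by omega)
  act_d i j hi hj := partialField_coord hb0 hb1 hi hj
  br_d i j hi hj := by
    -- Coordinate fields take constant values on coordinates, so their commutator kills all
    -- coordinates.
    refine derivation_eq_zero_of_coord hb0 hb1 fun l hl => ?_
    change ⁅partialField F k b i, partialField F k b j⁆ _ = 0
    rw [Derivation.commutator_apply, partialField_coord hb0 hb1 hi hl,
      partialField_coord hb0 hb1 hj hl]
    split_ifs <;> simp

/-! ### Sections of the sheaves -/

lemma g_mem_focal (IP : Finset ℕ) (c : Fin 2) : gField F k IP r₀ n₀ b c ∈ focal F k IP r₀ n₀ := by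
  intro j hj
  rw [Finset.mem_Icc] at hj
  exact sub_eq_zero.1 ((isFrame hb0 hb1).focalForm_g_of_lt IP hj.1 hj.2 (by omega) le_rfl)

lemma lie_g_zero_g_one {IP : Finset ℕ} (hIP : IP ⊆ Finset.Icc 1 k) (hk : 2 ≤ k) :
    ⁅gField F k IP r₀ n₀ b 0, gField F k IP r₀ n₀ b 1⁆ = gField F k IP r₀ n₀ b 2 :=
  (isFrame hb0 hb1).br_g_zero_g_one IP le_rfl hIP (by omega)

lemma lie_g_zero_g_two (IP : Finset ℕ) (hk : 2 ≤ k) :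
    ⁅gField F k IP r₀ n₀ b 0, gField F k IP r₀ n₀ b 2⁆ = gField F k IP r₀ n₀ b 3 := by
  have := (isFrame (k := k) hb0 hb1).br_g_zero_g IP le_rfl le_rfl hk
  rw [tailProd_of_le _ _ (by omega), one_smul] at this
  exact this

omit hb0 hb1 in
lemma lie_mem_smallGrowth {IP : Finset ℕ} {h : ℕ} {X Y : Derivation F (Func A k) (Func A k)}
    (hX : X ∈ focal F k IP r₀ n₀) (hY : Y ∈ smallGrowth F k IP r₀ n₀ (h + 1)) :
    ⁅X, Y⁆ ∈ smallGrowth F k IP r₀ n₀ (h + 2) :=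
  Submodule.mem_sup_right (Submodule.subset_span ⟨X, hX, Y, hY, rfl⟩)

omit hb0 hb1 in
lemma smallGrowth_mono {IP : Finset ℕ} {h h' : ℕ} (hh : h ≤ h') :
    smallGrowth F k IP r₀ n₀ (h + 1) ≤ smallGrowth F k IP r₀ n₀ (h' + 1) := by
  induction h', hh using Nat.le_induction with
  | base => exact le_rfl
  | succ h' _ ih => exact ih.trans le_sup_left

lemma iterBracket_mem_smallGrowth {IP : Finset ℕ} (hIP : IP ⊆ Finset.Icc 1 k) (hk : 2 ≤ k)
    (l : List (Fin 2)) :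
    iterBracket (fun X Y => ⁅X, Y⁆) (gField F k IP r₀ n₀ b) l ∈
      smallGrowth F k IP r₀ n₀ (l.length + 3) := by
  induction l with
  | nil =>
    rw [iterBracket, ← lie_g_zero_g_two hb0 hb1 IP hk]
    refine lie_mem_smallGrowth (g_mem_focal hb0 hb1 IP 0) ?_
    rw [← lie_g_zero_g_one hb0 hb1 hIP hk]
    exact lie_mem_smallGrowth (g_mem_focal hb0 hb1 IP 0) (g_mem_focal hb0 hb1 IP 1)
  | cons c l ih => exact lie_mem_smallGrowth (g_mem_focal hb0 hb1 IP c) ih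

lemma g_three_mem_lieSquare {IP : Finset ℕ} (hIP : IP ⊆ Finset.Icc 1 k) (hk : 2 ≤ k) :
    gField F k IP r₀ n₀ b 3 ∈ lieSquare F k IP r₀ n₀ 3 := by
  have h2 : gField F k IP r₀ n₀ b 2 ∈ lieSquare F k IP r₀ n₀ 2 :=
    Submodule.mem_sup_right (Submodule.subset_span ⟨_, g_mem_focal hb0 hb1 IP 0, _,
      g_mem_focal hb0 hb1 IP 1, (lie_g_zero_g_one hb0 hb1 hIP hk).symm⟩)
  have h1 : gField F k IP r₀ n₀ b 0 ∈ lieSquare F k IP r₀ n₀ 2 :=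
    Submodule.mem_sup_left (g_mem_focal hb0 hb1 IP 0)
  exact Submodule.mem_sup_right (Submodule.subset_span ⟨_, h1, _, h2,
    (lie_g_zero_g_two hb0 hb1 IP hk).symm⟩)

omit hb0 hb1 in
/-- The coefficient of `g_j` in an iterated bracket, as a function. -/
def wordCoeff (k : ℕ) (IP : Finset ℕ) (r₀ n₀ : A) (l : List (Fin 2)) (j : ℕ) : Func A k :=
  evalN (fun j => coord k r₀ n₀ (j + 1)) (coeffPoly IP k l j)

omit hb0 hb1 [Algebra F A] [Field F] in
lemma wordCoeff_of_lt (IP : Finset ℕ) (l : List (Fin 2)) {j : ℕ} (hj : j < 3) :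
    wordCoeff k IP r₀ n₀ l j = 0 := by
  rw [wordCoeff, coeffPoly_of_lt _ _ _ hj, map_zero]

lemma iterBracket_eq_sum {IP : Finset ℕ} (hk : 2 ≤ k) (l : List (Fin 2)) {h : ℕ}
    (hl : l.length + 3 ≤ h) :
    iterBracket (fun X Y => ⁅X, Y⁆) (gField F k IP r₀ n₀ b) l =
      ∑ j ∈ Finset.range (min h (k + 1) + 1),
        wordCoeff k IP r₀ n₀ l j • gField F k IP r₀ n₀ b j := by
  refine ((isFrame hb0 hb1).iterBracket_eq IP hk l).trans ?_
  refine sum_range_sub_one_add_three hk hl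
    (fun j => wordCoeff k IP r₀ n₀ l j • gField F k IP r₀ n₀ b j) (fun j hj => ?_) fun j hj => ?_
  · simp only [wordCoeff_of_lt IP l hj, zero_smul]
  · rw [wordCoeff, coeffPoly_of_gt _ _ _ hj, map_zero, zero_smul]

lemma exists_structureForm {IP : Finset ℕ} (hIP : IP ⊆ Finset.Icc 1 k) (hk : 2 ≤ k)
    (l : List (Fin 2)) {h : ℕ} (hl : l.length + 3 ≤ h) :
    ∃ w c, StructureForm F k IP r₀ n₀ b h
      (iterBracket (fun X Y => ⁅X, Y⁆) (gField F k IP r₀ n₀ b) l) w c := by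
  have h0 : ∀ j < 3, wordCoeff k IP r₀ n₀ l j • gField F k IP r₀ n₀ b j = 0 := fun j hj => by
    rw [wordCoeff_of_lt IP l hj, zero_smul]
  refine ⟨wordCoeff k IP r₀ n₀ l 3 • gField F k IP r₀ n₀ b 3, wordCoeff k IP r₀ n₀ l,
    Submodule.smul_mem _ _ (g_three_mem_lieSquare hb0 hb1 hIP hk), ?_, ?_⟩
  · exact (sum_range_four (fun j => wordCoeff k IP r₀ n₀ l j • gField F k IP r₀ n₀ b j) h0).symm
  · rw [iterBracket_eq_sum hb0 hb1 hk l hl]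
    exact sum_range_eq_add_sum_Icc (by omega)
      (fun j => wordCoeff k IP r₀ n₀ l j • gField F k IP r₀ n₀ b j) h0

lemma StructureForm.coeff_eq {IP : Finset ℕ} (hk : 2 ≤ k) {l : List (Fin 2)} {h : ℕ}
    (hl : l.length + 3 ≤ h) {w c} (hc : StructureForm F k IP r₀ n₀ b h
      (iterBracket (fun X Y => ⁅X, Y⁆) (gField F k IP r₀ n₀ b) l) w c) {i : ℕ} (hi : 3 ≤ i)
    (hih : i ≤ min h (k + 1)) : c i = wordCoeff k IP r₀ n₀ l i := by
  obtain ⟨-, hw, hX⟩ := hc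
  refine coeff_eq_of_triangular (k := k) (gField F k IP r₀ n₀ b)
    ((calculus F k A).focalForm IP (coord k r₀ n₀))
    (fun j i h1 h2 h3 => (isFrame hb0 hb1).focalForm_g_of_lt IP h1 h2 h3 le_rfl)
    (fun j h1 h2 => (isFrame hb0 hb1).isUnit_focalForm_g IP h1 h2 le_rfl) c
    (wordCoeff k IP r₀ n₀ l) (N := min h (k + 1)) (by omega) (by omega) ?_ (by omega) hih
  rw [← iterBracket_eq_sum hb0 hb1 hk l hl, hX, hw]

end

/-! ### Formal integral curves -/

section Flow

variable {B : Type*} [CommRing B] [Algebra F B]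

/-- The exponential series of a derivation at a point, as a linear map. -/
def flowLinear (X : Derivation F B B) (p : B →ₐ[F] F) : B →ₗ[F] PowerSeries F where
  toFun a := PowerSeries.mk fun n => p ((X : B →ₗ[F] B) ^ n • a) / (n.factorial : F)
  map_add' a a' := by
    ext n
    simp [add_div]
  map_smul' c a := by
    ext n
    simp [mul_div_assoc]

lemma derivative_flowLinear [CharZero F] (X : Derivation F B B) (p : B →ₐ[F] F) (a : B) :
    derivative F (flowLinear X p a) = flowLinear X p (X a) := by
  ext n
  have h1 : (n.factorial : F) ≠ 0 := by exact_mod_cast n.factorial_ne_zero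
  have h2 : ((n : F) + 1) ≠ 0 := by exact_mod_cast n.succ_ne_zero
  rw [PowerSeries.coeff_derivative]
  simp only [flowLinear, LinearMap.coe_mk, AddHom.coe_mk, PowerSeries.coeff_mk]
  rw [pow_succ, mul_smul, Nat.factorial_succ]
  push_cast
  field_simp
  rfl

lemma constantCoeff_flowLinear (X : Derivation F B B) (p : B →ₐ[F] F) (a : B) :
    constantCoeff (flowLinear X p a) = p a := by
  rw [← PowerSeries.coeff_zero_eq_constantCoeff_apply]
  simp [flowLinear]

/-- Both sides satisfy the same Leibniz recursion for derivatives and have the same constant term,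
so their coefficients agree inductively in characteristic zero. -/
lemma flowLinear_mul [CharZero F] (X : Derivation F B B) (p : B →ₐ[F] F) (a a' : B) :
    flowLinear X p (a * a') = flowLinear X p a * flowLinear X p a' := by
  ext n
  induction n generalizing a a' with
  | zero =>
    simp only [PowerSeries.coeff_zero_eq_constantCoeff_apply, map_mul, constantCoeff_flowLinear]
  | succ n ih =>
    have h2 : ((n : F) + 1) ≠ 0 := by exact_mod_cast n.succ_ne_zero
    refine mul_right_cancel₀ h2 ?_
    rw [← PowerSeries.coeff_derivative, ← PowerSeries.coeff_derivative, derivative_flowLinear,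
      Derivation.leibniz, Derivation.leibniz, derivative_flowLinear, derivative_flowLinear]
    simp only [smul_eq_mul, map_add, ih]

/-- The formal integral curve of a derivation through a point. -/
def flow [CharZero F] (X : Derivation F B B) (p : B →ₐ[F] F) : B →ₐ[F] PowerSeries F :=
  AlgHom.ofLinearMap (flowLinear X p)
    (by
      refine PowerSeries.derivative.ext ?_ ?_
      · rw [derivative_flowLinear]; simp
      · rw [constantCoeff_flowLinear]; simp)
    (flowLinear_mul X p)

lemma derivative_flow [CharZero F] (X : Derivation F B B) (p : B →ₐ[F] F) (a : B) :
    derivative F (flow X p a) = flow X p (X a) := derivative_flowLinear X p a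

lemma constantCoeff_flow [CharZero F] (X : Derivation F B B) (p : B →ₐ[F] F) (a : B) :
    constantCoeff (flow X p a) = p a := constantCoeff_flowLinear X p a

end Flow

end Alg

open PowerSeries (derivative constantCoeff)

namespace Alg

/-! ### Algebraicity of formal curves -/

section Algebraicity

variable {F : Type*} [Field F] {A : Type*} [CommRing A] [Algebra F A]
  {r₀ n₀ : A} {b : Module.Basis (Fin 2) A (Ω[A⁄F])}
  (hb0 : b 0 = KaehlerDifferential.D F A r₀) (hb1 : b 1 = KaehlerDifferential.D F A n₀)
include hb0 hb1

/-- If the coordinates take values in a field `K`, all functions take values algebraic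
over `K`. -/
lemma isAlgebraic_of_coord {K L : Type*} [Field K] [Field L] [Algebra F K] [Algebra K L]
    [Algebra F L] [IsScalarTower F K L] [Algebra.FiniteType F A] (φ : A →ₐ[F] L) {c₀ c₁ : K}
    (h0 : φ r₀ = algebraMap K L c₀) (h1 : φ n₀ = algebraMap K L c₁) (a : A) :
    IsAlgebraic K (φ a) := by
  obtain ⟨s, hs⟩ := Algebra.FiniteType.out (R := F) (A := A)
  set E : IntermediateField K L := IntermediateField.adjoin K (φ '' (s : Set A)) with hE
  have hmem : ∀ a, φ a ∈ E := by
    have : Algebra.adjoin F (s : Set A) ≤ (E.toSubalgebra.restrictScalars F).comap φ :=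
      Algebra.adjoin_le fun x hx => IntermediateField.subset_adjoin K _ ⟨x, hx, rfl⟩
    intro a
    exact this (hs ▸ Algebra.mem_top)
  have hfin : Algebra.EssFiniteType K E :=
    IntermediateField.essFiniteType_iff.2
      (IntermediateField.fg_adjoin_of_finite (s.finite_toSet.image φ))
  let φE : A →ₐ[F] E := φ.codRestrict (E.toSubalgebra.restrictScalars F) hmem
  let D : Derivation F E (Ω[E⁄K]) := (KaehlerDifferential.D K E).restrictScalars F
  let _ : Module A (Ω[E⁄K]) := Module.compHom _ (φE : A →+* E)
  have hsmul : ∀ (x : A) (y : Ω[E⁄K]), x • y = φE x • y := fun _ _ => rfl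
  -- Through `φE` the differentials of `E` over `K` form an `A`-module, and `D'` is the universal
  -- derivation of `E` restricted to `A`.
  have : IsScalarTower F A (Ω[E⁄K]) := ⟨fun c x y => by
    rw [hsmul, hsmul, map_smul, smul_assoc]⟩
  let D' : Derivation F A (Ω[E⁄K]) := Derivation.mk' (D.toLinearMap ∘ₗ φE.toLinearMap)
    fun x y => by
      rw [hsmul, hsmul]
      simp
  -- The images of `r₀` and `n₀` are constants of `K`, and their differentials span those of `A`.
  have hD' : D' = 0 := by
    refine derivation_eq_zero hb0 hb1 D' ?_ ?_
    · have : φE r₀ = algebraMap K E c₀ := Subtype.ext h0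
      change KaehlerDifferential.D K E (φE r₀) = 0
      rw [this, Derivation.map_algebraMap]
    · have : φE n₀ = algebraMap K E c₁ := Subtype.ext h1
      change KaehlerDifferential.D K E (φE n₀) = 0
      rw [this, Derivation.map_algebraMap]
  have hD : ∀ x : E, KaehlerDifferential.D K E x = 0 := by
    rintro ⟨x, hx⟩
    induction hx using IntermediateField.adjoin_induction with
    | mem x hx =>
      obtain ⟨a, _, rfl⟩ := hx
      exact DFunLike.congr_fun hD' a
    | algebraMap c => exact Derivation.map_algebraMap _ c
    | add x y hx hy ihx ihy =>
      have := map_add (KaehlerDifferential.D K E) ⟨x, hx⟩ ⟨y, hy⟩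
      rw [ihx, ihy, add_zero] at this
      exact this
    | inv x hx ih =>
      have := (KaehlerDifferential.D K E).leibniz_inv ⟨x, hx⟩
      rw [ih, smul_zero] at this
      exact this
    | mul x y hx hy ihx ihy =>
      have := (KaehlerDifferential.D K E).leibniz ⟨x, hx⟩ ⟨y, hy⟩
      rw [ihx, ihy, smul_zero, smul_zero, add_zero] at this
      exact this
  -- An essentially finite field extension without differentials is separable algebraic.
  have : Algebra.FormallyUnramified K E := by
    refine ⟨Submodule.subsingleton_iff E |>.1 ?_⟩
    refine subsingleton_of_bot_eq_top ?_
    rw [← KaehlerDifferential.span_range_derivation, eq_comm, Submodule.span_eq_bot]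
    rintro _ ⟨x, rfl⟩
    exact hD x
  have := Algebra.FormallyUnramified.isSeparable K E
  have h := (Algebra.IsSeparable.isAlgebraic K E).isAlgebraic (φE a)
  exact h.algHom E.val

/-- The field statement is applied to the fraction fields of `F[t]` and `F[[t]]`, and algebraicity
then descends. -/
lemma isAlgebraic_powerSeries [Algebra.FiniteType F A] (φ : A →ₐ[F] PowerSeries F)
    {c₀ c₁ : Polynomial F} (h0 : φ r₀ = c₀) (h1 : φ n₀ = c₁) (a : A) :
    IsAlgebraic (Polynomial F) (φ a) := by
  have hinj : Function.Injective (algebraMap (Polynomial F) (PowerSeries F)) :=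
    Polynomial.coe_injective F
  let L := FractionRing (PowerSeries F)
  have hinjL : Function.Injective (algebraMap (Polynomial F) L) := by
    rw [IsScalarTower.algebraMap_eq (Polynomial F) (PowerSeries F) L]
    exact (IsFractionRing.injective (PowerSeries F) L).comp hinj
  have : FaithfulSMul (Polynomial F) L := (faithfulSMul_iff_algebraMap_injective _ _).2 hinjL
  let K := FractionRing (Polynomial F)
  let : Algebra K L := FractionRing.liftAlgebra (Polynomial F) L
  have : IsScalarTower (Polynomial F) K L := FractionRing.isScalarTower_liftAlgebra _ _
  have : IsScalarTower F (Polynomial F) L := IsScalarTower.of_algebraMap_eq fun c => by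
    rw [IsScalarTower.algebraMap_apply (Polynomial F) (PowerSeries F) L,
      IsScalarTower.algebraMap_apply F (PowerSeries F) L]
    congr 1
    exact (Polynomial.coe_C c).symm
  have : IsScalarTower F K L := IsScalarTower.of_algebraMap_eq fun c => by
    rw [IsScalarTower.algebraMap_apply F (Polynomial F) L,
      IsScalarTower.algebraMap_apply F (Polynomial F) K,
      ← IsScalarTower.algebraMap_apply (Polynomial F) K L]
  let ψ : A →ₐ[F] L := (IsScalarTower.toAlgHom F (PowerSeries F) L).comp φ
  have hc : ∀ {x : A} {c : Polynomial F}, φ x = c →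
      ψ x = algebraMap K L (algebraMap (Polynomial F) K c) := fun {x c} h => by
    change algebraMap (PowerSeries F) L (φ x) = _
    rw [h, ← IsScalarTower.algebraMap_apply,
      IsScalarTower.algebraMap_apply (Polynomial F) (PowerSeries F) L]
    rfl
  have h := isAlgebraic_of_coord hb0 hb1 ψ (hc h0) (hc h1) a
  rw [← IsFractionRing.isAlgebraic_iff (Polynomial F) K L] at h
  exact (isAlgebraic_algebraMap_iff (IsFractionRing.injective (PowerSeries F) L)).1 h

end Algebraicity

/-! ### Focal orders -/

section Orders

variable {F : Type*} [Field F] [CharZero F] {A : Type*} [CommRing A] [Algebra F A] {k : ℕ}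
  {IP : Finset ℕ} {r₀ n₀ : A} {p : Func A k →ₐ[F] F}

omit [CharZero F] in
lemma FocalCurve.isFocalSeries {γ : Func A k →ₐ[F] PowerSeries F}
    (hγ : FocalCurve F k IP r₀ n₀ p γ) :
    IsFocalSeries IP k fun j => γ (coord k r₀ n₀ (j + 1)) :=
  isFocalSeries_of_focal (y := fun i => γ (coord k r₀ n₀ i)) hγ.focal

omit [CharZero F] in
lemma focalOrder_eq {a : Func A k} {γ : Func A k →ₐ[F] PowerSeries F}
    (hγ : FocalCurve F k IP r₀ n₀ p γ)
    (h : ∀ γ', FocalCurve F k IP r₀ n₀ p γ' → (γ a).order ≤ (γ' a).order) :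
    focalOrder F k IP r₀ n₀ p a = (γ a).order :=
  le_antisymm (iInf₂_le γ hγ) (le_iInf₂ h)

lemma verticalOrder_eq {γ : Func A k →ₐ[F] PowerSeries F} (hγ : FocalCurve F k IP r₀ n₀ p γ)
    (hx : IsGenericSeries IP k fun j => γ (coord k r₀ n₀ (j + 1))) {j : ℕ} (hj : j ≤ k) :
    verticalOrder F k IP r₀ n₀ p j = if j ∈ IP then (γ (coord k r₀ n₀ (j + 1))).order else 0 := by
  unfold verticalOrder divisorEq
  split_ifs with h
  · refine focalOrder_eq hγ fun γ' hγ' => hx.order_le hγ'.isFocalSeries (fun j _ => ?_) hj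
    rw [hγ.start, hγ'.start]
  · have e : ∀ γ' : Func A k →ₐ[F] PowerSeries F, (γ' 1).order = 0 := fun γ' => by
      rw [map_one, PowerSeries.order_one]
    rw [focalOrder_eq hγ fun γ' _ => by rw [e, e], e]

/-- The power series which are polynomials. -/
abbrev polynomialSeries (F : Type*) [Field F] : Subring (PowerSeries F) :=
  (Polynomial.coeToPowerSeries.ringHom (R := F)).range

lemma mem_polynomialSeries_of_derivative {s : PowerSeries F}
    (h : derivative F s ∈ polynomialSeries F) : s ∈ polynomialSeries F := by
  obtain ⟨q, hq⟩ := h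
  obtain ⟨r, hr, hr'⟩ := exists_derivative_eq q (constantCoeff s)
  refine ⟨r, PowerSeries.derivative.ext ?_ ?_⟩
  · rw [Polynomial.coeToPowerSeries.ringHom_apply, PowerSeries.derivative_coe, hr, ← hq]
    rfl
  · rw [Polynomial.coeToPowerSeries.ringHom_apply, Polynomial.constantCoeff_coe, ← hr',
      Polynomial.coeff_zero_eq_eval_zero]

omit [CharZero F] in
lemma tailProd_mem (S : Subring (PowerSeries F)) {n : ℕ → PowerSeries F} {j : ℕ}
    (h : ∀ l, j < l → l ≤ k → n l ∈ S) : tailProd IP k n j ∈ S :=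
  prod_mem fun l hl => by
    simp only [Finset.mem_filter, Finset.mem_Ioc] at hl
    exact h l hl.1.1 hl.1.2

lemma IsGenericSeries.mem_polynomialSeries {x : ℕ → PowerSeries F} (hx : IsGenericSeries IP k x)
    {j : ℕ} (hj : j ≤ k) : x j ∈ polynomialSeries F := by
  induction h : k - j using Nat.strongRecOn generalizing j with
  | ind m ih =>
    apply mem_polynomialSeries_of_derivative
    rcases hj.eq_or_lt with rfl | hlt
    · rw [hx.top]
      exact one_mem _
    · rw [hx.lt j hlt]
      refine mul_mem ?_ (tailProd_mem _ fun l h1 h2 => ih (k - l) (by omega) h2 rfl)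
      split_ifs
      · exact one_mem _
      · exact ih (k - (j + 1)) (by omega) (by omega) rfl

variable {b : Module.Basis (Fin 2) A (Ω[A⁄F])}
  (hb0 : b 0 = KaehlerDifferential.D F A r₀) (hb1 : b 1 = KaehlerDifferential.D F A n₀)
include hb0 hb1

/-- The curve must be a homomorphism on all of `A`, not just values of coordinates, so it is taken
as the formal flow of `g_0 + g_1`. The same triangular system makes its coordinates polynomial. -/
lemma exists_generic_curve [Algebra.FiniteType F A] (IP : Finset ℕ) (p : Func A k →ₐ[F] F) :
    ∃ γ, FocalCurve F k IP r₀ n₀ p γ ∧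
      IsGenericSeries IP k fun j => γ (coord k r₀ n₀ (j + 1)) := by
  have hf := isFrame (k := k) hb0 hb1
  set Y : Derivation F (Func A k) (Func A k) :=
    gField F k IP r₀ n₀ b 0 + gField F k IP r₀ n₀ b 1 with hY
  have hYf : Y ∈ focal F k IP r₀ n₀ :=
    add_mem (g_mem_focal hb0 hb1 IP 0) (g_mem_focal hb0 hb1 IP 1)
  have hYtop : Y (coord k r₀ n₀ (k + 1)) = 1 := by
    have h1 := hf.act_stdF_of_lt IP (show k < k + 1 by omega) le_rfl
    have h2 := hf.act_d (k + 1) (k + 1) le_rfl le_rfl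
    rw [if_pos rfl] at h2
    exact (congrArg₂ (· + ·) h1 h2).trans (zero_add _)
  have hYlt : ∀ j < k, Y (coord k r₀ n₀ (j + 1)) =
      derivCoeff IP k (fun l => coord k r₀ n₀ (l + 1)) j := fun j hj => by
    have h1 := hf.act_stdF_n IP hj le_rfl
    have h2 := hf.act_d (k + 1) (j + 1) le_rfl (by omega)
    rw [if_neg (by omega)] at h2
    exact (congrArg₂ (· + ·) h1 h2).trans (add_zero _)
  have hY0 : Y (coord k r₀ n₀ 0) = tailProd IP k (fun l => coord k r₀ n₀ (l + 1)) 0 := by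
    have h1 := hf.act_stdF_zero IP (show k ≤ k + 1 by omega)
    have h2 := hf.act_d (k + 1) 0 le_rfl (by omega)
    rw [if_neg (by omega)] at h2
    exact (congrArg₂ (· + ·) h1 h2).trans (add_zero _)
  set γ := flow Y p with hγ
  have hgen : IsGenericSeries IP k fun j => γ (coord k r₀ n₀ (j + 1)) := by
    refine ⟨?_, fun j hj => ?_⟩
    · rw [derivative_flow, hYtop, map_one]
    · rw [derivative_flow, hYlt j hj, map_derivCoeff]
  have hpoly : ∀ i ≤ k + 1, γ (coord k r₀ n₀ i) ∈ polynomialSeries F := by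
    intro i hi
    cases i with
    | zero =>
      apply mem_polynomialSeries_of_derivative
      rw [derivative_flow, hY0, map_tailProd]
      exact tailProd_mem _ fun l _ h2 => IsGenericSeries.mem_polynomialSeries hgen h2
    | succ i => exact IsGenericSeries.mem_polynomialSeries hgen (by omega)
  refine ⟨γ, ⟨fun a => ?_, fun a => constantCoeff_flow Y p a, ⟨coord k r₀ n₀ (k + 1), ?_⟩,
    fun j hj => ?_⟩, hgen⟩
  · obtain ⟨c₀, hc₀⟩ := hpoly 0 (by omega)
    obtain ⟨c₁, hc₁⟩ := hpoly 1 (by omega)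
    induction a using MvPolynomial.induction_on with
    | C a =>
      exact isAlgebraic_powerSeries hb0 hb1
        (γ.comp (IsScalarTower.toAlgHom F A (Func A k))) hc₀.symm hc₁.symm a
    | add p q hp hq => rw [map_add]; exact hp.add hq
    | mul_X q i hq =>
      rw [map_mul]
      refine hq.mul ?_
      obtain ⟨c, hc⟩ := hpoly (i + 2) (by omega)
      rw [coord, dif_pos i.2] at hc
      rw [← hc]
      exact isAlgebraic_algebraMap c
  · have := congrArg (PowerSeries.coeff 0) hgen.top
    rw [PowerSeries.coeff_derivative] at this
    intro h
    rw [zero_add, h] at this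
    simp at this
  · rw [derivative_flow, derivative_flow, hYf j hj, map_mul]

theorem exists_bracket [Algebra.FiniteType F A] (hIP : IP ⊆ Finset.Icc 1 k)
    (p : Func A k →ₐ[F] F) (h i : ℕ) (hi : 3 ≤ i) (hih : i ≤ min h (k + 1)) :
    ∃ f : Derivation F (Func A k) (Func A k),
      (∃ ε : List (Fin 2), ε.length ≤ h - 3 ∧
        f = iterBracket (fun X Y => ⁅X, Y⁆) (gField F k IP r₀ n₀ b) ε) ∧
      f ∈ smallGrowth F k IP r₀ n₀ h ∧
      (∃ w c, StructureForm F k IP r₀ n₀ b h f w c) ∧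
      ∀ w c, StructureForm F k IP r₀ n₀ b h f w c →
        focalOrder F k IP r₀ n₀ p (c i) = eInv k (verticalOrder F k IP r₀ n₀ p) h i := by
  have hk : 2 ≤ k := by omega
  obtain ⟨γ, hγ, hx⟩ := exists_generic_curve hb0 hb1 IP p
  obtain ⟨l, hl, h1, h2⟩ := hx.exists_word hi (hih.trans (min_le_left _ _))
    (hih.trans (min_le_right _ _)) (VO := verticalOrder F k IP r₀ n₀ p)
    fun j _ hj => verticalOrder_eq hγ hx hj
  have hl' : l.length + 3 ≤ h := by omega
  refine ⟨_, ⟨l, hl, rfl⟩, ?_, exists_structureForm hb0 hb1 hIP hk l hl', fun w c hc => ?_⟩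
  · obtain ⟨h, rfl⟩ : ∃ h', h = h' + 1 := ⟨h - 1, by omega⟩
    exact smallGrowth_mono (h := l.length + 2) (by omega)
      (iterBracket_mem_smallGrowth hb0 hb1 hIP hk l)
  · rw [hc.coeff_eq hb0 hb1 hk hl' hi hih]
    have e : ∀ γ' : Func A k →ₐ[F] PowerSeries F, γ' (wordCoeff k IP r₀ n₀ l i) =
        evalN (fun j => γ' (coord k r₀ n₀ (j + 1))) (coeffPoly IP k l i) := fun γ' =>
      map_evalN _ γ'.toRingHom _
    rw [← h1, ← e γ]
    refine focalOrder_eq hγ fun γ' hγ' => ?_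
    rw [e γ, e γ', h1]
    refine h2 _ hγ'.isFocalSeries fun j _ => ?_
    rw [hγ.start, hγ'.start]

end Orders

end Alg

end Goursat

end

theorem mainTheorem3 :
    -- smooth manifolds (`𝕜 = ℝ`) and complex manifolds (`𝕜 = ℂ`)
    (∀ (𝕜 : Type*) [RCLike 𝕜] (k : ℕ) (IP : Finset ℕ) (_ : IP ⊆ Finset.Icc 1 k)
      (U : Set (𝕜 × 𝕜)) (_ : IsOpen U)
      (p : Goursat.Mfd.Space 𝕜 k) (_ : p ∈ Goursat.Mfd.chart 𝕜 k U)
      (h i : ℕ) (_ : 3 ≤ h) (_ : 3 ≤ i) (_ : i ≤ min h (k + 1)),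
      ∃ f : Goursat.Mfd.Space 𝕜 k → Goursat.Mfd.Space 𝕜 k,
        (∃ ε : List (Fin 2), ε.length ≤ h - 3 ∧
          f = Goursat.iterBracket (VectorField.lieBracket 𝕜) (Goursat.Mfd.gField 𝕜 k IP) ε) ∧
        Goursat.Mfd.SmallGrowth 𝕜 k IP h (Goursat.Mfd.chart 𝕜 k U) f ∧
        (∃ w c, Goursat.Mfd.StructureForm 𝕜 k IP (Goursat.Mfd.chart 𝕜 k U) h f w c) ∧
        ∀ w c, Goursat.Mfd.StructureForm 𝕜 k IP (Goursat.Mfd.chart 𝕜 k U) h f w c →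
          Goursat.Mfd.focalOrder 𝕜 k IP p (c i) =
            Goursat.eInv k (Goursat.Mfd.verticalOrder 𝕜 k IP p) h i) ∧
    -- nonsingular varieties over an algebraically closed field of characteristic zero
    (∀ (F : Type*) [Field F] [IsAlgClosed F] [CharZero F] (A : Type*) [CommRing A] [Algebra F A]
      [Algebra.Smooth F A] (r₀ n₀ : A) (b : Module.Basis (Fin 2) A (KaehlerDifferential F A))
      (_ : b 0 = KaehlerDifferential.D F A r₀) (_ : b 1 = KaehlerDifferential.D F A n₀)
      (k : ℕ) (IP : Finset ℕ) (_ : IP ⊆ Finset.Icc 1 k)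
      (p : Goursat.Alg.Func A k →ₐ[F] F)
      (h i : ℕ) (_ : 3 ≤ h) (_ : 3 ≤ i) (_ : i ≤ min h (k + 1)),
      ∃ f : Derivation F (Goursat.Alg.Func A k) (Goursat.Alg.Func A k),
        (∃ ε : List (Fin 2), ε.length ≤ h - 3 ∧
          f = Goursat.iterBracket (fun X Y => ⁅X, Y⁆) (Goursat.Alg.gField F k IP r₀ n₀ b) ε) ∧
        f ∈ Goursat.Alg.smallGrowth F k IP r₀ n₀ h ∧
        (∃ w c, Goursat.Alg.StructureForm F k IP r₀ n₀ b h f w c) ∧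
        ∀ w c, Goursat.Alg.StructureForm F k IP r₀ n₀ b h f w c →
          Goursat.Alg.focalOrder F k IP r₀ n₀ p (c i) =
            Goursat.eInv k (Goursat.Alg.verticalOrder F k IP r₀ n₀ p) h i) := by
  refine ⟨fun 𝕜 _ k IP hIP U hU p hp h i _ hi hih =>
    Goursat.Mfd.exists_bracket 𝕜 IP hIP U hU p hp h i hi hih, ?_⟩
  intro F _ _ _ A _ _ _ r₀ n₀ b hb0 hb1 k IP hIP p h i _ hi hih
  exact Goursat.Alg.exists_bracket hb0 hb1 hIP p h i hi hih
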